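/- Let $M$ be a smooth manifold of dimension $n\ge 3$, $TM_0=TM\setminus\{0\}$, and let $F:TM\to[0,\infty)$ be a Finsler metric: $F$ is $C^\infty$ on $TM_0$, positively homogeneous of degree one on the fibres, and $g_{ij}=\frac12\,\partial^2F^2/\partial y^i\partial y^j$ is positive definite on $TM_0$. Put $C_{ijk}=\frac12\,\partial g_{ij}/\partial y^k$, $I_i=g^{jk}C_{ijk}$, $\|I\|^2=g^{ij}I_iI_j$, $y_i=g_{ij}y^j$, $h_{ij}=g_{ij}-F^{-2}y_iy_j$, and $G^i=\frac14 g^{il}\{\frac{\partial^2F^2}{\partial x^k\partial y^l}y^k-\frac{\partial F^2}{\partial x^l}\}$. Let ${}_{|}$ denote the horizontal covariant derivative of the Berwald connection, $L_{ijk}=C_{ijk|s}y^s$ and $\Sigma_{ijkl}=2(L_{ijk|l}-L_{ijl|k})$. Suppose that * $F$ is an $(\alpha,\beta)$-metric, i.e. $F=\alpha\,\phi(\beta/\alpha)$ on $TM_0$, where $\alpha$ is (the norm of) a smooth Riemannian metric, $\beta$ is a smooth 1-form with $|\beta/\alpha|<b_0$ on $TM_0$, and $\phi$ is a positive $C^\infty$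 function on $(-b_0,b_0)$, $0<b_0\le\infty$; * $F$ is not Riemannian; * $F$ has constant flag curvature $\kappa\neq0$; * $F$ has nonzero relative stretch curvature, i.e. $\Sigma_{ijkl}=cF\,(C_{ijk|l}-C_{ijl|k})$ on $TM_0$ for some function $c=c(x,y)$ on $TM_0$ that is not identically zero. Then the Cartan torsion of $F$ is semi-C-reducible: there are functions $p,q$ such that, at every point of the set $U=\{(x,y)\in TM_0: I_{(x,y)}\ne0\}$, $p+q=1$ and $$C_{ljm}=\frac{p}{n+1}\,(I_lh_{jm}+I_jh_{lm}+I_mh_{jl})+\frac{q}{\|I\|^2}\,I_lI_jI_m .$$ Moreover, for all such $p,q$, the characteristic scalar $p$ is $C^\infty$ on $U$ and constant along the geodesics of $F$: $p'=p_{|s}y^s=0$ on $U$, and for every geodesic $\sigma:J\to M$ of $F$ on an open interval $J$ ($\ddot\sigma^i+2G^i(\sigma,\dot\sigma)=0$ and $\dot\sigma\neq0$) with $\dot\sigma(t)\in U$ for all $t\in J$, the function $t\mapsto p(\dot\sigma(t))$ is constant on $J$. -/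

import Mathlib

open scoped Manifold ContDiff

noncomputable section

namespace Finsler

/-- The coordinate space `ℝⁿ`, which is the model space of all manifolds below. -/
abbrev Coord (n : ℕ) := EuclideanSpace ℝ (Fin n)

/-- The standard basis vector `e_i` of `ℝⁿ`. -/
abbrev stdVec {n : ℕ} (i : Fin n) : Coord n := EuclideanSpace.single i (1 : ℝ)

/-! ### Fibrewise notions

Here `f : ℝⁿ → ℝ` is the restriction of a Finsler metric to one tangent space, written in linear
coordinates. -/

section Fibre

variable {n : ℕ}

/-- The fundamental form `g_y(u,v) = ½ ∂²/∂s∂t f²(y + s u + t v)` at `s = t = 0`. -/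
def fundForm (f : Coord n → ℝ) (y u v : Coord n) : ℝ :=
  (1 / 2) * lineDeriv ℝ (fun z => lineDeriv ℝ (fun z' => f z' ^ 2) z v) y u

/-- The Cartan torsion `C_y(u,v,w) = ½ d/dt g_{y + t w}(u,v)` at `t = 0`. -/
def cartan (f : Coord n → ℝ) (y u v w : Coord n) : ℝ :=
  (1 / 2) * lineDeriv ℝ (fun z => fundForm f z u v) y w

/-- The matrix `g_ij(y)`. -/
def gramMatrix (f : Coord n → ℝ) (y : Coord n) : Matrix (Fin n) (Fin n) ℝ :=
  Matrix.of fun i j => fundForm f y (stdVec i) (stdVec j)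

/-- The inverse matrix `g^ij(y)`. -/
def gramInv (f : Coord n → ℝ) (y : Coord n) : Matrix (Fin n) (Fin n) ℝ :=
  (gramMatrix f y)⁻¹

/-- The mean Cartan torsion `I_y(u) = g^jk(y) C_y(u, e_j, e_k)`, the `g_y`-trace of `C_y(u,·,·)`
(it does not depend on the linear coordinates). -/
def meanCartan (f : Coord n → ℝ) (y u : Coord n) : ℝ :=
  ∑ j, ∑ k, gramInv f y j k * cartan f y u (stdVec j) (stdVec k)

/-- `‖I‖² = I_k I^k = g^jk I_j I_k`. -/
def meanCartanNormSq (f : Coord n → ℝ) (y : Coord n) : ℝ :=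
  ∑ j, ∑ k, gramInv f y j k * meanCartan f y (stdVec j) * meanCartan f y (stdVec k)

/-- The angular form `h_y(u,v) = g_y(u,v) - F⁻² g_y(y,u) g_y(y,v)`, in components
`h_ij = g_ij - F⁻² y_i y_j`. -/
def angular (f : Coord n → ℝ) (y u v : Coord n) : ℝ :=
  fundForm f y u v - fundForm f y y u * fundForm f y y v / f y ^ 2

end Fibre

/-! ### Local formulas

Here `f : ℝⁿ → ℝⁿ → ℝ`, `(x, y) ↦ f x y`, is a Finsler metric in the standard local coordinates
`(x, y)` of the tangent bundle given by a chart. -/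

section Local

variable {n : ℕ}

/-- `∂φ/∂x^k`. -/
def dX (k : Fin n) (φ : Coord n → Coord n → ℝ) (x y : Coord n) : ℝ :=
  lineDeriv ℝ (fun z => φ z y) x (stdVec k)

/-- `∂φ/∂y^k`. -/
def dY (k : Fin n) (φ : Coord n → Coord n → ℝ) (x y : Coord n) : ℝ :=
  lineDeriv ℝ (fun z => φ x z) y (stdVec k)

/-- The spray coefficients
`G^i = ¼ g^il (∂²F²/∂x^k∂y^l y^k - ∂F²/∂x^l)`. -/
def sprayCoeff (f : Coord n → Coord n → ℝ) (i : Fin n) (x y : Coord n) : ℝ :=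
  (1 / 4) * ∑ l, gramInv (f x) y i l *
    ((∑ k, dX k (dY l (fun x' y' => f x' y' ^ 2)) x y * y k) - dX l (fun x' y' => f x' y' ^ 2) x y)

/-- `N^i_k = ∂G^i/∂y^k`. -/
def nonlinConn (f : Coord n → Coord n → ℝ) (i k : Fin n) (x y : Coord n) : ℝ :=
  dY k (sprayCoeff f i) x y

/-- The coefficients `Γ^i_jk = ∂²G^i/∂y^j∂y^k` of the Berwald connection. -/
def berwaldConn (f : Coord n → Coord n → ℝ) (i j k : Fin n) (x y : Coord n) : ℝ :=
  dY j (dY k (sprayCoeff f i)) x y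

/-- The horizontal derivative `φ_{|k} = ∂φ/∂x^k - N^m_k ∂φ/∂y^m` of a scalar function. -/
def horizDeriv (f : Coord n → Coord n → ℝ) (k : Fin n) (φ : Coord n → Coord n → ℝ)
    (x y : Coord n) : ℝ :=
  dX k φ x y - ∑ m, nonlinConn f m k x y * dY m φ x y

/-- The horizontal covariant derivative `T_{ijk|l}`, with respect to the Berwald connection, of a
covariant 3-tensor `T_ijk(x, y)`. -/
def horizCov (f : Coord n → Coord n → ℝ) (T : Fin n → Fin n → Fin n → Coord n → Coord n → ℝ)
    (i j k l : Fin n) (x y : Coord n) : ℝ :=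
  horizDeriv f l (T i j k) x y
    - ∑ m, berwaldConn f m i l x y * T m j k x y
    - ∑ m, berwaldConn f m j l x y * T i m k x y
    - ∑ m, berwaldConn f m k l x y * T i j m x y

/-- The components `C_ijk(x, y)` of the Cartan torsion. -/
def cartanCoeff (f : Coord n → Coord n → ℝ) (i j k : Fin n) (x y : Coord n) : ℝ :=
  cartan (f x) y (stdVec i) (stdVec j) (stdVec k)

/-- The components `L_ijk = C_{ijk|s} y^s` of the Landsberg curvature. -/
def landsbergCoeff (f : Coord n → Coord n → ℝ) (i j k : Fin n) (x y : Coord n) : ℝ :=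
  ∑ s, horizCov f (cartanCoeff f) i j k s x y * y s

/-- The components `Σ_ijkl = 2 (L_{ijk|l} - L_{ijl|k})` of the stretch curvature. -/
def stretchCoeff (f : Coord n → Coord n → ℝ) (i j k l : Fin n) (x y : Coord n) : ℝ :=
  2 * (horizCov f (landsbergCoeff f) i j k l x y - horizCov f (landsbergCoeff f) i j l k x y)

/-- The components of the Riemann curvature,
`R^i_k = 2 ∂G^i/∂x^k - y^j ∂²G^i/∂x^j∂y^k + 2 G^j ∂²G^i/∂y^j∂y^k - ∂G^i/∂y^j ∂G^j/∂y^k`. -/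
def riemannCoeff (f : Coord n → Coord n → ℝ) (i k : Fin n) (x y : Coord n) : ℝ :=
  2 * dX k (sprayCoeff f i) x y
    - ∑ j, y j * dX j (dY k (sprayCoeff f i)) x y
    + 2 * ∑ j, sprayCoeff f j x y * dY j (dY k (sprayCoeff f i)) x y
    - ∑ j, dY j (sprayCoeff f i) x y * dY k (sprayCoeff f j) x y

/-- The Riemann curvature as a linear endomorphism, `(R_y u)^i = R^i_k u^k`. -/
def riemann (f : Coord n → Coord n → ℝ) (x y u : Coord n) : Coord n :=
  WithLp.toLp 2 fun i => ∑ k, riemannCoeff f i k x y * u k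

/-- The flag curvature of the flag `span {y, u}` with flagpole `y`. -/
def flagCurvature (f : Coord n → Coord n → ℝ) (x y u : Coord n) : ℝ :=
  fundForm (f x) y u (riemann f x y u) /
    (fundForm (f x) y y y * fundForm (f x) y u u - fundForm (f x) y y u ^ 2)

/-- The derivative along geodesics `φ' = φ_{|s} y^s` of a scalar function. -/
def geodesicDeriv (f φ : Coord n → Coord n → ℝ) (x y : Coord n) : ℝ :=
  ∑ s, horizDeriv f s φ x y * y s

end Local

/-! ### Finsler metrics on manifolds -/

section Global

variable {n : ℕ} {M : Type*} [TopologicalSpace M] [ChartedSpace (Coord n) M]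

/-- The tangent bundle `TM` of an `n`-dimensional manifold. -/
abbrev TM (n : ℕ) (M : Type*) [TopologicalSpace M] [ChartedSpace (Coord n) M]
    [IsManifold 𝓘(ℝ, Coord n) ∞ M] : Type _ :=
  TangentBundle 𝓘(ℝ, Coord n) M

variable [IsManifold 𝓘(ℝ, Coord n) ∞ M]

/-- The local expression `(x, y) ↦ φ (y^i ∂/∂x^i at the point with coordinates x)` of a function on
`TM` in the coordinates given by a chart `e`; meaningful for `x` in `e.target`. -/
def inChart (e : OpenPartialHomeomorph M (Coord n)) (φ : TM n M → ℝ) (x y : Coord n) : ℝ :=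
  φ ⟨e.symm x, mfderiv 𝓘(ℝ, Coord n) 𝓘(ℝ, Coord n) e.symm x y⟩

/-- The restriction of a function on `TM` to the tangent space `T_x M` (whose underlying vector
space is, by definition, the model space). -/
def fibre (φ : TM n M → ℝ) (x : M) (y : Coord n) : ℝ := φ ⟨x, y⟩

/-- A Finsler metric: a nonnegative function on `TM`, smooth on `TM₀ = TM \ {0}`, positively
homogeneous of degree one on the fibres, with `g_y` positive definite for every `y ≠ 0`. -/
structure IsFinslerMetric (F : TM n M → ℝ) : Prop where
  nonneg : ∀ v, 0 ≤ F v
  smooth : ContMDiffOn 𝓘(ℝ, Coord n).tangent 𝓘(ℝ, ℝ) ∞ F {v | v.2 ≠ 0}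
  homog : ∀ (x : M) (y : TangentSpace 𝓘(ℝ, Coord n) x) (r : ℝ), 0 < r → F ⟨x, r • y⟩ = r * F ⟨x, y⟩
  posDef : ∀ (x : M) (y u : Coord n), y ≠ 0 → u ≠ 0 → 0 < fundForm (fibre F x) y u u

/-- Smooth Riemannian metrics on `M`. -/
abbrev RiemMetric (n : ℕ) (M : Type*) [TopologicalSpace M] [ChartedSpace (Coord n) M]
    [IsManifold 𝓘(ℝ, Coord n) ∞ M] :=
  Bundle.ContMDiffRiemannianMetric 𝓘(ℝ, Coord n) ∞ (Coord n)
    (fun x : M => TangentSpace 𝓘(ℝ, Coord n) x)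

/-- The norm `α(v) = √(a(v,v))` of a Riemannian metric. -/
def riemNorm (a : RiemMetric n M) (v : TM n M) : ℝ := √(a.inner v.1 v.2 v.2)

/-- `F` is Riemannian: it is the norm of a smooth Riemannian metric. -/
def IsRiemannian (F : TM n M → ℝ) : Prop :=
  ∃ a : RiemMetric n M, ∀ v, F v = riemNorm a v

/-- `F` is an `(α,β)`-metric: `F = α φ(β/α)` on `TM₀`, where `α` is a Riemannian metric, `β` is a
smooth 1-form with `|β/α| < b₀`, and `φ` is a positive smooth function on `(-b₀, b₀)`, with
`0 < b₀ ≤ ∞`. -/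
def IsAlphaBetaMetric (F : TM n M → ℝ) : Prop :=
  ∃ (a : RiemMetric n M) (β : (x : M) → TangentSpace 𝓘(ℝ, Coord n) x →L[ℝ] ℝ)
    (b₀ : EReal) (φ : ℝ → ℝ),
    ContMDiff 𝓘(ℝ, Coord n).tangent 𝓘(ℝ, ℝ) ∞ (fun v : TM n M => β v.1 v.2) ∧
    0 < b₀ ∧
    ContDiffOn ℝ ∞ φ {s : ℝ | ((|s| : ℝ) : EReal) < b₀} ∧
    (∀ s : ℝ, ((|s| : ℝ) : EReal) < b₀ → 0 < φ s) ∧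
    (∀ v : TM n M, v.2 ≠ 0 → ((|β v.1 v.2 / riemNorm a v| : ℝ) : EReal) < b₀) ∧
    ∀ v : TM n M, v.2 ≠ 0 → F v = riemNorm a v * φ (β v.1 v.2 / riemNorm a v)

/-- `F` has constant flag curvature `κ`. -/
def HasConstantFlagCurvature (F : TM n M → ℝ) (κ : ℝ) : Prop :=
  ∀ e ∈ IsManifold.maximalAtlas 𝓘(ℝ, Coord n) ∞ M, ∀ x ∈ e.target, ∀ y u : Coord n,
    LinearIndependent ℝ ![y, u] → flagCurvature (inChart e F) x y u = κ

/-- `F` has relative stretch curvature with ratio `c`: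
`Σ_ijkl = c F (C_{ijk|l} - C_{ijl|k})` on `TM₀`. -/
def HasRelativeStretchCurvature (F c : TM n M → ℝ) : Prop :=
  ∀ e ∈ IsManifold.maximalAtlas 𝓘(ℝ, Coord n) ∞ M, ∀ x ∈ e.target, ∀ y : Coord n, y ≠ 0 →
    ∀ i j k l : Fin n,
      stretchCoeff (inChart e F) i j k l x y =
        inChart e c x y * inChart e F x y *
          (horizCov (inChart e F) (cartanCoeff (inChart e F)) i j k l x y
            - horizCov (inChart e F) (cartanCoeff (inChart e F)) i j l k x y)

/-- The set of `v ∈ TM₀` at which the mean Cartan torsion `I` does not vanish. -/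
def torsionSet (F : TM n M → ℝ) : Set (TM n M) :=
  {v | v.2 ≠ 0 ∧ ∃ u : Coord n, meanCartan (fibre F v.1) v.2 u ≠ 0}

/-- The Cartan torsion of `F` is semi-C-reducible with scalars `p` and `q`: `p + q = 1` and
`C_ljm = p/(n+1) (I_l h_jm + I_j h_lm + I_m h_jl) + q/‖I‖² I_l I_j I_m`
wherever `I ≠ 0`. The scalar `p` is the characteristic scalar of `F`. -/
def IsSemiCReducible (F p q : TM n M → ℝ) : Prop :=
  ∀ v ∈ torsionSet F, p v + q v = 1 ∧
    let f := fibre F v.1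
    let y : Coord n := v.2
    ∀ u₁ u₂ u₃ : Coord n,
      cartan f y u₁ u₂ u₃ =
        p v / (n + 1) * (meanCartan f y u₁ * angular f y u₂ u₃
          + meanCartan f y u₂ * angular f y u₁ u₃ + meanCartan f y u₃ * angular f y u₂ u₁)
        + q v / meanCartanNormSq f y
          * (meanCartan f y u₁ * meanCartan f y u₂ * meanCartan f y u₃)

/-- The velocity vector `σ'(t) ∈ TM` of a curve. -/
def velocity (σ : ℝ → M) (t : ℝ) : TM n M :=
  ⟨σ t, mfderiv 𝓘(ℝ, ℝ) 𝓘(ℝ, Coord n) σ t (1 : ℝ)⟩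

/-- `σ`, restricted to the open interval `J`, is a geodesic of `F`: a regular `C²` curve that
satisfies `ẍ^i + 2 G^i(x, ẋ) = 0` in every chart. -/
structure IsGeodesicOn (F : TM n M → ℝ) (σ : ℝ → M) (J : Set ℝ) : Prop where
  isOpen : IsOpen J
  ordConnected : J.OrdConnected
  contMDiffOn : ContMDiffOn 𝓘(ℝ, ℝ) 𝓘(ℝ, Coord n) 2 σ J
  regular : ∀ t ∈ J, (velocity σ t : TM n M).2 ≠ 0
  geodesic_eq : ∀ e ∈ IsManifold.maximalAtlas 𝓘(ℝ, Coord n) ∞ M, ∀ t ∈ J, σ t ∈ e.source →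
    ∀ i : Fin n, (deriv (deriv fun s => e (σ s)) t) i
      + 2 * sprayCoeff (inChart e F) i (e (σ t)) (deriv (fun s => e (σ s)) t) = 0

end Global

end Finsler

end

/-!
The geodesic spray `X` of `F` differentiates tensors covariantly; write `'` for this derivative, so
that `C' = L`. If `F` has constant flag curvature `κ`, then `R^i_k = κ (F² δ^i_k - y^i y_k)`
(`IsLocalFinsler.R_eq_of_flagCurvature_eq`), and differentiating the Euler–Lagrange equations gives the
Jacobi-type equation `C'' = L' = -κ F² C` (`SprayAlgebra.D_D_C_of_R`). Contracting the stretch identity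
with `y^l` gives `2 L' = c F L`. Hence `-2 κ F² C = c F L`
(`IsLocalFinsler.cartanCoeff_landsbergCoeff`): where `C ≠ 0`, also `c ≠ 0`, and `C' = r C` with
`r = -2 κ F / c`.

Evaluating the identity of semi-C-reducibility on the vector `I^i` expresses `p` through the quotient
`C(I, I, I) / ‖I‖⁴` (`charScalar`, `IsMinkowskiNorm.eq_charScalar`); here `n ≥ 3` is needed. This
expression is smooth where `I ≠ 0`. It is built from `C` and the metric, which is parallel along `X`,
and its numerator and denominator both have degree four in `C`. So `C' = r C` implies `p' = 0`
(`IsLocalFinsler.exists_represents_charScalar`), and `p` is constant along geodesics, whose velocities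
are integral curves of `X` (`IsLocalFinsler.hasDerivAt_comp_geodesic`).

Semi-C-reducibility itself is a property of each tangent space. There an `(α,β)`-metric is invariant
under the `α`-isometries that preserve `β`, in particular under the reflections along the vectors
`α`-orthogonal to `y` and to the dual of `β`. This symmetry leaves room only for a combination of
`θ h` and `θ θ θ`, where `θ` is the part of `β` orthogonal to `y` (`exists_eq_semiC_of_invariant`), and
taking traces shows that `θ` is proportional to `I`.

The tensor calculus is carried out in an abstract algebra with commuting derivations
(`SprayAlgebra`), where it is pure algebra. The algebra of smooth functions on an open set of nonzero
tangent vectors (`smoothFun`, `IsLocalFinsler.sprayAlgebra`) is such an algebra, and all quantities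
of the statement are represented by its elements.
-/

namespace Finsler

/-! ### Matrices over an algebra with derivations -/

section DerivationMatrix

variable {A : Type*} [CommRing A] [Algebra ℝ A] {ι : Type*}

theorem map_derivation_mul [Fintype ι] (d : Derivation ℝ A A) (M N : Matrix ι ι A) :
    (M * N).map d = M.map d * N + M * N.map d := by
  ext i j
  simp only [Matrix.map_apply, Matrix.mul_apply, Matrix.add_apply, map_sum, Derivation.leibniz,
    smul_eq_mul, ← Finset.sum_add_distrib]
  exact Finset.sum_congr rfl fun _ _ => by ring

theorem map_derivation_smul (d : Derivation ℝ A A) (a : A) (M : Matrix ι ι A) :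
    (a • M).map d = d a • M + a • M.map d := by
  ext i j
  simp only [Matrix.map_apply, Matrix.smul_apply, Matrix.add_apply, Derivation.leibniz,
    smul_eq_mul]
  ring

theorem map_derivation_add (d : Derivation ℝ A A) (M N : Matrix ι ι A) :
    (M + N).map d = M.map d + N.map d := by
  ext i j
  simp

theorem map_derivation_sum (d : Derivation ℝ A A) {κ : Type*} (s : Finset κ)
    (M : κ → Matrix ι ι A) : (∑ k ∈ s, M k).map d = ∑ k ∈ s, (M k).map d := by
  ext i j
  simp [Matrix.sum_apply]

theorem derivation_sum_apply {κ : Type*} (s : Finset κ) (D : κ → Derivation ℝ A A) (a : A) :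
    (∑ k ∈ s, D k) a = ∑ k ∈ s, D k a := by
  classical
  induction s using Finset.induction_on with
  | empty => simp
  | insert k s hk ih => simp [Finset.sum_insert hk, ih]

theorem mul_left_cancel_of_ne_zero_real {r : ℝ} (hr : r ≠ 0) {a b : A}
    (h : algebraMap ℝ A r * a = algebraMap ℝ A r * b) : a = b :=
  ((isUnit_iff_ne_zero.2 hr).map (algebraMap ℝ A)).mul_left_cancel h

theorem two_mul_cancel {a b : A} (h : 2 * a = 2 * b) : a = b :=
  mul_left_cancel_of_ne_zero_real (r := 2) two_ne_zero (by simpa only [map_ofNat] using h)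

theorem three_mul_cancel {a b : A} (h : 3 * a = 3 * b) : a = b :=
  mul_left_cancel_of_ne_zero_real (r := 3) three_ne_zero (by simpa only [map_ofNat] using h)

end DerivationMatrix

/-! ### Spray algebras -/

open Matrix in
/-- The trilinear form `Σ T_{ijk} u^k v^i w^j`. -/
def cubicForm {n : ℕ} {A : Type*} [CommRing A] (T : Fin n → Matrix (Fin n) (Fin n) A)
    (u v w : Fin n → A) : A :=
  ∑ k, u k * (v ⬝ᵥ (T k *ᵥ w))

/-- The algebraic skeleton of a Finsler metric in local coordinates: an algebra of functions of
`(x, y)` with the commuting derivations `dx i = ∂/∂x^i` and `dy i = ∂/∂y^i`, the fibre coordinates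
`y`, the function `E = F²`, which satisfies Euler's identity of degree two, the spray coefficients
`G`, given implicitly by the geodesic equation, and an inverse of the `y`-Hessian of `E`. All tensor
identities below are formal consequences of these fields. The base coordinates `x` themselves are not
needed, so that the structure also covers a single Minkowski norm, with `dx = 0` and `G = 0`. -/
structure SprayAlgebra (n : ℕ) (A : Type*) [CommRing A] [Algebra ℝ A] where
  dx : Fin n → Derivation ℝ A A
  dy : Fin n → Derivation ℝ A A
  dx_dx : ∀ i j a, dx i (dx j a) = dx j (dx i a)
  dy_dy : ∀ i j a, dy i (dy j a) = dy j (dy i a)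
  dy_dx : ∀ i j a, dy i (dx j a) = dx j (dy i a)
  y : Fin n → A
  dx_y : ∀ i j, dx i (y j) = 0
  dy_y : ∀ i j, dy i (y j) = if i = j then 1 else 0
  E : A
  euler : ∑ i, y i * dy i E = 2 * E
  G : Fin n → A
  spray : ∀ i, 2 * ∑ m, dy i (dy m E) * G m = ∑ k, dx k (dy i E) * y k - dx i E
  ginv : Matrix (Fin n) (Fin n) A
  ginv_mul : ginv * Matrix.of (fun i j => dy i (dy j E)) = 1

open Matrix

namespace SprayAlgebra

variable {n : ℕ} {A : Type*} [CommRing A] [Algebra ℝ A] (S : SprayAlgebra n A)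

/-- The `y`-Hessian of `E = F²`, which is `2 g_ij`. -/
def hess : Matrix (Fin n) (Fin n) A := Matrix.of fun i j => S.dy i (S.dy j S.E)

/-- The nonlinear connection `N^i_k = ∂G^i/∂y^k`. -/
def N : Matrix (Fin n) (Fin n) A := Matrix.of fun i k => S.dy k (S.G i)

/-- The Berwald connection `Γ^i_jk = ∂²G^i/∂y^j∂y^k`, as a matrix in `i, j`. -/
def Γ (k : Fin n) : Matrix (Fin n) (Fin n) A := S.N.map (S.dy k)

/-- The third `y`-derivatives of `E = F²`, which are `4 C_ijk`, as a matrix in `i, j`. -/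
def C (k : Fin n) : Matrix (Fin n) (Fin n) A := S.hess.map (S.dy k)

/-- The geodesic spray `X = y^s ∂/∂x^s - 2 G^m ∂/∂y^m`. -/
def X : Derivation ℝ A A := ∑ s, S.y s • S.dx s - (2 : ℝ) • ∑ m, S.G m • S.dy m

theorem X_apply (a : A) :
    S.X a = ∑ s, S.y s * S.dx s a - 2 * ∑ m, S.G m * S.dy m a := by
  have h : ∀ b : A, (2 : ℝ) • b = 2 * b := fun b => by
    rw [Algebra.smul_def, map_ofNat]
  simp only [X, Derivation.sub_apply, Derivation.smul_apply, h, derivation_sum_apply, smul_eq_mul]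

theorem hess_apply (i j : Fin n) : S.hess i j = S.dy i (S.dy j S.E) := rfl

theorem N_apply (i j : Fin n) : S.N i j = S.dy j (S.G i) := rfl

theorem Γ_apply (k m i : Fin n) : S.Γ k m i = S.dy k (S.N m i) := rfl

theorem C_apply (k i j : Fin n) : S.C k i j = S.dy k (S.hess i j) := rfl

theorem hess_symm (i j : Fin n) : S.hess i j = S.hess j i := S.dy_dy _ _ _

theorem hess_transpose : S.hess.transpose = S.hess := by
  ext i j; exact S.hess_symm j i

theorem Γ_symm (k m i : Fin n) : S.Γ k m i = S.Γ i m k := S.dy_dy _ _ _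

theorem C_symm (k i j : Fin n) : S.C k i j = S.C k j i := by
  simp only [C_apply, S.hess_symm i j]

theorem C_symm' (k i j : Fin n) : S.C k i j = S.C i k j := S.dy_dy _ _ _

theorem ginv_mul_hess : S.ginv * S.hess = 1 := S.ginv_mul

theorem hess_mul_ginv : S.hess * S.ginv = 1 := mul_eq_one_comm.1 S.ginv_mul

theorem dy_X (i : Fin n) (a : A) :
    S.dy i (S.X a) = S.X (S.dy i a) + S.dx i a - 2 * ∑ m, S.N m i * S.dy m a := by
  have h2 : S.dy i 2 = 0 := by
    have := (S.dy i).map_natCast 2; simpa using this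
  simp only [X_apply, map_sub, map_sum, Derivation.leibniz, smul_eq_mul, h2, S.dy_y, S.dy_dx,
    Finset.sum_add_distrib, S.dy_dy i, N_apply]
  simp only [mul_ite, mul_one, mul_zero, Finset.sum_ite_eq, Finset.mem_univ, if_true, add_zero]
  rw [Finset.sum_congr rfl fun m _ => mul_comm (S.dy m a) (S.dy i (S.G m))]
  ring

theorem dx_X (i : Fin n) (a : A) :
    S.dx i (S.X a) = S.X (S.dx i a) - 2 * ∑ m, S.dx i (S.G m) * S.dy m a := by
  have h2 : S.dx i 2 = 0 := by
    have := (S.dx i).map_natCast 2; simpa using this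
  simp only [X_apply, map_sub, map_sum, Derivation.leibniz, smul_eq_mul, h2, S.dx_y, ← S.dy_dx,
    Finset.sum_add_distrib, S.dx_dx i]
  rw [Finset.sum_congr rfl fun m _ => mul_comm (S.dy m a) (S.dx i (S.G m))]
  simp only [mul_zero, add_zero, Finset.sum_const_zero]
  simp only [S.dy_dx]
  ring

/-- The Euler–Lagrange equation of the energy. -/
theorem X_dy_E (i : Fin n) : S.X (S.dy i S.E) = S.dx i S.E := by
  have h := S.spray i
  rw [X_apply]
  have h1 : ∑ m, S.G m * S.dy m (S.dy i S.E) = ∑ m, S.dy i (S.dy m S.E) * S.G m :=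
    Finset.sum_congr rfl fun m _ => by rw [S.dy_dy m i, mul_comm]
  have h2 : ∑ s, S.y s * S.dx s (S.dy i S.E) = ∑ s, S.dx s (S.dy i S.E) * S.y s :=
    Finset.sum_congr rfl fun m _ => by rw [mul_comm]
  rw [h1, h2, h]; ring

/-- The `y`-derivative of the Euler–Lagrange equation; its symmetric part says that the metric is
parallel along the spray, its skew part enters the symmetry of the Riemann curvature. -/
theorem X_hess_aux (i j : Fin n) :
    S.X (S.hess i j) = 2 * (S.hess * S.N) i j + S.dx i (S.dy j S.E) - S.dx j (S.dy i S.E) := by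
  have h := congrArg (S.dy j) (S.X_dy_E i)
  rw [dy_X, S.dy_dx] at h
  have h1 : ∑ m, S.N m j * S.dy m (S.dy i S.E) = (S.hess * S.N) i j := by
    rw [Matrix.mul_apply]
    exact Finset.sum_congr rfl fun m _ => by rw [hess_apply, S.dy_dy m i, mul_comm]
  rw [h1] at h
  rw [hess_apply, S.dy_dy]
  linear_combination h

theorem transpose_N_mul_hess : S.N.transpose * S.hess = (S.hess * S.N).transpose := by
  rw [Matrix.transpose_mul, hess_transpose]

/-- The metric is parallel along the spray. -/
theorem map_X_hess : S.hess.map S.X = S.N.transpose * S.hess + S.hess * S.N := by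
  ext i j
  rw [transpose_N_mul_hess]
  simp only [Matrix.map_apply, Matrix.add_apply, Matrix.transpose_apply]
  have h1 := S.X_hess_aux i j
  have h2 := S.X_hess_aux j i
  rw [S.hess_symm j i] at h2
  apply two_mul_cancel
  linear_combination h1 + h2

/-! ### Riemann curvature -/

/-- The Riemann curvature `R^i_k = 2 ∂G^i/∂x^k - X(N^i_k) - N^i_j N^j_k`. -/
def R : Matrix (Fin n) (Fin n) A :=
  Matrix.of (fun i k => 2 * S.dx k (S.G i)) - S.N.map S.X - S.N * S.N

theorem hess_mul_dx_G (i j : Fin n) :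
    2 * ∑ m, S.hess i m * S.dx j (S.G m) = S.X (S.dx j (S.dy i S.E)) - S.dx i (S.dx j S.E) := by
  have h := congrArg (S.dx j) (S.X_dy_E i)
  rw [dx_X, S.dx_dx j i] at h
  have h1 : ∑ m, S.dx j (S.G m) * S.dy m (S.dy i S.E) = ∑ m, S.hess i m * S.dx j (S.G m) :=
    Finset.sum_congr rfl fun m _ => by rw [hess_apply, S.dy_dy m i, mul_comm]
  rw [h1] at h
  linear_combination -h

/-- The Riemann curvature is self-adjoint. -/
theorem hess_mul_R_symm (i j : Fin n) : (S.hess * S.R) i j = (S.hess * S.R) j i := by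
  have key : ∀ i j, (S.hess * S.R) i j = S.X (S.dx j (S.dy i S.E)) - S.dx i (S.dx j S.E)
      - S.X ((S.hess * S.N) i j) + (S.N.transpose * S.hess * S.N) i j := by
    intro i j
    have h0 := congrFun (congrFun (map_derivation_mul S.X S.hess S.N) i) j
    rw [map_X_hess] at h0
    have h1 := S.hess_mul_dx_G i j
    have h2 : (S.hess * Matrix.of (fun i k => 2 * S.dx k (S.G i))) i j =
        2 * ∑ m, S.hess i m * S.dx j (S.G m) := by
      rw [Matrix.mul_apply, Finset.mul_sum]
      exact Finset.sum_congr rfl fun m _ => by simp only [Matrix.of_apply]; ring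
    rw [h1] at h2
    rw [R, mul_sub, mul_sub, Matrix.sub_apply, Matrix.sub_apply, h2]
    simp only [Matrix.map_apply, Matrix.add_apply, add_mul] at h0
    rw [h0, mul_assoc S.hess]
    ring
  have hs : (S.N.transpose * S.hess * S.N) i j = (S.N.transpose * S.hess * S.N) j i := by
    have : (S.N.transpose * S.hess * S.N).transpose = S.N.transpose * S.hess * S.N := by
      simp [Matrix.transpose_mul, hess_transpose, mul_assoc]
    exact congrFun (congrFun this.symm i) j
  rw [key, key, hs]
  have h1 := congrArg S.X (S.X_hess_aux i j)
  have h2 := congrArg S.X (S.X_hess_aux j i)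
  rw [S.hess_symm j i] at h2
  have hX2 : S.X 2 = 0 := by
    have := S.X.map_natCast 2; simpa using this
  simp only [map_add, map_sub, Derivation.leibniz, smul_eq_mul, hX2] at h1 h2
  rw [S.dx_dx i j]
  apply two_mul_cancel
  linear_combination h1 - h2

/-- The matrix `K^m_i` (for fixed `k`), which is minus the contraction `R_i^m_{kl} y^l` of the
horizontal curvature of the Berwald connection. -/
def K (k : Fin n) : Matrix (Fin n) (Fin n) A :=
  (S.Γ k).map S.X - S.N.map (S.dx k) + S.N * S.Γ k - S.Γ k * S.N

/-- The `y`-derivative of the Riemann curvature. -/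
theorem dy_R (i m k : Fin n) :
    S.dy i (S.R m k) = 2 * S.dx k (S.N m i) - S.dx i (S.N m k) - S.X (S.Γ k m i)
      + 2 * (S.Γ k * S.N) m i - (S.Γ i * S.N) m k - (S.N * S.Γ k) m i := by
  have h2 : S.dy i 2 = 0 := by
    have := (S.dy i).map_natCast 2; simpa using this
  have h0 := congrFun (congrFun (map_derivation_mul (S.dy i) S.N S.N) m) k
  simp only [Matrix.map_apply, Matrix.add_apply] at h0
  have h3 : ∑ l, S.N l i * S.dy l (S.N m k) = (S.Γ k * S.N) m i := by
    rw [Matrix.mul_apply]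
    exact Finset.sum_congr rfl fun l _ => by rw [S.Γ_symm, Γ_apply, mul_comm]
  have h4 : (S.N * S.N.map (S.dy i)) m k = (S.N * S.Γ k) m i := by
    rw [Matrix.mul_apply, Matrix.mul_apply]
    exact Finset.sum_congr rfl fun l _ => by rw [S.Γ_symm]; rfl
  simp only [R, Matrix.sub_apply, Matrix.of_apply, Matrix.map_apply, map_sub, h0, dy_X,
    Derivation.leibniz, h2, h3, h4, smul_eq_mul, S.dy_dx]
  rw [S.Γ_symm k m i, Γ_apply, N_apply S m i]
  simp only [Γ]
  ring

/-- The horizontal curvature is determined by the `y`-derivatives of the Riemann curvature. -/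
theorem three_K (i m k : Fin n) :
    3 * S.K k m i = -(2 * S.dy i (S.R m k) + S.dy k (S.R m i)) := by
  have h : (S.N * S.Γ i) m k = (S.N * S.Γ k) m i := by
    rw [Matrix.mul_apply, Matrix.mul_apply]
    exact Finset.sum_congr rfl fun l _ => by rw [S.Γ_symm]
  rw [dy_R, dy_R, S.Γ_symm i m k, h]
  simp only [K, Matrix.sub_apply, Matrix.add_apply, Matrix.map_apply]
  ring

/-! ### The Cartan torsion along the spray -/

/-- The dynamical covariant derivative `T_{ijk|s} y^s` of a covariant 3-tensor `T_ijk`, the matrix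
`T k` having the entries `T_ijk`. -/
def D (T : Fin n → Matrix (Fin n) (Fin n) A) (k : Fin n) : Matrix (Fin n) (Fin n) A :=
  (T k).map S.X - S.N.transpose * T k - T k * S.N - ∑ m, S.N m k • T m

/-- A formula for the Landsberg curvature, obtained by differentiating `map_X_hess` with respect to
`y^k`. -/
theorem D_C (k : Fin n) :
    S.D S.C k = -S.hess.map (S.dx k) + ∑ m, S.N m k • S.C m + (S.Γ k).transpose * S.hess
      + S.hess * S.Γ k := by
  have h1 : (S.hess.map S.X).map (S.dy k) =
      (S.C k).map S.X + S.hess.map (S.dx k) - (2 : A) • ∑ m, S.N m k • S.C m := by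
    ext i j
    simp only [Matrix.map_apply, dy_X, Matrix.sub_apply, Matrix.add_apply, Matrix.smul_apply,
      Matrix.sum_apply, smul_eq_mul, C]
  rw [map_X_hess, map_derivation_add, map_derivation_mul,
    map_derivation_mul, Matrix.transpose_map] at h1
  have h3 : (S.C k).map S.X = (S.Γ k).transpose * S.hess + S.N.transpose * S.C k
      + (S.C k * S.N + S.hess * S.Γ k) - S.hess.map (S.dx k)
      + (2 : A) • ∑ m, S.N m k • S.C m := by
    rw [Γ, C, h1]; simp only [C]; abel
  rw [D, h3, two_smul]
  abel

/-- The Jacobi-type equation for the Cartan torsion: its second derivative along the spray is an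
expression in the curvature. -/
theorem D_D_C (k : Fin n) :
    S.D (S.D S.C) k = -∑ m, S.R m k • S.C m + (S.K k).transpose * S.hess + S.hess * S.K k := by
  have hc : ∀ m, (S.C m).map S.X = S.D S.C m + S.N.transpose * S.C m + S.C m * S.N
      + ∑ l, S.N l m • S.C l := by
    intro m; rw [D]; abel
  have hx : (S.hess.map (S.dx k)).map S.X = (S.N.map (S.dx k)).transpose * S.hess
      + S.N.transpose * S.hess.map (S.dx k) + S.hess.map (S.dx k) * S.N
      + S.hess * S.N.map (S.dx k) + ∑ m, (2 * S.dx k (S.G m)) • S.C m := by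
    have h1 : (S.hess.map S.X).map (S.dx k) = (S.hess.map (S.dx k)).map S.X
        - ∑ m, (2 * S.dx k (S.G m)) • S.C m := by
      ext i j
      simp only [Matrix.map_apply, dx_X, Matrix.sub_apply, Matrix.smul_apply,
        Matrix.sum_apply, smul_eq_mul, C, Finset.mul_sum, mul_assoc]
    rw [map_X_hess, map_derivation_add, map_derivation_mul,
      map_derivation_mul, Matrix.transpose_map] at h1
    rw [eq_sub_iff_add_eq] at h1
    rw [← h1]; abel
  have hR : ∑ m, S.R m k • S.C m = ∑ m, (2 * S.dx k (S.G m)) • S.C m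
      - ∑ m, S.X (S.N m k) • S.C m - ∑ m, ∑ l, (S.N m k * S.N l m) • S.C l := by
    rw [Finset.sum_comm (f := fun m l => (S.N m k * S.N l m) • S.C l)]
    simp only [← Finset.sum_smul, ← Finset.sum_sub_distrib, ← sub_smul]
    refine Finset.sum_congr rfl fun m _ => ?_
    congr 1
    simp only [R, Matrix.sub_apply, Matrix.of_apply, Matrix.map_apply, Matrix.mul_apply]
    congr 1
    exact Finset.sum_congr rfl fun l _ => mul_comm _ _
  have e : ∀ M : Matrix (Fin n) (Fin n) A, (-M).map S.X = -M.map S.X := fun M => by ext; simp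
  have hDk : (S.D S.C k).map S.X = -(S.hess.map (S.dx k)).map S.X
      + (∑ m, S.X (S.N m k) • S.C m + ∑ m, S.N m k • (S.C m).map S.X)
      + (((S.Γ k).map S.X).transpose * S.hess + (S.Γ k).transpose * S.hess.map S.X)
      + (S.hess.map S.X * S.Γ k + S.hess * (S.Γ k).map S.X) := by
    rw [D_C]
    simp only [map_derivation_add, map_derivation_mul, map_derivation_sum,
      map_derivation_smul, Matrix.transpose_map, e, Finset.sum_add_distrib]
  have hN : ∑ m, S.N m k • (S.C m).map S.X = ∑ m, S.N m k • S.D S.C m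
      + S.N.transpose * (∑ m, S.N m k • S.C m) + (∑ m, S.N m k • S.C m) * S.N
      + ∑ m, ∑ l, (S.N m k * S.N l m) • S.C l := by
    simp only [hc, smul_add, Finset.sum_add_distrib, Finset.mul_sum, Finset.sum_mul,
      Matrix.mul_smul, Matrix.smul_mul, Finset.smul_sum, smul_smul]
  rw [D, hDk, hN, hx, hR, map_X_hess]
  rw [show S.N.transpose * S.D S.C k = S.N.transpose * (-S.hess.map (S.dx k)
    + ∑ m, S.N m k • S.C m + (S.Γ k).transpose * S.hess + S.hess * S.Γ k) by rw [D_C],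
    show S.D S.C k * S.N = (-S.hess.map (S.dx k) + ∑ m, S.N m k • S.C m
      + (S.Γ k).transpose * S.hess + S.hess * S.Γ k) * S.N by rw [D_C]]
  simp only [K, Matrix.transpose_sub, Matrix.transpose_add, Matrix.transpose_mul]
  noncomm_ring

/-! ### Homogeneity -/

theorem hess_mul_y (i : Fin n) : ∑ m, S.hess i m * S.y m = S.dy i S.E := by
  have h2 : S.dy i 2 = 0 := by
    have := (S.dy i).map_natCast 2; simpa using this
  have h := congrArg (S.dy i) S.euler
  simp only [map_sum, Derivation.leibniz, smul_eq_mul, h2, S.dy_y, Finset.sum_add_distrib,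
    mul_ite, mul_one, mul_zero, Finset.sum_ite_eq, Finset.mem_univ, if_true] at h
  have : ∑ m, S.hess i m * S.y m = ∑ m, S.y m * S.dy i (S.dy m S.E) :=
    Finset.sum_congr rfl fun m _ => by rw [hess_apply, mul_comm]
  rw [this]
  linear_combination h

theorem y_mul_C (i j : Fin n) : ∑ m, S.y m * S.C m i j = 0 := by
  have h := congrArg (S.dy j) (S.hess_mul_y i)
  simp only [map_sum, Derivation.leibniz, smul_eq_mul, S.dy_y, Finset.sum_add_distrib,
    mul_ite, mul_one, mul_zero, Finset.sum_ite_eq, Finset.mem_univ, if_true] at h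
  have : ∑ m, S.y m * S.C m i j = ∑ m, S.y m * S.dy j (S.hess i m) :=
    Finset.sum_congr rfl fun m _ => by
      rw [S.C_symm m i j, S.C_symm' m j i, S.C_symm j m i, C_apply]
  rw [this]
  rw [S.hess_symm, hess_apply] at h
  linear_combination h

/-- If the Riemann curvature is that of constant flag curvature `κ`, then `C'' = -κ F² C`: the trace
term of `D_D_C` gives `-κ F² C`, and the remaining terms cancel, since the Berwald curvature, with
its upper index lowered, is skew. -/
theorem D_D_C_of_R (κ : ℝ) (hR : ∀ m k, 2 * S.R m k =
    algebraMap ℝ A κ * ((if m = k then 2 * S.E else 0) - S.y m * S.dy k S.E)) (k : Fin n) :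
    S.D (S.D S.C) k = -(algebraMap ℝ A κ * S.E) • S.C k := by
  have h2 : ∀ i, S.dy i 2 = 0 := fun i => by
    have := (S.dy i).map_natCast 2; simpa using this
  have hRC : ∑ m, S.R m k • S.C m = (algebraMap ℝ A κ * S.E) • S.C k := by
    ext i j
    apply two_mul_cancel
    have := S.y_mul_C i j
    simp only [Matrix.sum_apply, Matrix.smul_apply, smul_eq_mul, Finset.mul_sum, ← mul_assoc, hR,
      sub_mul, mul_sub, ite_mul, mul_ite, Finset.sum_sub_distrib]
    have h3 : ∑ x, algebraMap ℝ A κ * S.y x * S.dy k S.E * S.C x i j = 0 := by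
      rw [← mul_zero (algebraMap ℝ A κ * S.dy k S.E), ← this, Finset.mul_sum]
      exact Finset.sum_congr rfl fun _ _ => by ring
    rw [h3]
    simp
    ring
  -- lowering the index of `K` gives an antisymmetric matrix
  have hdR : ∀ i j k, 2 * ∑ m, S.hess j m * S.dy i (S.R m k) = algebraMap ℝ A κ *
      (2 * S.dy i S.E * S.hess j k - S.hess j i * S.dy k S.E - S.dy j S.E * S.hess i k) := by
    intro i j k
    have h1 : ∀ m, 2 * S.dy i (S.R m k) = algebraMap ℝ A κ *
        ((if m = k then 2 * S.dy i S.E else 0) - (if i = m then 1 else 0) * S.dy k S.E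
          - S.y m * S.hess i k) := by
      intro m
      have h := congrArg (S.dy i) (hR m k)
      simp only [Derivation.leibniz, h2, smul_eq_mul, Derivation.map_algebraMap, map_sub,
        S.dy_y, mul_zero, add_zero, apply_ite (S.dy i), map_zero] at h
      rw [h, hess_apply]
      split_ifs <;> ring
    rw [← S.hess_mul_y j, Finset.mul_sum, Finset.sum_mul]
    calc ∑ m, 2 * (S.hess j m * S.dy i (S.R m k))
        = ∑ m, algebraMap ℝ A κ * ((if m = k then S.hess j m * (2 * S.dy i S.E) else 0)
          - (if i = m then S.hess j m * S.dy k S.E else 0) - S.hess j m * S.y m * S.hess i k) := by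
          refine Finset.sum_congr rfl fun m _ => ?_
          rw [show 2 * (S.hess j m * S.dy i (S.R m k)) = S.hess j m * (2 * S.dy i (S.R m k)) by ring,
            h1]
          split_ifs <;> ring
      _ = _ := by
          rw [← Finset.mul_sum, Finset.sum_sub_distrib, Finset.sum_sub_distrib]
          simp only [Finset.sum_ite_eq, Finset.sum_ite_eq', Finset.mem_univ, if_true]
          ring
  have hK : ∀ i j, 2 * (3 * (S.hess * S.K k) j i) = -3 * algebraMap ℝ A κ *
      (S.dy i S.E * S.hess j k - S.dy j S.E * S.hess i k) := by
    intro i j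
    have h1 : 3 * (S.hess * S.K k) j i = -(2 * ∑ m, S.hess j m * S.dy i (S.R m k)
        + ∑ m, S.hess j m * S.dy k (S.R m i)) := by
      rw [Matrix.mul_apply, Finset.mul_sum, Finset.mul_sum, ← Finset.sum_add_distrib,
        ← Finset.sum_neg_distrib]
      refine Finset.sum_congr rfl fun m _ => ?_
      linear_combination S.hess j m * S.three_K i m k
    rw [h1]
    have e1 := hdR i j k
    have e2 := hdR k j i
    rw [S.hess_symm k i] at e2
    linear_combination -2 * e1 - e2
  have hanti : (S.K k).transpose * S.hess + S.hess * S.K k = 0 := by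
    have ht : (S.K k).transpose * S.hess = (S.hess * S.K k).transpose := by
      rw [Matrix.transpose_mul, hess_transpose]
    rw [ht]
    ext i j
    apply three_mul_cancel
    apply two_mul_cancel
    simp only [Matrix.add_apply, Matrix.transpose_apply, Matrix.zero_apply]
    linear_combination hK i j + hK j i
  rw [D_D_C, add_assoc, hanti, hRC, add_zero, neg_smul]

/-- Euler's identity for the spray coefficients, which are homogeneous of degree two. -/
theorem N_mul_y (i : Fin n) : ∑ s, S.y s * S.N i s = 2 * S.G i := by
  let L : Derivation ℝ A A := ∑ s, S.y s • S.dy s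
  have hL : ∀ a, L a = ∑ s, S.y s * S.dy s a := fun a => by
    simp [L, derivation_sum_apply]
  have hLE : ∀ i, L (S.dy i S.E) = S.dy i S.E := fun i => by
    rw [hL]
    refine Eq.trans ?_ (S.hess_mul_y i)
    exact Finset.sum_congr rfl fun m _ => by rw [hess_apply, S.dy_dy, mul_comm]
  have hLdx : ∀ k a, L (S.dx k a) = S.dx k (L a) := fun k a => by
    simp only [hL, map_sum, Derivation.leibniz, S.dx_y, S.dy_dx, smul_eq_mul, mul_zero, add_zero]
  have hLy : ∀ k, L (S.y k) = S.y k := fun k => by simp [hL, S.dy_y]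
  have hLhess : ∀ i j, L (S.hess i j) = 0 := fun i j => by
    rw [hL]; exact S.y_mul_C i j
  have h2 : L 2 = 0 := by have := L.map_natCast 2; simpa using this
  have hd2 : ∀ k, S.dx k 2 = 0 := fun k => by have := (S.dx k).map_natCast 2; simpa using this
  have hLE2 : L S.E = 2 * S.E := by rw [hL, S.euler]
  have key : S.hess *ᵥ (fun m => L (S.G m)) = S.hess *ᵥ (fun m => 2 * S.G m) := by
    ext i
    apply two_mul_cancel
    have h := congrArg L (S.spray i)
    simp only [map_sub, map_sum, Derivation.leibniz, smul_eq_mul, h2, hLdx, hLE, hLE2, hLy,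
      mul_zero, add_zero, Finset.sum_add_distrib, hd2, ← S.hess_apply, hLhess] at h
    have hs := S.spray i
    simp only [← S.hess_apply] at hs
    simp only [mulVec, dotProduct]
    rw [h, ← Finset.sum_congr rfl fun m _ => mul_comm (S.y m) (S.dx m (S.dy i S.E))]
    rw [← Finset.sum_congr rfl fun m _ => mul_comm (S.y m) (S.dx m (S.dy i S.E))] at hs
    simp only [mul_left_comm _ (2 : A), ← Finset.mul_sum]
    linear_combination -2 * hs
  have h := congrArg (fun v => (S.ginv *ᵥ v) i) key
  simp only [mulVec_mulVec, ginv_mul_hess, one_mulVec] at h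
  rw [← h, hL]; rfl

theorem Γ_mul_y (m i : Fin n) : ∑ s, S.y s * S.Γ s m i = S.N m i := by
  have h2 : S.dy i 2 = 0 := by
    have := (S.dy i).map_natCast 2; simpa using this
  have h := congrArg (S.dy i) (S.N_mul_y m)
  simp only [map_sum, Derivation.leibniz, smul_eq_mul, h2, S.dy_y, Finset.sum_add_distrib,
    mul_ite, mul_one, mul_zero, Finset.sum_ite_eq, Finset.mem_univ, if_true, add_zero] at h
  simp only [S.Γ_symm _ m i, Γ_apply]
  rw [N_apply] at h ⊢
  linear_combination h

/-- The spray is the horizontal derivative in the direction `y`. -/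
theorem X_eq_sum_horiz (a : A) :
    ∑ s, S.y s * (S.dx s a - ∑ m, S.N m s * S.dy m a) = S.X a := by
  simp only [mul_sub, Finset.sum_sub_distrib, X_apply, Finset.mul_sum]
  congr 1
  rw [Finset.sum_comm]
  refine Finset.sum_congr rfl fun m _ => ?_
  rw [← mul_assoc, ← N_mul_y, Finset.sum_mul]
  exact Finset.sum_congr rfl fun s _ => by ring

/-! ### Horizontal covariant derivatives -/

/-- The horizontal covariant derivative `T_{ijk|l}` of the Berwald connection, as a matrix in
`i, j`. -/
def cov (T : Fin n → Matrix (Fin n) (Fin n) A) (k l : Fin n) : Matrix (Fin n) (Fin n) A :=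
  (T k).map (S.dx l) - ∑ m, S.N m l • (T k).map (S.dy m) - (S.Γ l)ᵀ * T k - T k * S.Γ l
    - ∑ m, S.Γ l m k • T m

theorem sum_y_smul_cov (T : Fin n → Matrix (Fin n) (Fin n) A) (k : Fin n) :
    ∑ l, S.y l • S.cov T k l = S.D T k := by
  have h1 : ∑ l, S.y l • ((T k).map (S.dx l) - ∑ m, S.N m l • (T k).map (S.dy m)) =
      (T k).map S.X := by
    ext i j
    simp only [Matrix.sum_apply, Matrix.smul_apply, Matrix.sub_apply, Matrix.map_apply,
      smul_eq_mul, X_eq_sum_horiz]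
  have h2 : ∑ l, S.y l • S.Γ l = S.N := by
    ext i j
    simp only [Matrix.sum_apply, Matrix.smul_apply, smul_eq_mul, Γ_mul_y]
  have h3 : ∑ l, S.y l • ((S.Γ l)ᵀ * T k) = S.Nᵀ * T k := by
    rw [← h2, transpose_sum, Finset.sum_mul]
    simp only [transpose_smul, Matrix.smul_mul]
  have h4 : ∑ l, S.y l • (T k * S.Γ l) = T k * S.N := by
    rw [← h2, Finset.mul_sum]
    simp only [Matrix.mul_smul]
  have h5 : ∑ l, S.y l • ∑ m, S.Γ l m k • T m = ∑ m, S.N m k • T m := by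
    simp only [Finset.smul_sum, smul_smul]
    rw [Finset.sum_comm]
    simp only [← Finset.sum_smul, Γ_mul_y]
  simp only [cov, D, smul_sub, Finset.sum_sub_distrib, h3, h4, h5] at h1 ⊢
  rw [h1]

/-- If `T_{ijk} y^k = 0` then `T_{ijk|l} y^k = 0`. -/
theorem sum_y_smul_cov_left {T : Fin n → Matrix (Fin n) (Fin n) A} (hT : ∑ k, S.y k • T k = 0)
    (l : Fin n) : ∑ k, S.y k • S.cov T k l = 0 := by
  have e1 : ∀ d : Derivation ℝ A A, ∑ k, S.y k • (T k).map d = -∑ k, d (S.y k) • T k := by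
    intro d
    have h := congrArg (fun M : Matrix (Fin n) (Fin n) A => M.map d) hT
    simp only [map_derivation_sum, map_derivation_smul,
      Finset.sum_add_distrib] at h
    rw [Matrix.map_zero _ (map_zero d)] at h
    exact eq_neg_of_add_eq_zero_right h
  have h1 : ∑ k, S.y k • (T k).map (S.dx l) = 0 := by simp [e1, S.dx_y]
  have h2 : ∑ k, S.y k • ∑ m, S.N m l • (T k).map (S.dy m) = -∑ m, S.N m l • T m := by
    simp only [Finset.smul_sum]
    rw [Finset.sum_comm]
    simp only [smul_comm (S.y _), ← Finset.smul_sum, e1, S.dy_y, ite_smul, one_smul, zero_smul,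
      Finset.sum_ite_eq, Finset.mem_univ, if_true, smul_neg, Finset.sum_neg_distrib]
  have h3 : ∑ k, S.y k • ((S.Γ l)ᵀ * T k) = 0 := by
    simp only [← Matrix.mul_smul, ← Finset.mul_sum, hT, mul_zero]
  have h4 : ∑ k, S.y k • (T k * S.Γ l) = 0 := by
    simp only [← Matrix.smul_mul, ← Finset.sum_mul, hT, zero_mul]
  have h5 : ∑ k, S.y k • ∑ m, S.Γ l m k • T m = ∑ m, S.N m l • T m := by
    simp only [Finset.smul_sum, smul_smul]
    rw [Finset.sum_comm]
    simp only [← Finset.sum_smul, S.Γ_symm l, Γ_mul_y]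
  simp only [cov, smul_sub, Finset.sum_sub_distrib, h1, h2, h3, h4, h5]
  abel

theorem sum_y_smul_D {T : Fin n → Matrix (Fin n) (Fin n) A} (hT : ∑ k, S.y k • T k = 0) :
    ∑ k, S.y k • S.D T k = 0 := by
  simp only [← sum_y_smul_cov, Finset.smul_sum]
  rw [Finset.sum_comm]
  simp only [smul_comm (S.y _) (S.y _), ← Finset.smul_sum, S.sum_y_smul_cov_left hT, smul_zero,
    Finset.sum_const_zero]

theorem sum_y_smul_C : ∑ k, S.y k • S.C k = 0 := by
  ext i j
  simpa only [Matrix.sum_apply, Matrix.smul_apply, smul_eq_mul, Matrix.zero_apply] using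
    S.y_mul_C i j

/-! ### Traces -/

/-- The trace `E^{ij} T_{ijk}` of a covariant 3-tensor, where `E^{ij} = g^{ij} / 2` is the inverse of
the Hessian. -/
def tr (T : Fin n → Matrix (Fin n) (Fin n) A) (k : Fin n) : A := (S.ginv * T k).trace

/-- The vector `E^{ij} w_j` dual to a covector. -/
def sharp (w : Fin n → A) : Fin n → A := S.ginv *ᵥ w

theorem map_mulVec (d : Derivation ℝ A A) (M : Matrix (Fin n) (Fin n) A) (v : Fin n → A) :
    (fun i => d ((M *ᵥ v) i)) = M.map d *ᵥ v + M *ᵥ fun i => d (v i) := by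
  ext i
  simp only [mulVec, dotProduct, map_sum, Derivation.leibniz, smul_eq_mul, Pi.add_apply,
    Matrix.map_apply, ← Finset.sum_add_distrib]
  exact Finset.sum_congr rfl fun _ _ => by ring

theorem map_dotProduct (d : Derivation ℝ A A) (u v : Fin n → A) :
    d (u ⬝ᵥ v) = (fun i => d (u i)) ⬝ᵥ v + u ⬝ᵥ fun i => d (v i) := by
  simp only [dotProduct, map_sum, Derivation.leibniz, smul_eq_mul, ← Finset.sum_add_distrib]
  exact Finset.sum_congr rfl fun _ _ => by ring

theorem ginv_transpose : S.ginvᵀ = S.ginv := by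
  have h : S.ginvᵀ * S.hess = 1 := by
    rw [← S.hess_transpose, ← transpose_mul, hess_mul_ginv, transpose_one]
  calc S.ginvᵀ = S.ginvᵀ * (S.hess * S.ginv) := by rw [hess_mul_ginv, mul_one]
    _ = S.ginv := by rw [← mul_assoc, h, one_mul]

theorem map_X_ginv : S.ginv.map S.X = -(S.ginv * S.Nᵀ + S.N * S.ginv) := by
  have h := map_derivation_mul S.X S.ginv S.hess
  rw [ginv_mul_hess, map_X_hess] at h
  have h1 : (1 : Matrix (Fin n) (Fin n) A).map S.X = 0 := by
    ext i j
    simp only [Matrix.map_apply, Matrix.one_apply]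
    split_ifs <;> simp
  rw [h1] at h
  have h2 := congrArg (fun M => M * S.ginv) h
  simp only [zero_mul, add_mul, mul_add, mul_assoc, hess_mul_ginv, mul_one] at h2
  rw [← mul_assoc S.ginv S.hess, ginv_mul_hess, one_mul] at h2
  exact eq_neg_of_add_eq_zero_left h2.symm

theorem X_C (k : Fin n) : (S.C k).map S.X = S.D S.C k + S.Nᵀ * S.C k + S.C k * S.N
    + ∑ m, S.N m k • S.C m := by
  rw [D]; abel

/-- Taking traces commutes with the dynamical covariant derivative. -/
theorem X_tr : (fun k => S.X (S.tr S.C k)) = S.tr (S.D S.C) + S.Nᵀ *ᵥ S.tr S.C := by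
  ext k
  have h : S.X (S.tr S.C k) = ((S.ginv * S.C k).map S.X).trace := by
    simp [tr, Matrix.trace]
  have e1 : (S.ginv * (S.C k * S.N)).trace = (S.N * S.ginv * S.C k).trace := by
    rw [← mul_assoc, Matrix.trace_mul_comm, mul_assoc]
  rw [h, map_derivation_mul, map_X_ginv, X_C]
  simp only [mul_add, add_mul, neg_mul, trace_add, trace_neg, e1, tr, Pi.add_apply, mulVec,
    dotProduct, transpose_apply, Finset.mul_sum, trace_sum, Matrix.mul_smul, trace_smul,
    smul_eq_mul, mul_assoc]
  ring

theorem X_sharp : (fun k => S.X (S.sharp (S.tr S.C) k)) =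
    S.sharp (S.tr (S.D S.C)) - S.N *ᵥ S.sharp (S.tr S.C) := by
  simp only [sharp]
  rw [map_mulVec, X_tr, map_X_ginv]
  simp only [neg_mulVec, add_mulVec, mulVec_add, mulVec_mulVec]
  abel

theorem dotProduct_sharp_comm (u v : Fin n → A) : u ⬝ᵥ S.sharp v = v ⬝ᵥ S.sharp u := by
  rw [sharp, sharp, dotProduct_mulVec, ← mulVec_transpose, ginv_transpose, dotProduct_comm]

/-- The derivative of `‖I‖²` along the spray. -/
theorem X_normSq : S.X (S.tr S.C ⬝ᵥ S.sharp (S.tr S.C)) =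
    2 * (S.tr (S.D S.C) ⬝ᵥ S.sharp (S.tr S.C)) := by
  rw [map_dotProduct, X_tr, X_sharp, dotProduct_sub, add_dotProduct, S.dotProduct_sharp_comm _
    (S.tr (S.D S.C)), mulVec_transpose, ← dotProduct_mulVec]
  ring

/-- The derivative along the spray of the Cartan torsion evaluated on the vector `I`. -/
theorem X_cub : let v := S.sharp (S.tr S.C); let w := S.sharp (S.tr (S.D S.C))
    S.X (cubicForm S.C v v v) = cubicForm (S.D S.C) v v v + cubicForm S.C w v v
      + cubicForm S.C v w v + cubicForm S.C v v w := by
  intro v w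
  have hv : (fun k => S.X (v k)) = w - S.N *ᵥ v := S.X_sharp
  have h0 : S.X (cubicForm S.C v v v) = cubicForm S.C (fun k => S.X (v k)) v v
      + cubicForm S.C v (fun k => S.X (v k)) v + cubicForm S.C v v (fun k => S.X (v k))
      + cubicForm (fun k => (S.C k).map S.X) v v v := by
    simp only [cubicForm, map_sum, Derivation.leibniz, smul_eq_mul, map_dotProduct, map_mulVec,
      ← Finset.sum_add_distrib, dotProduct_add]
    exact Finset.sum_congr rfl fun _ _ => by ring
  have e1 : ∑ k, v k * ∑ m, S.N m k * (v ⬝ᵥ (S.C m *ᵥ v)) = cubicForm S.C (S.N *ᵥ v) v v := by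
    have hm : ∀ m, (S.N *ᵥ v) m = ∑ k, S.N m k * v k := fun m => rfl
    simp only [cubicForm, hm, Finset.sum_mul, Finset.mul_sum]
    rw [Finset.sum_comm]
    refine Finset.sum_congr rfl fun m _ => Finset.sum_congr rfl fun k _ => by ring
  have e2 : cubicForm (fun k => (S.C k).map S.X) v v v = cubicForm (S.D S.C) v v v
      + cubicForm S.C v (S.N *ᵥ v) v + cubicForm S.C v v (S.N *ᵥ v) + cubicForm S.C (S.N *ᵥ v) v v := by
    rw [← e1]
    simp only [cubicForm, X_C, add_mulVec, dotProduct_add, mul_add, Finset.sum_add_distrib]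
    congr 1
    · congr 1
      · congr 1
        refine Finset.sum_congr rfl fun k _ => ?_
        rw [← mulVec_mulVec, mulVec_transpose, dotProduct_comm, ← dotProduct_mulVec, dotProduct_comm]
      · simp only [mulVec_mulVec]
    · refine Finset.sum_congr rfl fun k _ => ?_
      simp only [Matrix.sum_mulVec, smul_mulVec, dotProduct_sum, dotProduct_smul, smul_eq_mul]
  rw [h0, e2, hv]
  simp only [cubicForm, sub_dotProduct, dotProduct_sub, mulVec_sub, Pi.sub_apply, sub_mul, mul_sub,
    Finset.sum_sub_distrib]
  ring

end SprayAlgebra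

end Finsler

noncomputable section

namespace Finsler

/-! ### The algebra of smooth functions on an open set -/

section SmoothFun

variable {P : Type*} [NormedAddCommGroup P] [NormedSpace ℝ P]

/-- The algebra of functions on `S` that are restrictions of functions smooth on `S`. Its elements are
functions on the subtype, not on the ambient space, so that two functions agreeing on `S` give the
same element and nowhere vanishing elements are invertible. -/
def smoothFun (S : Set P) : Subalgebra ℝ (S → ℝ) where
  carrier := {a | ∃ φ : P → ℝ, ContDiffOn ℝ ∞ φ S ∧ ∀ s : S, a s = φ s}
  mul_mem' := by
    rintro a b ⟨φ, hφ, ha⟩ ⟨ψ, hψ, hb⟩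
    exact ⟨fun p => φ p * ψ p, hφ.mul hψ, fun s => by simp [ha, hb]⟩
  add_mem' := by
    rintro a b ⟨φ, hφ, ha⟩ ⟨ψ, hψ, hb⟩
    exact ⟨fun p => φ p + ψ p, hφ.add hψ, fun s => by simp [ha, hb]⟩
  algebraMap_mem' r := ⟨fun _ => r, contDiffOn_const, fun _ => rfl⟩

/-- `a` is the restriction of `φ` to `S`. -/
def Represents {S : Set P} (φ : P → ℝ) (a : smoothFun S) : Prop := ∀ s : S, φ s = a.1 s

variable {S : Set P}

/-- The restriction to `S` of a function that is smooth on `S`. -/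
def smoothFun.mk (φ : P → ℝ) (hφ : ContDiffOn ℝ ∞ φ S) : smoothFun S :=
  ⟨fun s => φ s, φ, hφ, fun _ => rfl⟩

theorem represents_mk (φ : P → ℝ) (hφ : ContDiffOn ℝ ∞ φ S) :
    Represents φ (smoothFun.mk φ hφ) := fun _ => rfl

/-- Some function on the whole space whose restriction is `a`. -/
def extension (a : smoothFun S) : P → ℝ := a.2.choose

theorem contDiffOn_extension (a : smoothFun S) : ContDiffOn ℝ ∞ (extension a) S :=
  a.2.choose_spec.1

theorem represents_extension (a : smoothFun S) : Represents (extension a) a :=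
  fun s => (a.2.choose_spec.2 s).symm

theorem Represents.eqOn {φ ψ : P → ℝ} {a : smoothFun S} (hφ : Represents φ a)
    (hψ : Represents ψ a) : Set.EqOn φ ψ S :=
  fun s hs => (hφ ⟨s, hs⟩).trans (hψ ⟨s, hs⟩).symm

theorem Represents.contDiffOn {φ : P → ℝ} {a : smoothFun S} (hφ : Represents φ a) :
    ContDiffOn ℝ ∞ φ S :=
  (contDiffOn_extension a).congr (hφ.eqOn (represents_extension a))

theorem Represents.differentiableAt (hS : IsOpen S) {φ : P → ℝ} {a : smoothFun S}
    (hφ : Represents φ a) {p : P} (hp : p ∈ S) : DifferentiableAt ℝ φ p :=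
  (hφ.contDiffOn.contDiffAt (hS.mem_nhds hp)).differentiableAt (by simp)

theorem Represents.contDiffOn_fderiv (hS : IsOpen S) {φ : P → ℝ} {a : smoothFun S}
    (hφ : Represents φ a) (v : P) : ContDiffOn ℝ ∞ (fun p => fderiv ℝ φ p v) S :=
  (hφ.contDiffOn.fderiv_of_isOpen hS (m := ∞) (by simp)).clm_apply contDiffOn_const

/-- The derivative in the direction `v`, as a derivation of the algebra of smooth functions. As `S` is
open, the derivative on `S` does not depend on the extension that is differentiated. -/
def dirDeriv (hS : IsOpen S) (v : P) : Derivation ℝ (smoothFun S) (smoothFun S) :=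
  have hd : ∀ (a : smoothFun S) {φ : P → ℝ}, Represents φ a → ∀ s : S,
      fderiv ℝ (extension a) s v = fderiv ℝ φ s v := fun a φ hφ s => by
    rw [Filter.EventuallyEq.fderiv_eq]
    exact ((represents_extension a).eqOn hφ).eventuallyEq_of_mem (hS.mem_nhds s.2)
  Derivation.mk'
    { toFun := fun a => smoothFun.mk (fun p => fderiv ℝ (extension a) p v)
        ((represents_extension a).contDiffOn_fderiv hS v)
      map_add' := fun a b => by
        ext s
        have h : Represents (extension a + extension b) (a + b) := fun s => by
          simp [(represents_extension a) s, (represents_extension b) s]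
        change fderiv ℝ (extension (a + b)) s v = fderiv ℝ (extension a) s v +
          fderiv ℝ (extension b) s v
        rw [hd _ h, fderiv_add ((represents_extension a).differentiableAt hS s.2)
          ((represents_extension b).differentiableAt hS s.2)]
        rfl
      map_smul' := fun r a => by
        ext s
        have h : Represents (r • extension a) (r • a) := fun s => by
          simp [(represents_extension a) s]
        change fderiv ℝ (extension (r • a)) s v = r * fderiv ℝ (extension a) s v
        rw [hd _ h, fderiv_const_smul ((represents_extension a).differentiableAt hS s.2)]
        rfl }
    fun a b => by
      ext s
      have h : Represents (extension a * extension b) (a * b) := fun s => by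
        simp [(represents_extension a) s, (represents_extension b) s]
      change fderiv ℝ (extension (a * b)) s v = a.1 s * fderiv ℝ (extension b) s v +
        b.1 s * fderiv ℝ (extension a) s v
      rw [hd _ h, fderiv_mul ((represents_extension a).differentiableAt hS s.2)
        ((represents_extension b).differentiableAt hS s.2), ← (represents_extension a) s,
        ← (represents_extension b) s]
      rfl

theorem Represents.dirDeriv_eq_fderiv (hS : IsOpen S) {φ : P → ℝ} {a : smoothFun S}
    (hφ : Represents φ a) (v : P) : Represents (fun p => fderiv ℝ φ p v) (dirDeriv hS v a) :=
  fun s => by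
    change _ = fderiv ℝ (extension a) s v
    rw [Filter.EventuallyEq.fderiv_eq]
    exact ((represents_extension a).eqOn hφ).eventuallyEq_of_mem (hS.mem_nhds s.2)

theorem Represents.lineDeriv (hS : IsOpen S) {φ : P → ℝ} {a : smoothFun S}
    (hφ : Represents φ a) (v : P) :
    Represents (fun p => lineDeriv ℝ φ p v) (dirDeriv hS v a) := fun s => by
  rw [← hφ.dirDeriv_eq_fderiv hS v s]
  exact (hφ.differentiableAt hS s.2).lineDeriv_eq_fderiv

theorem dirDeriv_add (hS : IsOpen S) (u v : P) (a : smoothFun S) :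
    dirDeriv hS (u + v) a = dirDeriv hS u a + dirDeriv hS v a := by
  ext s
  have h := (represents_extension a).dirDeriv_eq_fderiv hS
  change (dirDeriv hS (u + v) a).1 s = (dirDeriv hS u a).1 s + (dirDeriv hS v a).1 s
  rw [← h, ← h, ← h]
  exact map_add _ _ _

theorem dirDeriv_smul (hS : IsOpen S) (r : ℝ) (v : P) (a : smoothFun S) :
    dirDeriv hS (r • v) a = r • dirDeriv hS v a := by
  ext s
  have h := (represents_extension a).dirDeriv_eq_fderiv hS
  change (dirDeriv hS (r • v) a).1 s = r * (dirDeriv hS v a).1 s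
  rw [← h, ← h]
  exact map_smul _ _ _

theorem dirDeriv_comm (hS : IsOpen S) (u v : P) (a : smoothFun S) :
    dirDeriv hS u (dirDeriv hS v a) = dirDeriv hS v (dirDeriv hS u a) := by
  ext s
  have h := (represents_extension a).dirDeriv_eq_fderiv hS
  rw [← (h v).dirDeriv_eq_fderiv hS u s, ← (h u).dirDeriv_eq_fderiv hS v s]
  have hc := (contDiffOn_extension a).contDiffAt (hS.mem_nhds s.2)
  have hsymm : IsSymmSndFDerivAt ℝ (extension a) s := hc.isSymmSndFDerivAt (by
    rw [minSmoothness_of_isRCLikeNormedField]; exact WithTop.coe_le_coe.2 le_top)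
  have hd : DifferentiableAt ℝ (fderiv ℝ (extension a)) s :=
    (hc.fderiv_right (m := 1) (by exact WithTop.coe_le_coe.2 le_top)).differentiableAt (by simp)
  beta_reduce
  rw [fderiv_clm_apply hd (differentiableAt_const _), fderiv_clm_apply hd
    (differentiableAt_const _)]
  simpa using hsymm u v

/-- A nowhere vanishing smooth function is invertible. -/
theorem exists_mul_eq_one {a : smoothFun S} (ha : ∀ s, a.1 s ≠ 0) :
    ∃ b : smoothFun S, a * b = 1 := by
  refine ⟨⟨fun s => (a.1 s)⁻¹, fun p => (extension a p)⁻¹,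
    (contDiffOn_extension a).inv fun p hp => ?_, fun s => by
      beta_reduce; rw [represents_extension a s]⟩, ?_⟩
  · rw [represents_extension a ⟨p, hp⟩]; exact ha _
  · ext s; exact mul_inv_cancel₀ (ha s)

/-- Evaluation at a point. -/
def evalAt (s : S) : smoothFun S →ₐ[ℝ] ℝ :=
  (Pi.evalAlgHom ℝ (fun _ : S => ℝ) s).comp (smoothFun S).val

@[simp]
theorem evalAt_apply (s : S) (a : smoothFun S) : evalAt s a = a.1 s := rfl

end SmoothFun

end Finsler

end

noncomputable section

namespace Finsler

open Matrix

/-! ### Minkowski norms -/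

section Minkowski

variable {n : ℕ}

theorem sum_stdVec (u : Coord n) : ∑ i, u i • stdVec i = u := by
  ext j
  simp [stdVec, Finset.sum_apply, Pi.single_apply]

theorem map_eq_sum_stdVec (L : Coord n →ₗ[ℝ] ℝ) (u : Coord n) :
    L u = ∑ i, u i * L (stdVec i) := by
  conv_lhs => rw [← sum_stdVec u]
  simp only [map_sum, map_smul, smul_eq_mul]

/-- A (not necessarily reversible) Minkowski norm on `ℝⁿ`: the restriction of a Finsler metric to one
tangent space. -/
structure IsMinkowskiNorm (f : Coord n → ℝ) : Prop where
  smooth : ContDiffOn ℝ ∞ f {0}ᶜ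
  homog : ∀ (y : Coord n) (r : ℝ), 0 < r → f (r • y) = r * f y
  posDef : ∀ y u : Coord n, y ≠ 0 → u ≠ 0 → 0 < fundForm f y u u

theorem isOpen_compl_zero : IsOpen ({0}ᶜ : Set (Coord n)) := isOpen_compl_singleton

namespace IsMinkowskiNorm

variable {f : Coord n → ℝ} (hf : IsMinkowskiNorm f)

include hf

/-- The square of a Minkowski norm, as a smooth function on the nonzero vectors. -/
def energy : smoothFun ({0}ᶜ : Set (Coord n)) := smoothFun.mk (fun y => f y ^ 2) (hf.smooth.pow 2)

theorem represents_fundForm (u v : Coord n) : Represents (fun y => fundForm f y u v)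
    ((1 / 2 : ℝ) • dirDeriv isOpen_compl_zero u (dirDeriv isOpen_compl_zero v hf.energy)) :=
  fun s => by
    have h : Represents (fun y => f y ^ 2) hf.energy := represents_mk _ _
    change _ = (1 / 2 : ℝ) * (dirDeriv isOpen_compl_zero u
      (dirDeriv isOpen_compl_zero v hf.energy)).1 s
    rw [← (h.lineDeriv isOpen_compl_zero v).lineDeriv isOpen_compl_zero u s]
    rfl

theorem represents_cartan (u v w : Coord n) : Represents (fun y => cartan f y u v w)
    ((1 / 4 : ℝ) • dirDeriv isOpen_compl_zero w (dirDeriv isOpen_compl_zero u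
      (dirDeriv isOpen_compl_zero v hf.energy))) :=
  fun s => by
    have h := (hf.represents_fundForm u v).lineDeriv isOpen_compl_zero w s
    rw [Derivation.map_smul] at h
    change (1 / 2 : ℝ) * lineDeriv ℝ _ _ _ = (1 / 4 : ℝ) * (dirDeriv isOpen_compl_zero w
      (dirDeriv isOpen_compl_zero u (dirDeriv isOpen_compl_zero v hf.energy))).1 s
    beta_reduce at h
    rw [h]
    change (1 / 2 : ℝ) * ((1 / 2 : ℝ) * _) = _
    ring

variable {y : Coord n} (hy : y ≠ 0)

include hy

theorem fundForm_eq (u v : Coord n) : fundForm f y u v = (1 / 2 : ℝ) *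
    (dirDeriv isOpen_compl_zero u (dirDeriv isOpen_compl_zero v hf.energy)).1 ⟨y, hy⟩ :=
  hf.represents_fundForm u v ⟨y, hy⟩

theorem cartan_eq (u v w : Coord n) : cartan f y u v w = (1 / 4 : ℝ) *
    (dirDeriv isOpen_compl_zero w (dirDeriv isOpen_compl_zero u
      (dirDeriv isOpen_compl_zero v hf.energy))).1 ⟨y, hy⟩ :=
  hf.represents_cartan u v w ⟨y, hy⟩

theorem fundForm_symm (u v : Coord n) : fundForm f y u v = fundForm f y v u := by
  rw [hf.fundForm_eq hy, hf.fundForm_eq hy, dirDeriv_comm]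

theorem cartan_swap_left (u v w : Coord n) : cartan f y u v w = cartan f y v u w := by
  rw [hf.cartan_eq hy, hf.cartan_eq hy, dirDeriv_comm _ u v]

theorem cartan_swap_right (u v w : Coord n) : cartan f y u v w = cartan f y u w v := by
  rw [hf.cartan_eq hy, hf.cartan_eq hy, dirDeriv_comm _ u v, dirDeriv_comm _ w v,
    dirDeriv_comm _ w u]

/-- The fundamental form at `y` as a bilinear form. -/
def gForm : Coord n →ₗ[ℝ] Coord n →ₗ[ℝ] ℝ :=
  have hadd : ∀ u u' v, fundForm f y (u + u') v = fundForm f y u v + fundForm f y u' v :=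
    fun u u' v => by
      simp only [hf.fundForm_eq hy, dirDeriv_add]
      exact mul_add _ _ _
  have hsmul : ∀ (r : ℝ) u v, fundForm f y (r • u) v = r * fundForm f y u v :=
    fun r u v => by
      simp only [hf.fundForm_eq hy, dirDeriv_smul]
      exact mul_left_comm _ _ _
  LinearMap.mk₂ ℝ (fundForm f y) hadd hsmul
    (fun u v v' => by
      rw [hf.fundForm_symm hy, hadd, hf.fundForm_symm hy v, hf.fundForm_symm hy v'])
    (fun r u v => by
      rw [hf.fundForm_symm hy, hsmul, hf.fundForm_symm hy v]; rfl)

theorem gForm_apply (u v : Coord n) : hf.gForm hy u v = fundForm f y u v := rfl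

/-- The Cartan torsion at `y` as a trilinear form. -/
def cForm : Coord n →ₗ[ℝ] Coord n →ₗ[ℝ] Coord n →ₗ[ℝ] ℝ :=
  have hadd : ∀ u v w w', cartan f y u v (w + w') = cartan f y u v w + cartan f y u v w' :=
    fun u v w w' => by
      simp only [hf.cartan_eq hy, dirDeriv_add]
      exact mul_add _ _ _
  have hsmul : ∀ (r : ℝ) u v w, cartan f y u v (r • w) = r * cartan f y u v w :=
    fun r u v w => by
      simp only [hf.cartan_eq hy, dirDeriv_smul]
      exact mul_left_comm _ _ _
  have h1 : ∀ u v w, cartan f y u v w = cartan f y w v u := fun u v w => by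
    rw [hf.cartan_swap_left hy, hf.cartan_swap_right hy, hf.cartan_swap_left hy]
  LinearMap.mk₂ ℝ (fun u v =>
    { toFun := fun w => cartan f y u v w
      map_add' := hadd u v
      map_smul' := fun r w => hsmul r u v w })
    (fun u u' v => by
      ext w
      change cartan f y (u + u') v _ = cartan f y u v _ + cartan f y u' v _
      rw [h1, hadd, h1 u, h1 u'])
    (fun r u v => by
      ext w
      change cartan f y (r • u) v _ = r * cartan f y u v _
      rw [h1, hsmul, h1 u])
    (fun u v v' => by
      ext w
      change cartan f y u (v + v') _ = cartan f y u v _ + cartan f y u v' _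
      rw [hf.cartan_swap_right hy, hadd, hf.cartan_swap_right hy u v,
        hf.cartan_swap_right hy u v'])
    (fun r u v => by
      ext w
      change cartan f y u (r • v) _ = r * cartan f y u v _
      rw [hf.cartan_swap_right hy, hsmul, hf.cartan_swap_right hy u v])

theorem cForm_apply (u v w : Coord n) : hf.cForm hy u v w = cartan f y u v w := rfl

theorem gForm_pos {u : Coord n} (hu : u ≠ 0) : 0 < hf.gForm hy u u := hf.posDef y u hy hu

theorem gForm_eq_sum (u v : Coord n) :
    hf.gForm hy u v = u.ofLp ⬝ᵥ (gramMatrix f y *ᵥ v.ofLp) := by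
  conv_lhs => rw [← sum_stdVec u, ← sum_stdVec v]
  simp only [map_sum, LinearMap.sum_apply, map_smul, LinearMap.smul_apply, smul_eq_mul,
    dotProduct, mulVec, gramMatrix, gForm_apply, Matrix.of_apply]
  simp only [Finset.mul_sum]
  rw [Finset.sum_comm]
  exact Finset.sum_congr rfl fun _ _ => Finset.sum_congr rfl fun _ _ => by ring

theorem det_gramMatrix_ne_zero : (gramMatrix f y).det ≠ 0 := by
  intro h
  obtain ⟨v, hv, hv'⟩ := Matrix.exists_mulVec_eq_zero_iff.2 h
  have := hf.gForm_pos hy (u := WithLp.toLp 2 v) (by simpa using hv)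
  rw [gForm_eq_sum] at this
  simp [hv'] at this

theorem gramMatrix_symm (i j : Fin n) : gramMatrix f y i j = gramMatrix f y j i :=
  hf.fundForm_symm hy _ _

theorem gramInv_mul : gramInv f y * gramMatrix f y = 1 :=
  Matrix.nonsing_inv_mul _ (isUnit_iff_ne_zero.2 (hf.det_gramMatrix_ne_zero hy))

theorem mul_gramInv : gramMatrix f y * gramInv f y = 1 :=
  Matrix.mul_nonsing_inv _ (isUnit_iff_ne_zero.2 (hf.det_gramMatrix_ne_zero hy))

theorem gramInv_transpose : (gramInv f y)ᵀ = gramInv f y := by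
  rw [gramInv, Matrix.transpose_nonsing_inv]
  congr 1
  ext i j
  exact hf.gramMatrix_symm hy j i

end IsMinkowskiNorm

end Minkowski

/-- A square matrix of smooth functions with nowhere vanishing determinant is invertible. -/
theorem exists_matrix_mul_eq_one {P : Type*} [NormedAddCommGroup P] [NormedSpace ℝ P] {S : Set P}
    {n : ℕ} (M : Matrix (Fin n) (Fin n) (smoothFun S))
    (hM : ∀ s, (M.map (evalAt s)).det ≠ 0) : ∃ M' : Matrix (Fin n) (Fin n) (smoothFun S),
      M' * M = 1 := by
  obtain ⟨b, hb⟩ := exists_mul_eq_one (a := M.det) fun s => by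
    have := hM s
    rwa [← AlgHom.mapMatrix_apply, ← AlgHom.map_det] at this
  exact ⟨M⁻¹, Matrix.nonsing_inv_mul _ (IsUnit.of_mul_eq_one _ hb)⟩

section Minkowski

variable {n : ℕ}

/-- The `i`-th coordinate as a smooth function. -/
def coordFun (S : Set (Coord n)) (i : Fin n) : smoothFun S :=
  smoothFun.mk (fun y => y i) (by fun_prop)

/-- Euler's identity for the square of a positively homogeneous function. -/
theorem lineDeriv_self_sq {f : Coord n → ℝ}
    (h : ∀ (y : Coord n) (r : ℝ), 0 < r → f (r • y) = r * f y) (y : Coord n) :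
    lineDeriv ℝ (fun z => f z ^ 2) y y = 2 * f y ^ 2 := by
  have h1 : (fun t : ℝ => f (y + t • y) ^ 2) =ᶠ[nhds 0] fun t => (1 + t) ^ 2 * f y ^ 2 := by
    filter_upwards [lt_mem_nhds (show (-1 : ℝ) < 0 by norm_num)] with t ht
    rw [show y + t • y = (1 + t) • y by rw [add_smul, one_smul], h _ _ (by linarith)]
    ring
  rw [lineDeriv, h1.deriv_eq]
  have : HasDerivAt (fun t : ℝ => (1 + t) ^ 2 * f y ^ 2) (2 * (1 + 0) * f y ^ 2) 0 := by
    have := (((hasDerivAt_id (0 : ℝ)).const_add 1).pow 2).mul_const (f y ^ 2)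
    simpa using this
  rw [this.deriv]; ring

namespace IsMinkowskiNorm

variable {f : Coord n → ℝ} (hf : IsMinkowskiNorm f)

include hf

/-- A Minkowski norm, regarded as a Finsler metric that does not depend on the base point. -/
theorem exists_sprayAlgebra : ∃ S : SprayAlgebra n (smoothFun ({0}ᶜ : Set (Coord n))),
    S.dy = (fun i => dirDeriv isOpen_compl_zero (stdVec i)) ∧ S.y = coordFun _ ∧
      S.E = hf.energy := by
  have hc : ∀ i, Represents (fun y : Coord n => y i) (coordFun {0}ᶜ i) := fun i =>
    represents_mk _ _
  have hE : Represents (fun y => f y ^ 2) hf.energy := represents_mk _ _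
  obtain ⟨M, hM⟩ := exists_matrix_mul_eq_one
    (Matrix.of fun i j => dirDeriv isOpen_compl_zero (stdVec i)
      (dirDeriv isOpen_compl_zero (stdVec j) hf.energy)) fun s => by
    have h1 := hf.det_gramMatrix_ne_zero s.2
    have h2 : (Matrix.of fun i j => dirDeriv isOpen_compl_zero (stdVec i)
      (dirDeriv isOpen_compl_zero (stdVec j) hf.energy)).map (evalAt s) =
        (2 : ℝ) • gramMatrix f s := by
      ext i j
      simp only [Matrix.map_apply, Matrix.of_apply, evalAt_apply, Matrix.smul_apply, gramMatrix,
        hf.fundForm_eq s.2, smul_eq_mul]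
      ring
    rw [h2, Matrix.det_smul]
    exact mul_ne_zero (by positivity) h1
  refine ⟨{ dx := 0, dy := fun i => dirDeriv isOpen_compl_zero (stdVec i), y := coordFun _
            E := hf.energy, G := 0, ginv := M
            dx_dx := by simp
            dy_dy := fun i j a => dirDeriv_comm _ _ _ _
            dy_dx := by simp
            dx_y := by simp
            dy_y := ?_
            euler := ?_
            spray := by simp
            ginv_mul := hM }, rfl, rfl, rfl⟩
  · intro i j
    ext s
    rw [← (hc j).dirDeriv_eq_fderiv isOpen_compl_zero (stdVec i) s]
    have : fderiv ℝ (fun y : Coord n => y j) s = EuclideanSpace.proj j :=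
      (EuclideanSpace.proj (𝕜 := ℝ) j : Coord n →L[ℝ] ℝ).fderiv
    beta_reduce
    rw [this]
    by_cases h : i = j
    · subst h; simp
    · have h' : j ≠ i := fun e => h e.symm
      simp [h, h']
  · ext s
    have h1 : Represents (fun z => lineDeriv ℝ (fun z => f z ^ 2) z s.1)
      (dirDeriv isOpen_compl_zero s.1 hf.energy) := hE.lineDeriv isOpen_compl_zero s.1
    have h2 := h1 s
    beta_reduce at h2
    rw [lineDeriv_self_sq hf.homog] at h2
    have h3 := (hE.dirDeriv_eq_fderiv isOpen_compl_zero s.1 s)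
    beta_reduce at h3
    conv_lhs at h3 => rw [← sum_stdVec s.1, map_sum]
    simp only [map_smul, smul_eq_mul] at h3
    rw [← evalAt_apply, ← evalAt_apply]
    simp only [map_sum, map_mul, evalAt_apply, map_ofNat]
    rw [← hE s, h2, ← h3]
    refine Finset.sum_congr rfl fun i _ => ?_
    rw [← hE.dirDeriv_eq_fderiv isOpen_compl_zero _ s, sum_stdVec]
    rfl

variable {y : Coord n} (hy : y ≠ 0)

include hy

theorem gForm_self : hf.gForm hy y y = f y ^ 2 := by
  obtain ⟨S, h1, h2, h3⟩ := hf.exists_sprayAlgebra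
  have hE : Represents (fun y => f y ^ 2) hf.energy := represents_mk _ _
  have e1 := congrArg (evalAt ⟨y, hy⟩) S.euler
  have e2 := fun i => congrArg (evalAt ⟨y, hy⟩) (S.hess_mul_y i)
  simp only [map_sum, map_mul, SprayAlgebra.hess_apply, h1, h2, h3, evalAt_apply, map_ofNat] at e1 e2
  rw [← hE] at e1
  simp only [← e2] at e1
  rw [gForm_eq_sum]
  have : ∀ i j, (dirDeriv isOpen_compl_zero (stdVec i) (dirDeriv isOpen_compl_zero (stdVec j)
      hf.energy)).1 ⟨y, hy⟩ = 2 * gramMatrix f y i j := fun i j => by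
    simp only [gramMatrix, Matrix.of_apply, hf.fundForm_eq hy]; ring
  simp only [this] at e1
  simp only [dotProduct, mulVec]
  have e3 : ∀ i, (coordFun {0}ᶜ i).1 ⟨y, hy⟩ = y i := fun i => rfl
  simp only [e3, mul_assoc, ← Finset.mul_sum, mul_left_comm _ (2 : ℝ)] at e1
  linarith

theorem cForm_self (u v : Coord n) : hf.cForm hy u v y = 0 := by
  obtain ⟨S, h1, h2, h3⟩ := hf.exists_sprayAlgebra
  have e2 := fun i j => congrArg (evalAt ⟨y, hy⟩) (S.y_mul_C i j)
  simp only [map_sum, map_mul, SprayAlgebra.C_apply, SprayAlgebra.hess_apply, h1, h2, h3,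
    evalAt_apply, map_zero] at e2
  have h0 : ∀ i j, hf.cForm hy (stdVec i) (stdVec j) y = 0 := fun i j => by
    have e3 : hf.cForm hy (stdVec i) (stdVec j) y =
        ∑ k, y k * cartan f y (stdVec i) (stdVec j) (stdVec k) := by
      exact map_eq_sum_stdVec _ y
    rw [e3]
    simp only [hf.cartan_eq hy, mul_left_comm _ (1 / 4 : ℝ), ← Finset.mul_sum]
    rw [← mul_zero (1 / 4 : ℝ), ← e2 i j]
    rfl
  rw [← sum_stdVec u, ← sum_stdVec v]
  simp [map_sum, LinearMap.sum_apply, h0]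

theorem ne_zero : f y ≠ 0 := fun h => by
  have h1 := hf.gForm_self hy
  have h2 := hf.gForm_pos hy hy
  rw [h1, h] at h2
  simp at h2

end IsMinkowskiNorm

end Minkowski

end Finsler

end

noncomputable section

namespace Finsler

open Matrix

/-! ### Naturality under linear maps -/

section Naturality

variable {n : ℕ}

theorem lineDeriv_comp_linearMap {V W : Type*} [NormedAddCommGroup V] [NormedSpace ℝ V]
    [NormedAddCommGroup W] [NormedSpace ℝ W] (φ : W → ℝ) (A : V →ₗ[ℝ] W) (y v : V) :
    lineDeriv ℝ (fun z => φ (A z)) y v = lineDeriv ℝ φ (A y) (A v) := by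
  simp [lineDeriv]

theorem fundForm_comp (f : Coord n → ℝ) (A : Coord n →ₗ[ℝ] Coord n) (y u v : Coord n) :
    fundForm (fun z => f (A z)) y u v = fundForm f (A y) (A u) (A v) := by
  simp only [fundForm]
  rw [← lineDeriv_comp_linearMap _ A]
  congr 2
  ext z
  exact lineDeriv_comp_linearMap (fun z => f z ^ 2) A z v

theorem cartan_comp (f : Coord n → ℝ) (A : Coord n →ₗ[ℝ] Coord n) (y u v w : Coord n) :
    cartan (fun z => f (A z)) y u v w = cartan f (A y) (A u) (A v) (A w) := by
  simp only [cartan, fundForm_comp]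
  rw [← lineDeriv_comp_linearMap _ A]

theorem angular_comp (f : Coord n → ℝ) (A : Coord n →ₗ[ℝ] Coord n) (y u v : Coord n) :
    angular (fun z => f (A z)) y u v = angular f (A y) (A u) (A v) := by
  simp only [angular, fundForm_comp]

end Naturality

/-! ### Trilinear forms -/

section Trilinear

variable {V : Type*} [AddCommGroup V] [Module ℝ V]

/-- A symmetric trilinear form is determined by its values on the diagonal. -/
theorem trilinear_eq_zero {D : V →ₗ[ℝ] V →ₗ[ℝ] V →ₗ[ℝ] ℝ} (h1 : ∀ u v w, D u v w = D v u w)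
    (h2 : ∀ u v w, D u v w = D u w v) (h0 : ∀ u, D u u u = 0) (u v w : V) : D u v w = 0 := by
  have key : ∀ u v, D u u v = 0 := fun u v => by
    have e1 := h0 (u + v)
    have e2 := h0 (u - v)
    simp only [map_add, map_sub, LinearMap.add_apply, LinearMap.sub_apply, h0] at e1 e2
    have s1 := h2 u v u
    have s2 := h1 v u u
    have s3 := h2 v v u
    have s4 := h1 u v v
    have s5 := h2 v u v
    linarith
  have e := key (u + v) w
  simp only [map_add, LinearMap.add_apply, key] at e
  have := h1 u v w
  linarith

/-- The symmetric trilinear form `a (θ h + θ h + θ h) + b θ θ θ`. -/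
def semiCForm (a b : ℝ) (θ : V →ₗ[ℝ] ℝ) (h : V →ₗ[ℝ] V →ₗ[ℝ] ℝ) :
    V →ₗ[ℝ] V →ₗ[ℝ] V →ₗ[ℝ] ℝ :=
  LinearMap.mk₂ ℝ (fun u v => a • (θ u • h v + θ v • h u + h v u • θ) + (b * (θ u * θ v)) • θ)
    (fun u u' v => by ext w; simp; ring) (fun r u v => by ext w; simp; ring)
    (fun u v v' => by ext w; simp; ring) (fun r u v => by ext w; simp; ring)

theorem semiCForm_apply (a b : ℝ) (θ : V →ₗ[ℝ] ℝ) (h : V →ₗ[ℝ] V →ₗ[ℝ] ℝ) (u v w : V) :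
    semiCForm a b θ h u v w = a * (θ u * h v w + θ v * h u w + θ w * h v u)
      + b * (θ u * θ v * θ w) := by
  simp [semiCForm]; ring

/-- The reflection in the hyperplane that is `b`-orthogonal to `w`. -/
def bilinReflection (b : V →ₗ[ℝ] V →ₗ[ℝ] ℝ) (w : V) : V →ₗ[ℝ] V :=
  LinearMap.id - (2 / b w w) • (b w).smulRight w

theorem bilinReflection_apply (b : V →ₗ[ℝ] V →ₗ[ℝ] ℝ) (w u : V) :
    bilinReflection b w u = u - (2 / b w w * b w u) • w := by
  simp [bilinReflection, smul_smul]

theorem bilinReflection_of_orthogonal {b : V →ₗ[ℝ] V →ₗ[ℝ] ℝ} {w u : V} (h : b w u = 0) :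
    bilinReflection b w u = u := by
  simp [bilinReflection_apply, h]

theorem bilinReflection_self {b : V →ₗ[ℝ] V →ₗ[ℝ] ℝ} {w : V} (h : b w w ≠ 0) :
    bilinReflection b w w = -w := by
  rw [bilinReflection_apply, div_mul_cancel₀ _ h, two_smul]; abel

theorem bilinReflection_swap {b : V →ₗ[ℝ] V →ₗ[ℝ] ℝ} (hb : ∀ u v, b u v = b v u) {u v : V}
    (h : b u u = b v v) (h' : b (u - v) (u - v) ≠ 0) : bilinReflection b (u - v) u = v := by
  have e : 2 * b (u - v) u = b (u - v) (u - v) := by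
    simp only [map_sub, LinearMap.sub_apply, hb v u]; linarith
  rw [bilinReflection_apply, div_mul_eq_mul_div, e, div_self h', one_smul]; abel

theorem bilin_bilinReflection {b : V →ₗ[ℝ] V →ₗ[ℝ] ℝ} (hb : ∀ u v, b u v = b v u) {w : V}
    (h : b w w ≠ 0) (u : V) : b (bilinReflection b w u) (bilinReflection b w u) = b u u := by
  simp only [bilinReflection_apply, map_sub, map_smul, LinearMap.sub_apply, LinearMap.smul_apply,
    smul_eq_mul, hb u w]
  field_simp
  ring

/-- A symmetric trilinear form `T` with `T(y, ·, ·) = 0` has the shape `a θ h + c θ θ θ`, where `h` is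
the angular form of `g`, if `T` and `g` are invariant under all `b`-isometries that fix `y` and
preserve `β`. Here `θ` is the part of `β` that is `b`-orthogonal to `y`. The reflections along the
vectors of `W = {y, e}^⊥`, where `b e = θ`, are such isometries: they kill the terms of `T` and `g`
that are odd in `W`, and, being transitive on the spheres of `W`, make `T(e, ·, ·)` and `g`
proportional on `W`. -/
theorem exists_eq_semiC_of_invariant [FiniteDimensional ℝ V] {b g : V →ₗ[ℝ] V →ₗ[ℝ] ℝ}
    {T : V →ₗ[ℝ] V →ₗ[ℝ] V →ₗ[ℝ] ℝ} {y : V} (hb : ∀ u v, b u v = b v u)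
    (hbpos : ∀ u, u ≠ 0 → 0 < b u u) (hgpos : ∀ u, u ≠ 0 → 0 < g u u)
    (hg : ∀ u v, g u v = g v u)
    (hT1 : ∀ u v w, T u v w = T v u w) (hT2 : ∀ u v w, T u v w = T u w v)
    (hTy : ∀ u v, T u v y = 0) (β : V →ₗ[ℝ] ℝ) (hy : y ≠ 0)
    (hinvT : ∀ R : V →ₗ[ℝ] V, R y = y → (∀ u, b (R u) (R u) = b u u) → (∀ u, β (R u) = β u) →
      ∀ u v w, T (R u) (R v) (R w) = T u v w)
    (hinvg : ∀ R : V →ₗ[ℝ] V, R y = y → (∀ u, b (R u) (R u) = b u u) → (∀ u, β (R u) = β u) →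
      ∀ u v, g (R u) (R v) = g u v) :
    ∃ (θ : V →ₗ[ℝ] ℝ) (a c : ℝ), θ y = 0 ∧ ∀ u v w, T u v w =
      semiCForm a c θ (g - (g y y)⁻¹ • (g y).smulRight (g y)) u v w := by
  have hbne : ∀ u, u ≠ 0 → b u u ≠ 0 := fun u hu => (hbpos u hu).ne'
  set θ : V →ₗ[ℝ] ℝ := β - (β y / b y y) • b y with hθ
  have hθy : θ y = 0 := by
    simp [hθ, div_mul_cancel₀ _ (hbne y hy)]
  obtain ⟨e, he⟩ : ∃ e, b e = θ := by
    have hinj : Function.Injective b := by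
      rw [← LinearMap.ker_eq_bot, LinearMap.ker_eq_bot']
      intro u hu
      by_contra hne
      exact hbne u hne (by rw [hu]; rfl)
    exact (LinearMap.injective_iff_surjective_of_finrank_eq_finrank
      (Subspace.dual_finrank_eq (K := ℝ) (V := V)).symm).1 hinj θ
  have hey : b e y = 0 := by rw [he, hθy]
  -- reflections along vectors of `W = {y, e}^⊥` are admissible isometries
  have hWβ : ∀ w, b w y = 0 → b w e = 0 → β w = 0 := fun w h1 h2 => by
    have h3 : θ w = 0 := by rw [← he, hb, h2]
    rw [hθ] at h3
    simpa [hb y w, h1] using h3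
  have hRy : ∀ w, b w y = 0 → bilinReflection b w y = y := fun w h =>
    bilinReflection_of_orthogonal h
  have hRβ : ∀ w, b w y = 0 → b w e = 0 → ∀ u, β (bilinReflection b w u) = β u :=
    fun w h1 h2 u => by
      simp [bilinReflection_apply, hWβ w h1 h2]
  have hRT : ∀ w, b w y = 0 → b w e = 0 → w ≠ 0 → ∀ u v z,
      T (bilinReflection b w u) (bilinReflection b w v) (bilinReflection b w z) = T u v z :=
    fun w h1 h2 h0 => hinvT _ (hRy w h1) (bilin_bilinReflection hb (hbne w h0)) (hRβ w h1 h2)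
  have hRg : ∀ w, b w y = 0 → b w e = 0 → w ≠ 0 → ∀ u v,
      g (bilinReflection b w u) (bilinReflection b w v) = g u v :=
    fun w h1 h2 h0 => hinvg _ (hRy w h1) (bilin_bilinReflection hb (hbne w h0)) (hRβ w h1 h2)
  have hgw : ∀ w, b w y = 0 → b w e = 0 → ∀ z, b w z = 0 → g z w = 0 := fun w h1 h2 z hz => by
    by_cases h0 : w = 0
    · simp [h0]
    have := hRg w h1 h2 h0 z w
    rw [bilinReflection_of_orthogonal hz, bilinReflection_self (hbne w h0), map_neg] at this
    linarith
  have hTeew : ∀ w, b w y = 0 → b w e = 0 → T e e w = 0 := fun w h1 h2 => by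
    by_cases h0 : w = 0
    · simp [h0]
    have := hRT w h1 h2 h0 e e w
    rw [bilinReflection_of_orthogonal h2, bilinReflection_self (hbne w h0), map_neg] at this
    linarith
  have hTwww : ∀ w, b w y = 0 → b w e = 0 → T w w w = 0 := fun w h1 h2 => by
    by_cases h0 : w = 0
    · simp [h0]
    have := hRT w h1 h2 h0 w w w
    rw [bilinReflection_self (hbne w h0)] at this
    simp only [map_neg, LinearMap.neg_apply] at this
    linarith
  -- on `W` the quadratic forms `T e w w` and `g w w` are proportional
  obtain ⟨c, hc⟩ : ∃ c : ℝ, ∀ w, b w y = 0 → b w e = 0 → T e w w = c * g w w := by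
    by_cases hW : ∃ w, b w y = 0 ∧ b w e = 0 ∧ w ≠ 0
    · obtain ⟨w₀, h1, h2, h0⟩ := hW
      refine ⟨T e w₀ w₀ / g w₀ w₀, fun w hw1 hw2 => ?_⟩
      by_cases hw : w = 0
      · simp [hw]
      have hpos := hbpos w hw
      have hpos0 := hbpos w₀ h0
      set r := √(b w w / b w₀ w₀) with hr
      have hr2 : r * r = b w w / b w₀ w₀ := Real.mul_self_sqrt (by positivity)
      have hnorm : b w w = b (r • w₀) (r • w₀) := by
        simp only [map_smul, LinearMap.smul_apply, smul_eq_mul]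
        rw [← mul_assoc, hr2, div_mul_cancel₀ _ hpos0.ne']
      have hs : T e w w = T e (r • w₀) (r • w₀) ∧ g w w = g (r • w₀) (r • w₀) := by
        by_cases hd : w - r • w₀ = 0
        · rw [sub_eq_zero.1 hd]
          exact ⟨by rw [← sub_eq_zero.1 hd], by rw [← sub_eq_zero.1 hd]⟩
        have hd1 : b (w - r • w₀) y = 0 := by simp [hw1, h1]
        have hd2 : b (w - r • w₀) e = 0 := by simp [hw2, h2]
        have hsw := bilinReflection_swap hb hnorm (hbne _ hd)
        have k1 := hRT _ hd1 hd2 hd e w w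
        have k2 := hRg _ hd1 hd2 hd w w
        rw [hsw] at k1 k2
        rw [bilinReflection_of_orthogonal hd2] at k1
        exact ⟨k1.symm, k2.symm⟩
      rw [hs.1, hs.2]
      simp only [map_smul, LinearMap.smul_apply, smul_eq_mul]
      field_simp [(hgpos w₀ h0).ne']
    · push Not at hW
      exact ⟨0, fun w h1 h2 => by simp [hW w h1 h2]⟩
  set h := g - (g y y)⁻¹ • (g y).smulRight (g y) with hh
  have happ : ∀ u v, h u v = g u v - (g y y)⁻¹ * (g y u * g y v) := fun u v => by
    simp [hh]
  have hhs : ∀ u v, h u v = h v u := fun u v => by rw [happ, happ, hg u v]; ring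
  have hhy : ∀ v, h y v = 0 := fun v => by
    rw [happ, ← mul_assoc, inv_mul_cancel₀ (hgpos y hy).ne']; ring
  obtain ⟨a', c', hac⟩ : ∃ a' c' : ℝ, ∀ (t : ℝ) (w : V), b w y = 0 → b w e = 0 →
      T (t • e + w) (t • e + w) (t • e + w) = semiCForm a' c' θ h (t • e + w) (t • e + w)
        (t • e + w) := by
    have hθw : ∀ w, b w e = 0 → θ w = 0 := fun w h2 => by rw [← he, hb, h2]
    have hhw : ∀ w, b w y = 0 → b w e = 0 → h w w = g w w := fun w h1 h2 => by
      rw [happ, hgw w h1 h2 y h1]; ring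
    have hhe : ∀ w, b w y = 0 → b w e = 0 → h e w = 0 := fun w h1 h2 => by
      rw [happ, hgw w h1 h2 y h1, hgw w h1 h2 e h2]; ring
    have hTe : ∀ (t : ℝ) (w : V), b w y = 0 → b w e = 0 →
        T (t • e + w) (t • e + w) (t • e + w) = t ^ 3 * T e e e + 3 * t * (c * g w w) :=
      fun t w h1 h2 => by
        have s1 := hT1 w e e
        have s2 := hT2 e w e
        have s3 := hT1 w e w
        have s4 := hT2 w w e
        have s5 := hTeew w h1 h2
        have s6 := hTwww w h1 h2
        have s7 := hc w h1 h2
        simp only [map_add, map_smul, LinearMap.add_apply, LinearMap.smul_apply, smul_eq_mul, s4,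
          s3, s2, s1, s5, s6, s7]
        ring
    by_cases he0 : e = 0
    · refine ⟨0, 0, fun t w h1 h2 => ?_⟩
      simp only [he0, smul_zero, zero_add, hTwww w h1 h2, semiCForm_apply]
      ring
    · have hbe := hbne e he0
      refine ⟨c / b e e, (T e e e - 3 * c * h e e) / b e e ^ 3, fun t w h1 h2 => ?_⟩
      rw [hTe t w h1 h2, semiCForm_apply]
      simp only [map_add, map_smul, LinearMap.add_apply, LinearMap.smul_apply, smul_eq_mul,
        hθw w h2, hhe w h1 h2, hhs w e, hhw w h1 h2]
      rw [← he]
      field_simp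
      ring
  refine ⟨θ, a', c', hθy, fun u v w => ?_⟩
  have hneg : ∀ u v w, semiCForm (-a') (-c') θ h u v w = -semiCForm a' c' θ h u v w :=
    fun u v w => by simp only [semiCForm_apply]; ring
  suffices hD : (T + semiCForm (-a') (-c') θ h) u v w = 0 by
    simp only [LinearMap.add_apply, hneg] at hD
    linarith
  refine trilinear_eq_zero (fun u v w => ?_) (fun u v w => ?_) (fun u => ?_) u v w
  · simp only [LinearMap.add_apply, semiCForm_apply, hT1 u v w, hhs v u]; ring
  · simp only [LinearMap.add_apply, semiCForm_apply, hT2 u v w, hhs v u, hhs w v, hhs w u]; ring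
  · -- decompose `u = s y + t e + w`
    obtain ⟨s, t, w, h1, h2, rfl⟩ : ∃ (s t : ℝ) (w : V), b w y = 0 ∧ b w e = 0 ∧
        u = s • y + (t • e + w) := by
      by_cases he0 : e = 0
      · refine ⟨b u y / b y y, 0, u - (b u y / b y y) • y, ?_, by simp [he0], by simp⟩
        simp [div_mul_cancel₀ _ (hbne y hy)]
      · refine ⟨b u y / b y y, b u e / b e e,
          u - (b u y / b y y) • y - (b u e / b e e) • e, ?_, ?_, by abel⟩
        · simp [div_mul_cancel₀ _ (hbne y hy), hey]
        · simp [div_mul_cancel₀ _ (hbne e he0), hb y e, hey]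
    simp only [LinearMap.add_apply, hneg]
    have hyT1 : ∀ u v, T y u v = 0 := fun u v => by rw [hT1, hT2, hTy]
    have hyT2 : ∀ u v, T u y v = 0 := fun u v => by rw [hT2, hTy]
    have k := hac t w h1 h2
    set z := t • e + w
    have k1 : T (s • y + z) (s • y + z) (s • y + z) = T z z z := by
      simp only [map_add, map_smul, LinearMap.add_apply, LinearMap.smul_apply, smul_eq_mul, hyT1,
        hyT2, hTy]
      ring
    have k2 : semiCForm a' c' θ h (s • y + z) (s • y + z) (s • y + z) =
        semiCForm a' c' θ h z z z := by
      simp only [semiCForm_apply, map_add, map_smul, LinearMap.add_apply, LinearMap.smul_apply,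
        smul_eq_mul, hhy, hhs _ y, hθy]
      ring
    rw [k1, k2, k, add_neg_cancel]

end Trilinear

end Finsler

end

noncomputable section

namespace Finsler

open Matrix

/-! ### The characteristic scalar of a Minkowski norm -/

variable {n : ℕ}

/-- The vector `I^i = g^{ij} I_j` dual to the mean Cartan torsion. -/
def meanCartanVec (f : Coord n → ℝ) (y : Coord n) : Coord n :=
  WithLp.toLp 2 (gramInv f y *ᵥ fun k => meanCartan f y (stdVec k))

/-- The value that the identity of semi-C-reducibility, evaluated on the vector `I^i`, forces on the
scalar `p`. It is meaningful for `n ≥ 3` and `I ≠ 0`, and invariant under `C ↦ r C`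
for `r ≠ 0`. -/
def charScalar (f : Coord n → ℝ) (y : Coord n) : ℝ :=
  (n + 1) / (n - 2) * (1 - cartan f y (meanCartanVec f y) (meanCartanVec f y) (meanCartanVec f y) /
    meanCartanNormSq f y ^ 2)

/-- The `g_y`-trace of a bilinear form. -/
def gTrace (f : Coord n → ℝ) (y : Coord n) (b : Coord n → Coord n → ℝ) : ℝ :=
  ∑ j, ∑ k, gramInv f y j k * b (stdVec j) (stdVec k)

theorem meanCartan_eq_gTrace (f : Coord n → ℝ) (y u : Coord n) :
    meanCartan f y u = gTrace f y (cartan f y u) := rfl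

theorem meanCartanNormSq_eq_gTrace (f : Coord n → ℝ) (y : Coord n) :
    meanCartanNormSq f y = gTrace f y fun u v => meanCartan f y u * meanCartan f y v := by
  simp only [meanCartanNormSq, gTrace, mul_assoc]

/-- The semi-C-reducibility identity at one tangent vector. -/
def SemiCReducibleAt (f : Coord n → ℝ) (y : Coord n) (p q : ℝ) : Prop :=
  p + q = 1 ∧ ∀ u₁ u₂ u₃ : Coord n,
    cartan f y u₁ u₂ u₃ =
      p / (n + 1) * (meanCartan f y u₁ * angular f y u₂ u₃
        + meanCartan f y u₂ * angular f y u₁ u₃ + meanCartan f y u₃ * angular f y u₂ u₁)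
      + q / meanCartanNormSq f y
        * (meanCartan f y u₁ * meanCartan f y u₂ * meanCartan f y u₃)

namespace IsMinkowskiNorm

variable {f : Coord n → ℝ} (hf : IsMinkowskiNorm f) {y : Coord n} (hy : y ≠ 0)

include hf hy

/-- The mean Cartan torsion as a linear form. -/
def mForm : Coord n →ₗ[ℝ] ℝ where
  toFun := meanCartan f y
  map_add' u v := by
    simp only [meanCartan, ← hf.cForm_apply hy, map_add, LinearMap.add_apply, mul_add,
      Finset.sum_add_distrib]
  map_smul' r u := by
    simp only [meanCartan, ← hf.cForm_apply hy, map_smul, LinearMap.smul_apply, smul_eq_mul,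
      Finset.mul_sum, RingHom.id_apply, mul_left_comm r]

theorem mForm_apply (u : Coord n) : hf.mForm hy u = meanCartan f y u := rfl

theorem gForm_stdVec (z : Coord n) (j : Fin n) :
    hf.gForm hy z (stdVec j) = (gramMatrix f y *ᵥ z.ofLp) j := by
  rw [gForm_apply, hf.fundForm_symm hy, ← hf.gForm_apply hy, gForm_eq_sum]
  simp [stdVec]

theorem gTrace_gForm_mul (z : Coord n) (η : Coord n →ₗ[ℝ] ℝ) :
    gTrace f y (fun u v => hf.gForm hy z u * η v) = η z := by
  have h1 : gTrace f y (fun u v => hf.gForm hy z u * η v) =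
      (gramMatrix f y *ᵥ z.ofLp) ⬝ᵥ (gramInv f y *ᵥ fun k => η (stdVec k)) := by
    simp only [gTrace, gForm_stdVec, dotProduct]
    refine Finset.sum_congr rfl fun j _ => ?_
    simp only [mulVec, dotProduct, Finset.mul_sum]
    exact Finset.sum_congr rfl fun k _ => by ring
  rw [h1, dotProduct_comm, dotProduct_mulVec, ← mulVec_transpose]
  have h2 : (gramMatrix f y)ᵀ = gramMatrix f y := by
    ext i j; exact hf.gramMatrix_symm hy j i
  rw [h2, mulVec_mulVec, hf.mul_gramInv hy, one_mulVec, map_eq_sum_stdVec η z]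
  exact Finset.sum_congr rfl fun k _ => mul_comm _ _

theorem gTrace_gForm : gTrace f y (fun u v => hf.gForm hy u v) = n := by
  have h : gTrace f y (fun u v => hf.gForm hy u v) = (gramInv f y * (gramMatrix f y)ᵀ).trace := rfl
  have h2 : (gramMatrix f y)ᵀ = gramMatrix f y := by
    ext i j; exact hf.gramMatrix_symm hy j i
  rw [h, h2, hf.gramInv_mul hy]
  simp

/-- The angular form as a bilinear form. -/
def hForm : Coord n →ₗ[ℝ] Coord n →ₗ[ℝ] ℝ :=
  hf.gForm hy - (hf.gForm hy y y)⁻¹ • (hf.gForm hy y).smulRight (hf.gForm hy y)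

theorem hForm_apply (u v : Coord n) : hf.hForm hy u v = angular f y u v := by
  simp [hForm, angular, hf.gForm_self hy, gForm_apply]
  ring

theorem gForm_self_ne_zero : hf.gForm hy y y ≠ 0 := (hf.gForm_pos hy hy).ne'

theorem gForm_symm (u v : Coord n) : hf.gForm hy u v = hf.gForm hy v u := hf.fundForm_symm hy u v

/-- The trace of `a (θ h + θ h + θ h) + c θ θ θ`. -/
theorem gTrace_semiCForm (a c : ℝ) (θ : Coord n →ₗ[ℝ] ℝ) (hθ : θ y = 0) (u : Coord n) :
    gTrace f y (fun v w => semiCForm a c θ (hf.hForm hy) u v w) =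
      (a * (n + 1) + c * gTrace f y fun v w => θ v * θ w) * θ u := by
  set i := (hf.gForm hy y y)⁻¹ with hi
  have hii : i * hf.gForm hy y y = 1 := inv_mul_cancel₀ (hf.gForm_self_ne_zero hy)
  have hexp : ∀ v w, hf.hForm hy v w = hf.gForm hy v w - i * (hf.gForm hy y v * hf.gForm hy y w) :=
    fun v w => by simp [hForm, hi]
  have hlin : ∀ (r : ℝ) (b : Coord n → Coord n → ℝ),
      gTrace f y (fun v w => r * b v w) = r * gTrace f y b := fun r b => by
    simp only [gTrace, Finset.mul_sum, mul_left_comm r]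
  have hadd : ∀ b b' : Coord n → Coord n → ℝ,
      gTrace f y (fun v w => b v w + b' v w) = gTrace f y b + gTrace f y b' := fun b b' => by
    simp only [gTrace, mul_add, Finset.sum_add_distrib]
  have hcomm : ∀ b : Coord n → Coord n → ℝ,
      gTrace f y (fun v w => b w v) = gTrace f y b := fun b => by
    simp only [gTrace]
    rw [Finset.sum_comm]
    refine Finset.sum_congr rfl fun k _ => Finset.sum_congr rfl fun j _ => ?_
    rw [← hf.gramInv_transpose hy, transpose_apply, hf.gramInv_transpose hy]
  have t1 : gTrace f y (fun v w => hf.gForm hy v w) = n := hf.gTrace_gForm hy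
  have t2 := hf.gTrace_gForm_mul hy y (hf.gForm hy y)
  have t3 := hf.gTrace_gForm_mul hy u θ
  have t4 := hf.gTrace_gForm_mul hy y θ
  rw [hθ] at t4
  have e : (fun v w => semiCForm a c θ (hf.hForm hy) u v w) = fun v w =>
      ((a * θ u) * hf.gForm hy v w + (-(a * θ u * i)) * (hf.gForm hy y v * hf.gForm hy y w))
      + ((a * (hf.gForm hy u w * θ v) + (-(a * i * hf.gForm hy y u)) * (hf.gForm hy y w * θ v))
      + (a * (hf.gForm hy u v * θ w) + (-(a * i * hf.gForm hy y u)) * (hf.gForm hy y v * θ w)))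
      + (c * θ u) * (θ v * θ w) := by
    ext v w
    rw [semiCForm_apply, hexp, hexp, hexp, hf.gForm_symm hy v u]
    ring
  rw [e]
  simp only [hadd, hlin]
  rw [hcomm (fun v w => hf.gForm hy u v * θ w), hcomm (fun v w => hf.gForm hy y v * θ w), t1, t2,
    t3, t4]
  linear_combination (-(a * θ u)) * hii

theorem gForm_meanCartanVec (v : Coord n) :
    hf.gForm hy (meanCartanVec f y) v = meanCartan f y v := by
  rw [map_eq_sum_stdVec (hf.gForm hy _), ← hf.mForm_apply hy, map_eq_sum_stdVec (hf.mForm hy)]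
  refine Finset.sum_congr rfl fun j _ => ?_
  rw [gForm_stdVec, meanCartanVec]
  simp only [mulVec_mulVec, hf.mul_gramInv hy, one_mulVec]
  rfl

theorem meanCartan_meanCartanVec : meanCartan f y (meanCartanVec f y) = meanCartanNormSq f y := by
  rw [← hf.mForm_apply hy, meanCartanNormSq_eq_gTrace]
  rw [← hf.gTrace_gForm_mul hy]
  simp only [gForm_meanCartanVec]
  rfl

theorem meanCartan_self : meanCartan f y y = 0 := by
  have : ∀ v w, cartan f y y v w = 0 := fun v w => by
    rw [hf.cartan_swap_left hy, hf.cartan_swap_right hy]; exact hf.cForm_self hy v w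
  simp [meanCartan, this]

theorem meanCartanNormSq_pos {u : Coord n} (hu : meanCartan f y u ≠ 0) :
    0 < meanCartanNormSq f y := by
  rw [← hf.meanCartan_meanCartanVec hy, ← hf.gForm_meanCartanVec hy]
  refine hf.gForm_pos hy fun h => hu ?_
  rw [← hf.gForm_meanCartanVec hy, h]
  simp

theorem meanCartanNormSq_ne_zero_iff :
    meanCartanNormSq f y ≠ 0 ↔ ∃ u, meanCartan f y u ≠ 0 := by
  refine ⟨fun h => ⟨meanCartanVec f y, ?_⟩, fun ⟨u, hu⟩ => (hf.meanCartanNormSq_pos hy hu).ne'⟩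
  rwa [hf.meanCartan_meanCartanVec hy]

/-- The scalar `p` of a semi-C-reducible Cartan torsion is determined by the norm. -/
theorem eq_charScalar (hn : 3 ≤ n) {p q : ℝ} (hI : meanCartanNormSq f y ≠ 0)
    (h : SemiCReducibleAt f y p q) : p = charScalar f y := by
  obtain ⟨hpq, h⟩ := h
  have h1 := h (meanCartanVec f y) (meanCartanVec f y) (meanCartanVec f y)
  have hg : fundForm f y (meanCartanVec f y) (meanCartanVec f y) = meanCartanNormSq f y := by
    rw [← hf.gForm_apply hy, hf.gForm_meanCartanVec hy, hf.meanCartan_meanCartanVec hy]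
  have hgy : fundForm f y y (meanCartanVec f y) = 0 := by
    rw [hf.fundForm_symm hy, ← hf.gForm_apply hy, hf.gForm_meanCartanVec hy, hf.meanCartan_self hy]
  have ha : angular f y (meanCartanVec f y) (meanCartanVec f y) = meanCartanNormSq f y := by
    rw [angular, hg, hgy]; simp
  rw [ha, hf.meanCartan_meanCartanVec hy] at h1
  have hn' : (3 : ℝ) ≤ n := by exact_mod_cast hn
  have hn2 : (n : ℝ) - 2 ≠ 0 := by linarith
  have hn1 : (n : ℝ) + 1 ≠ 0 := by linarith
  obtain rfl : q = 1 - p := by linarith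
  rw [charScalar, h1]
  field_simp
  ring

/-- If the Cartan torsion is a combination of `θ h` and `θ θ θ`, where `θ` vanishes on `y`, then `θ`
is proportional to the mean Cartan torsion. -/
theorem exists_semiCReducibleAt {a c : ℝ} {θ : Coord n →ₗ[ℝ] ℝ} (hθ : θ y = 0)
    (h : ∀ u v w, hf.cForm hy u v w = semiCForm a c θ (hf.hForm hy) u v w)
    (hI : meanCartanNormSq f y ≠ 0) : ∃ p q, SemiCReducibleAt f y p q := by
  set τ := gTrace f y fun v w => θ v * θ w with hτ
  set μ := a * (n + 1) + c * τ with hμ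
  have hm : ∀ u, meanCartan f y u = μ * θ u := fun u => by
    rw [hμ, hτ, ← hf.gTrace_semiCForm hy a c θ hθ u, meanCartan_eq_gTrace]
    simp only [← h]
    rfl
  have hnorm : meanCartanNormSq f y = μ ^ 2 * τ := by
    simp only [meanCartanNormSq_eq_gTrace, hm, hτ, gTrace, Finset.mul_sum]
    exact Finset.sum_congr rfl fun _ _ => Finset.sum_congr rfl fun _ _ => by ring
  rw [hnorm] at hI
  have hμ0 : μ ≠ 0 := fun h => hI (by rw [h]; ring)
  have hτ0 : τ ≠ 0 := fun h => hI (by rw [h]; ring)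
  have hn1 : (n : ℝ) + 1 ≠ 0 := by positivity
  refine ⟨(n + 1) * a / μ, c * τ / μ, ?_, fun u v w => ?_⟩
  · rw [← add_div, div_eq_one_iff_eq hμ0, hμ]; ring
  · rw [← hf.cForm_apply hy, h, semiCForm_apply, hm, hm, hm, hnorm, hf.hForm_apply, hf.hForm_apply,
      hf.hForm_apply]
    field_simp

/-- A Minkowski norm invariant under the isometries of a Euclidean inner product that preserve a
linear form has a semi-C-reducible Cartan torsion. -/
theorem exists_semiCReducibleAt_of_invariant (b : Coord n →ₗ[ℝ] Coord n →ₗ[ℝ] ℝ)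
    (hb : ∀ u v, b u v = b v u) (hbpos : ∀ u, u ≠ 0 → 0 < b u u) (β : Coord n →ₗ[ℝ] ℝ)
    (hinv : ∀ R : Coord n →ₗ[ℝ] Coord n, (∀ u, b (R u) (R u) = b u u) → (∀ u, β (R u) = β u) →
      ∀ u, f (R u) = f u) (hI : meanCartanNormSq f y ≠ 0) :
    ∃ p q, SemiCReducibleAt f y p q := by
  have h := exists_eq_semiC_of_invariant (g := hf.gForm hy) (T := hf.cForm hy) (y := y) hb hbpos
    (fun u hu => hf.gForm_pos hy hu) (hf.gForm_symm hy) (hf.cartan_swap_left hy)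
    (hf.cartan_swap_right hy) (hf.cForm_self hy) β hy
    (fun R hRy h1 h2 u v w => by
      have := cartan_comp f R y u v w
      simp only [hinv R h1 h2, hRy] at this
      exact this.symm)
    (fun R hRy h1 h2 u v => by
      have := fundForm_comp f R y u v
      simp only [hinv R h1 h2, hRy] at this
      exact this.symm)
  obtain ⟨θ, a, c, hθ, h⟩ := h
  exact hf.exists_semiCReducibleAt hy hθ h hI

/-- Invariance of the trace under linear changes of coordinates. -/
theorem gTrace_comp (A : Coord n ≃ₗ[ℝ] Coord n) {z : Coord n} (hz : A z = y)
    (b : Coord n →ₗ[ℝ] Coord n →ₗ[ℝ] ℝ) :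
    gTrace (fun x => f (A x)) z (fun u v => b (A u) (A v)) = gTrace f y fun u v => b u v := by
  set M : Matrix (Fin n) (Fin n) ℝ := Matrix.of fun i j => A (stdVec j) i with hM
  set B : Matrix (Fin n) (Fin n) ℝ := Matrix.of fun i j => b (stdVec i) (stdVec j) with hB
  have hbil : ∀ (b' : Coord n →ₗ[ℝ] Coord n →ₗ[ℝ] ℝ) (u v : Coord n), b' u v =
      u.ofLp ⬝ᵥ ((Matrix.of fun i j => b' (stdVec i) (stdVec j)) *ᵥ v.ofLp) := fun b' u v => by
    rw [← LinearMap.flip_apply, map_eq_sum_stdVec]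
    refine Finset.sum_congr rfl fun i _ => ?_
    rw [LinearMap.flip_apply, map_eq_sum_stdVec]
    congr 1
    exact Finset.sum_congr rfl fun j _ => mul_comm _ _
  have hcong : ∀ (b' : Coord n →ₗ[ℝ] Coord n →ₗ[ℝ] ℝ) (i j : Fin n),
      b' (A (stdVec i)) (A (stdVec j)) =
      (Mᵀ * (Matrix.of fun i j => b' (stdVec i) (stdVec j)) * M) i j := fun b' i j => by
    rw [hbil b', Matrix.mul_assoc, Matrix.mul_apply]
    simp only [dotProduct, Matrix.mul_apply, mulVec, hM, transpose_apply, Matrix.of_apply]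
  have hG : gramMatrix (fun x => f (A x)) z = Mᵀ * gramMatrix f y * M := by
    ext i j
    have h1 := fundForm_comp f A.toLinearMap z (stdVec i) (stdVec j)
    have h2 := hcong (hf.gForm hy) i j
    simp only [LinearEquiv.coe_coe, hz] at h1
    exact h1.trans h2
  have hMinv : IsUnit M.det := by
    set M' : Matrix (Fin n) (Fin n) ℝ := Matrix.of fun i j => A.symm (stdVec j) i with hM'
    have : M * M' = 1 := by
      ext i j
      have h1 : A (A.symm (stdVec j)) i = (stdVec j : Coord n) i := by rw [A.apply_symm_apply]
      conv_lhs at h1 => rw [← sum_stdVec (A.symm (stdVec j))]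
      simp only [map_sum, map_smul] at h1
      rw [Matrix.mul_apply]
      simp only [hM, hM', Matrix.of_apply]
      rw [Matrix.one_apply]
      simp at h1
      rw [← h1]
      exact Finset.sum_congr rfl fun k _ => mul_comm _ _
    exact isUnit_det_of_right_inverse this
  have hdet : IsUnit Mᵀ.det := by rwa [det_transpose]
  have htr : ∀ (f' : Coord n → ℝ) (z' : Coord n) (b' : Coord n → Coord n → ℝ), gTrace f' z' b' =
      (gramInv f' z' * (Matrix.of fun i j => b' (stdVec i) (stdVec j))ᵀ).trace := fun _ _ _ => rfl
  have hcong' : (Matrix.of fun i j => b (A (stdVec i)) (A (stdVec j))) = Mᵀ * B * M := by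
    ext i j; exact hcong b i j
  rw [htr, htr, hcong', gramInv, hG, Matrix.mul_inv_rev, Matrix.mul_inv_rev]
  rw [transpose_mul, transpose_mul, transpose_transpose]
  rw [show M⁻¹ * ((gramMatrix f y)⁻¹ * Mᵀ⁻¹) * (Mᵀ * (Bᵀ * M)) =
    M⁻¹ * ((gramMatrix f y)⁻¹ * (Mᵀ⁻¹ * Mᵀ) * Bᵀ * M) by simp only [Matrix.mul_assoc]]
  rw [Matrix.nonsing_inv_mul _ hdet, mul_one, trace_mul_comm, Matrix.mul_assoc,
    Matrix.mul_nonsing_inv _ hMinv, mul_one]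
  rfl

theorem meanCartan_comp (A : Coord n ≃ₗ[ℝ] Coord n) {z : Coord n} (hz : A z = y) (u : Coord n) :
    meanCartan (fun x => f (A x)) z u = meanCartan f y (A u) := by
  rw [meanCartan_eq_gTrace, meanCartan_eq_gTrace]
  refine Eq.trans ?_ (hf.gTrace_comp hy A hz (hf.cForm hy (A u)))
  congr 1
  ext v w
  have := cartan_comp f A.toLinearMap z u v w
  simp only [LinearEquiv.coe_coe, hz] at this
  exact this

theorem meanCartanNormSq_comp (A : Coord n ≃ₗ[ℝ] Coord n) {z : Coord n} (hz : A z = y) :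
    meanCartanNormSq (fun x => f (A x)) z = meanCartanNormSq f y := by
  rw [meanCartanNormSq_eq_gTrace, meanCartanNormSq_eq_gTrace]
  refine Eq.trans ?_ (hf.gTrace_comp hy A hz ((hf.mForm hy).smulRight (hf.mForm hy)))
  congr 1
  ext v w
  simp [hf.meanCartan_comp hy A hz, mForm_apply]

theorem semiCReducibleAt_comp (A : Coord n ≃ₗ[ℝ] Coord n) {z : Coord n} (hz : A z = y) {p q : ℝ}
    (h : SemiCReducibleAt f y p q) : SemiCReducibleAt (fun x => f (A x)) z p q := by
  refine ⟨h.1, fun u v w => ?_⟩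
  have h1 := cartan_comp f A.toLinearMap z
  have h2 := angular_comp f A.toLinearMap z
  simp only [LinearEquiv.coe_coe, hz] at h1 h2
  rw [h1, h2, h2, h2, hf.meanCartan_comp hy A hz, hf.meanCartan_comp hy A hz,
    hf.meanCartan_comp hy A hz, hf.meanCartanNormSq_comp hy A hz, h.2]

end IsMinkowskiNorm

end Finsler

end

noncomputable section

namespace Finsler

open Matrix

/-! ### Finsler metrics in local coordinates -/

variable {n : ℕ}

/-- A Finsler metric over an open set of `ℝⁿ`, in the standard coordinates of the tangent bundle. -/
structure IsLocalFinsler (f : Coord n → Coord n → ℝ) (Ω : Set (Coord n)) : Prop where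
  isOpen : IsOpen Ω
  smooth : ContDiffOn ℝ ∞ (fun p : Coord n × Coord n => f p.1 p.2) (Ω ×ˢ {0}ᶜ)
  homog : ∀ x ∈ Ω, ∀ (y : Coord n) (r : ℝ), 0 < r → f x (r • y) = r * f x y
  posDef : ∀ x ∈ Ω, ∀ y u : Coord n, y ≠ 0 → u ≠ 0 → 0 < fundForm (f x) y u u

/-- `a` is the restriction to `S` of the curried function `φ`; the curried form is that of the local
formulas of Finsler geometry. -/
def Represents₂ {S : Set (Coord n × Coord n)} (φ : Coord n → Coord n → ℝ) (a : smoothFun S) :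
    Prop := ∀ s : S, φ s.1.1 s.1.2 = a.1 s

theorem Represents₂.uncurry {S : Set (Coord n × Coord n)} {φ : Coord n → Coord n → ℝ}
    {a : smoothFun S} (h : Represents₂ φ a) :
    Represents (fun p : Coord n × Coord n => φ p.1 p.2) a := h

theorem Represents₂.sum {S : Set (Coord n × Coord n)} {ι : Type*} (t : Finset ι)
    {φ : ι → Coord n → Coord n → ℝ} {a : ι → smoothFun S} (h : ∀ i, Represents₂ (φ i) (a i)) :
    Represents₂ (fun x y => ∑ i ∈ t, φ i x y) (∑ i ∈ t, a i) := fun s => by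
  rw [← evalAt_apply, map_sum]
  exact Finset.sum_congr rfl fun i _ => h i s

section

variable {S : Set (Coord n × Coord n)} (hS : IsOpen S)

include hS

theorem Represents₂.dX {φ : Coord n → Coord n → ℝ} {a : smoothFun S} (h : Represents₂ φ a)
    (k : Fin n) : Represents₂ (dX k φ) (dirDeriv hS (stdVec k, 0) a) := fun s => by
  rw [← Represents.lineDeriv hS h.uncurry (stdVec k, 0) s]
  simp [Finsler.dX, lineDeriv]

theorem Represents₂.dY {φ : Coord n → Coord n → ℝ} {a : smoothFun S} (h : Represents₂ φ a)
    (k : Fin n) : Represents₂ (dY k φ) (dirDeriv hS (0, stdVec k) a) := fun s => by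
  rw [← Represents.lineDeriv hS h.uncurry (0, stdVec k) s]
  simp [Finsler.dY, lineDeriv]

end

namespace IsLocalFinsler

variable {f : Coord n → Coord n → ℝ} {Ω : Set (Coord n)} (hf : IsLocalFinsler f Ω)

include hf

theorem isMinkowskiNorm {x : Coord n} (hx : x ∈ Ω) : IsMinkowskiNorm (f x) where
  smooth := hf.smooth.comp (s := {0}ᶜ) (f := fun y => (x, y)) (by fun_prop) fun _ hy => ⟨hx, hy⟩
  homog := hf.homog x hx
  posDef := hf.posDef x hx

variable {S : Set (Coord n × Coord n)} (hS : IsOpen S) (hsub : S ⊆ Ω ×ˢ {0}ᶜ)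

include hsub

/-- The function `F²` on an open set of nonzero tangent vectors. -/
def energy : smoothFun S := smoothFun.mk (fun p => f p.1 p.2 ^ 2) ((hf.smooth.mono hsub).pow 2)

theorem represents_energy : Represents₂ (fun x y => f x y ^ 2) (hf.energy hsub) :=
  fun _ => rfl

theorem represents_fundForm (i j : Fin n) :
    Represents₂ (fun x y => fundForm (f x) y (stdVec i) (stdVec j))
      ((1 / 2 : ℝ) • dirDeriv hS (0, stdVec i) (dirDeriv hS (0, stdVec j) (hf.energy hsub))) :=
  fun s => by
    change _ = (1 / 2 : ℝ) * (dirDeriv hS (0, stdVec i)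
      (dirDeriv hS (0, stdVec j) (hf.energy hsub))).1 s
    rw [← Represents₂.dY hS (Represents₂.dY hS (hf.represents_energy hsub) j) i s]
    rfl

theorem exists_ginv : ∃ M : Matrix (Fin n) (Fin n) (smoothFun S),
    M * (Matrix.of fun i j => dirDeriv hS (0, stdVec i)
      (dirDeriv hS (0, stdVec j) (hf.energy hsub))) = 1 := by
  refine exists_matrix_mul_eq_one _ fun s => ?_
  have h1 := (hf.isMinkowskiNorm (hsub s.2).1).det_gramMatrix_ne_zero (hsub s.2).2
  have h2 : (Matrix.of fun i j => dirDeriv hS (0, stdVec i)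
      (dirDeriv hS (0, stdVec j) (hf.energy hsub))).map (evalAt s) =
        (2 : ℝ) • gramMatrix (f s.1.1) s.1.2 := by
    ext i j
    have h := hf.represents_fundForm hS hsub i j s
    simp only [Matrix.map_apply, Matrix.of_apply, evalAt_apply, Matrix.smul_apply, gramMatrix, h]
    change _ = (2 : ℝ) * ((1 / 2 : ℝ) * _)
    ring
  rw [h2, Matrix.det_smul]
  exact mul_ne_zero (by positivity) h1

/-- The `i`-th fibre coordinate. -/
def fibreCoord (S : Set (Coord n × Coord n)) (i : Fin n) : smoothFun S :=
  smoothFun.mk (fun p => p.2 i) (by fun_prop)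

/-- The spray algebra of a Finsler metric, on an open set of nonzero tangent vectors. -/
def sprayAlgebra : SprayAlgebra n (smoothFun S) where
  dx i := dirDeriv hS (stdVec i, 0)
  dy i := dirDeriv hS (0, stdVec i)
  dx_dx _ _ _ := dirDeriv_comm _ _ _ _
  dy_dy _ _ _ := dirDeriv_comm _ _ _ _
  dy_dx _ _ _ := dirDeriv_comm _ _ _ _
  y := fibreCoord S
  dx_y i j := by
    ext s
    have h := Represents₂.dX hS (φ := fun _ y => y j) (a := fibreCoord S j)
      (fun _ => rfl) i s
    rw [← h]
    simp [dX, lineDeriv]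
  dy_y i j := by
    ext s
    have h := Represents₂.dY hS (φ := fun _ y => y j) (a := fibreCoord S j)
      (fun _ => rfl) i s
    rw [← h]
    have h1 : dY i (fun _ y => y j) s.1.1 s.1.2 = (stdVec i : Coord n) j := by
      have h2 := ((EuclideanSpace.proj (𝕜 := ℝ) j : Coord n →L[ℝ] ℝ).hasFDerivAt
        (x := s.1.2)).hasLineDerivAt (stdVec i)
      exact h2.lineDeriv
    rw [h1]
    by_cases h : i = j
    · subst h; simp
    · have h' : j ≠ i := fun e => h e.symm
      simp [h, h']
  E := hf.energy hsub
  euler := by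
    ext s
    have hE := (hf.represents_energy hsub).uncurry
    have h1 := Represents.lineDeriv hS hE (0, s.1.2) s
    have h2 : lineDeriv ℝ (fun p : Coord n × Coord n => f p.1 p.2 ^ 2) s (0, s.1.2) =
        2 * f s.1.1 s.1.2 ^ 2 := by
      rw [← lineDeriv_self_sq (hf.homog _ (hsub s.2).1) s.1.2]
      simp [lineDeriv]
    have h3 := Represents.dirDeriv_eq_fderiv hS hE (0, s.1.2) s
    have h4 : ((0, s.1.2) : Coord n × Coord n) = ∑ i, s.1.2 i • (0, stdVec i) := by
      ext1
      · simp [Prod.fst_sum]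
      · simp [Prod.snd_sum]; exact (sum_stdVec _).symm
    rw [← h1] at h3
    beta_reduce at h3
    rw [h2] at h3
    conv_lhs at h3 => rw [h4, map_sum]
    simp only [map_smul, smul_eq_mul] at h3
    rw [← evalAt_apply, ← evalAt_apply]
    simp only [map_sum, map_mul, evalAt_apply, map_ofNat]
    rw [← hE s, ← h3]
    refine Finset.sum_congr rfl fun i _ => ?_
    rw [← Represents.dirDeriv_eq_fderiv hS hE _ s]
    rfl
  G i := algebraMap ℝ _ (1 / 2) * ∑ l, (hf.exists_ginv hS hsub).choose i l *
    ((∑ k, dirDeriv hS (stdVec k, 0) (dirDeriv hS (0, stdVec l) (hf.energy hsub)) * fibreCoord S k)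
      - dirDeriv hS (stdVec l, 0) (hf.energy hsub))
  spray i := by
    set H : Matrix (Fin n) (Fin n) (smoothFun S) := Matrix.of fun i j => dirDeriv hS (0, stdVec i)
      (dirDeriv hS (0, stdVec j) (hf.energy hsub)) with hH
    set M := (hf.exists_ginv hS hsub).choose with hM
    have h1 : H * M = 1 := mul_eq_one_comm.1 (hf.exists_ginv hS hsub).choose_spec
    set b : Fin n → smoothFun S := fun l => (∑ k, dirDeriv hS (stdVec k, 0)
      (dirDeriv hS (0, stdVec l) (hf.energy hsub)) * fibreCoord S k)
      - dirDeriv hS (stdVec l, 0) (hf.energy hsub) with hb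
    have h2 : (H *ᵥ (M *ᵥ b)) i = b i := by rw [mulVec_mulVec, h1, one_mulVec]
    have h3 : (2 : smoothFun S) * algebraMap ℝ _ (1 / 2) = 1 := by
      rw [← map_ofNat (algebraMap ℝ (smoothFun S)) 2, ← map_mul]
      norm_num
    refine Eq.trans ?_ h2
    simp only [mulVec, dotProduct, mul_left_comm _ (algebraMap ℝ (smoothFun S) (1 / 2)),
      ← Finset.mul_sum]
    rw [← mul_assoc, mul_comm _ (2 : smoothFun S), h3, one_mul]
    rfl
  ginv := (hf.exists_ginv hS hsub).choose
  ginv_mul := (hf.exists_ginv hS hsub).choose_spec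

theorem represents_gramMatrix (i j : Fin n) : Represents₂ (fun x y => gramMatrix (f x) y i j)
    ((1 / 2 : ℝ) • (hf.sprayAlgebra hS hsub).hess i j) := hf.represents_fundForm hS hsub i j

theorem represents_gramInv (i j : Fin n) : Represents₂ (fun x y => gramInv (f x) y i j)
    ((2 : ℝ) • (hf.sprayAlgebra hS hsub).ginv i j) := fun s => by
  have h1 : (hf.sprayAlgebra hS hsub).ginv.map (evalAt s) *
      (hf.sprayAlgebra hS hsub).hess.map (evalAt s) = 1 := by
    rw [← AlgHom.mapMatrix_apply, ← AlgHom.mapMatrix_apply, ← map_mul,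
      SprayAlgebra.ginv_mul_hess, map_one]
  have h2 : gramMatrix (f s.1.1) s.1.2 =
      (1 / 2 : ℝ) • (hf.sprayAlgebra hS hsub).hess.map (evalAt s) := by
    ext i j
    exact hf.represents_gramMatrix hS hsub i j s
  have h3 : ((2 : ℝ) • (hf.sprayAlgebra hS hsub).ginv.map (evalAt s)) *
      gramMatrix (f s.1.1) s.1.2 = 1 := by
    rw [h2, Matrix.smul_mul, Matrix.mul_smul, h1, smul_smul]
    norm_num
  change (gramMatrix (f s.1.1) s.1.2)⁻¹ i j = _
  rw [Matrix.inv_eq_left_inv h3]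
  rfl

theorem represents_sprayCoeff (i : Fin n) : Represents₂ (sprayCoeff f i)
    ((hf.sprayAlgebra hS hsub).G i) := fun s => by
  have hE := hf.represents_energy hsub
  rw [← evalAt_apply]
  simp only [sprayAlgebra, map_mul, map_sum, map_sub, AlgHom.commutes]
  simp only [sprayCoeff, hf.represents_gramInv hS hsub i _ s]
  simp only [evalAt_apply, ← Represents₂.dX hS (Represents₂.dY hS hE _) _ s,
    ← Represents₂.dX hS hE _ s]
  rw [Finset.mul_sum, Finset.mul_sum]
  refine Finset.sum_congr rfl fun l _ => ?_
  change (1 / 4 : ℝ) * ((2 : ℝ) * _ * _) = (1 / 2 : ℝ) * _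
  rw [show (hf.sprayAlgebra hS hsub).ginv = (hf.exists_ginv hS hsub).choose from rfl]
  have : ∀ k, (fibreCoord S k).1 s = s.1.2 k := fun k => rfl
  simp only [this]
  ring

theorem represents_nonlinConn (i k : Fin n) : Represents₂ (nonlinConn f i k)
    ((hf.sprayAlgebra hS hsub).N i k) :=
  Represents₂.dY hS (hf.represents_sprayCoeff hS hsub i) k

theorem represents_berwaldConn (i j k : Fin n) : Represents₂ (berwaldConn f i j k)
    ((hf.sprayAlgebra hS hsub).Γ k i j) := by
  rw [SprayAlgebra.Γ_symm]
  exact Represents₂.dY hS (hf.represents_nonlinConn hS hsub i k) j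

theorem represents_horizDeriv (k : Fin n) {φ : Coord n → Coord n → ℝ} {a : smoothFun S}
    (h : Represents₂ φ a) : Represents₂ (horizDeriv f k φ)
      ((hf.sprayAlgebra hS hsub).dx k a - ∑ m, (hf.sprayAlgebra hS hsub).N m k *
        (hf.sprayAlgebra hS hsub).dy m a) := fun s => by
  rw [← evalAt_apply]
  simp only [map_sub, map_sum, map_mul, evalAt_apply, horizDeriv,
    hf.represents_nonlinConn hS hsub _ _ s, Represents₂.dX hS h _ s, Represents₂.dY hS h _ s]
  rfl

theorem represents_horizCov {T : Fin n → Fin n → Fin n → Coord n → Coord n → ℝ}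
    {a : Fin n → Matrix (Fin n) (Fin n) (smoothFun S)}
    (h : ∀ i j k, Represents₂ (T i j k) (a k i j)) (i j k l : Fin n) :
    Represents₂ (horizCov f T i j k l) ((hf.sprayAlgebra hS hsub).cov a k l i j) := fun s => by
  rw [← evalAt_apply]
  simp only [SprayAlgebra.cov, Matrix.sub_apply, Matrix.sum_apply, Matrix.smul_apply, smul_eq_mul,
    Matrix.map_apply, Matrix.mul_apply, Matrix.transpose_apply, horizCov,
    hf.represents_horizDeriv hS hsub l (h i j k) s, hf.represents_berwaldConn hS hsub _ _ _ s,
    h _ _ _ s, map_sub, map_sum, map_mul, evalAt_apply]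
  simp only [← evalAt_apply, map_sub, map_sum, map_mul]
  congr 2
  exact Finset.sum_congr rfl fun m _ => mul_comm _ _

theorem represents_cartanCoeff (i j k : Fin n) : Represents₂ (cartanCoeff f i j k)
    ((1 / 4 : ℝ) • (hf.sprayAlgebra hS hsub).C k i j) := fun s => by
  have h := Represents₂.dY hS (hf.represents_gramMatrix hS hsub i j) k
  rw [Derivation.map_smul] at h
  replace h := h s
  change (1 / 2 : ℝ) * dY k (fun x y => gramMatrix (f x) y i j) s.1.1 s.1.2 = _
  rw [h]
  change (1 / 2 : ℝ) * ((1 / 2 : ℝ) * _) = (1 / 4 : ℝ) * _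
  rw [← mul_assoc]
  norm_num
  rfl

theorem represents_geodesicDeriv {φ : Coord n → Coord n → ℝ} {a : smoothFun S}
    (h : Represents₂ φ a) : Represents₂ (geodesicDeriv f φ) ((hf.sprayAlgebra hS hsub).X a) := by
  rw [← SprayAlgebra.X_eq_sum_horiz]
  refine Represents₂.sum _ fun k s => ?_
  rw [← evalAt_apply]
  rw [map_mul, mul_comm]
  rw [hf.represents_horizDeriv hS hsub k h s]
  rfl

theorem represents_sum_horizCov {T : Fin n → Fin n → Fin n → Coord n → Coord n → ℝ}
    {a : Fin n → Matrix (Fin n) (Fin n) (smoothFun S)}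
    (h : ∀ i j k, Represents₂ (T i j k) (a k i j)) (i j k : Fin n) :
    Represents₂ (fun x y => ∑ l, horizCov f T i j k l x y * y l)
      ((hf.sprayAlgebra hS hsub).D a k i j) := by
  rw [← SprayAlgebra.sum_y_smul_cov, Matrix.sum_apply]
  refine Represents₂.sum _ fun l s => ?_
  rw [← evalAt_apply]
  rw [Matrix.smul_apply, smul_eq_mul, map_mul, mul_comm]
  rw [hf.represents_horizCov hS hsub h i j k l s]
  rfl

theorem represents_riemannCoeff (i k : Fin n) : Represents₂ (riemannCoeff f i k)
    ((hf.sprayAlgebra hS hsub).R i k) := fun s => by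
  have hG := fun i => hf.represents_sprayCoeff hS hsub i
  rw [← evalAt_apply]
  simp only [SprayAlgebra.R, Matrix.sub_apply, Matrix.of_apply, Matrix.map_apply, Matrix.mul_apply,
    SprayAlgebra.X_apply, map_sub, map_mul, map_sum, map_ofNat, evalAt_apply, riemannCoeff,
    hG _ s, Represents₂.dX hS (hG _) _ s, Represents₂.dY hS (hG _) _ s,
    Represents₂.dX hS (Represents₂.dY hS (hG _) _) _ s,
    Represents₂.dY hS (Represents₂.dY hS (hG _) _) _ s]
  have : ∀ k, s.1.2 k = ((hf.sprayAlgebra hS hsub).y k).1 s := fun k => rfl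
  simp only [this]
  rw [sub_add]
  rfl

end IsLocalFinsler

end Finsler

end

noncomputable section

namespace Finsler

open Matrix

theorem SprayAlgebra.D_smul {n : ℕ} {A : Type*} [CommRing A] [Algebra ℝ A] (S : SprayAlgebra n A)
    (r : ℝ) (T : Fin n → Matrix (Fin n) (Fin n) A) (k : Fin n) :
    S.D (fun k => r • T k) k = r • S.D T k := by
  have h : (r • T k).map S.X = r • (T k).map S.X := by
    ext i j; simp
  simp only [SprayAlgebra.D, h, Matrix.mul_smul, Matrix.smul_mul, smul_sub, Finset.smul_sum,
    smul_comm r]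

section CubicForm

variable {n : ℕ}

theorem map_cubicForm {A B : Type*} [CommRing A] [CommRing B] (φ : A →+* B)
    (T : Fin n → Matrix (Fin n) (Fin n) A) (u v w : Fin n → A) :
    φ (cubicForm T u v w) = cubicForm (fun k => (T k).map φ) (fun k => φ (u k))
      (fun k => φ (v k)) (fun k => φ (w k)) := by
  simp [cubicForm, dotProduct, mulVec]

theorem cubicForm_smul {A : Type*} [CommRing A] (r s t z : A)
    (T : Fin n → Matrix (Fin n) (Fin n) A) (u v w : Fin n → A) :
    cubicForm (fun k => z • T k) (r • u) (s • v) (t • w) = z * r * s * t * cubicForm T u v w := by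
  simp only [cubicForm, Finset.mul_sum, smul_mulVec, mulVec_smul, dotProduct_smul,
    smul_dotProduct, smul_eq_mul, Pi.smul_apply]
  exact Finset.sum_congr rfl fun _ _ => by ring

theorem cubicForm_smul_cases {A : Type*} [CommRing A] (r : A)
    (T : Fin n → Matrix (Fin n) (Fin n) A) (v : Fin n → A) :
    cubicForm (fun k => r • T k) v v v = r * cubicForm T v v v ∧
    cubicForm T (r • v) v v = r * cubicForm T v v v ∧
    cubicForm T v (r • v) v = r * cubicForm T v v v ∧
    cubicForm T v v (r • v) = r * cubicForm T v v v := by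
  have h1 := cubicForm_smul 1 1 1 r T v v v
  have h2 := cubicForm_smul r 1 1 1 T v v v
  have h3 := cubicForm_smul 1 r 1 1 T v v v
  have h4 := cubicForm_smul 1 1 r 1 T v v v
  simp only [one_smul, one_mul, mul_one] at h1 h2 h3 h4
  exact ⟨h1, h2, h3, h4⟩

end CubicForm

variable {n : ℕ}

namespace IsLocalFinsler

variable {f : Coord n → Coord n → ℝ} {Ω : Set (Coord n)} (hf : IsLocalFinsler f Ω)
  {S : Set (Coord n × Coord n)} (hS : IsOpen S) (hsub : S ⊆ Ω ×ˢ {0}ᶜ)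

include hf

/-! ### Constant flag curvature -/

/-- The Riemann curvature of a Finsler metric of constant flag curvature `κ` is
`R^m_k = κ (F² δ^m_k - y^m y_k)`. The flag curvature gives the quadratic form `g_y(u, R u)` for `u`
not proportional to `y`; the whole form is recovered from the self-adjointness of `R` by
polarization. -/
theorem R_eq_of_flagCurvature_eq (hn : 2 ≤ n) {κ : ℝ} (hκ : κ ≠ 0)
    (hflag : ∀ x ∈ Ω, ∀ y u : Coord n, LinearIndependent ℝ ![y, u] → flagCurvature f x y u = κ)
    (m k : Fin n) : 2 * (hf.sprayAlgebra hS hsub).R m k = algebraMap ℝ (smoothFun S) κ *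
      ((if m = k then 2 * (hf.sprayAlgebra hS hsub).E else 0) -
        (hf.sprayAlgebra hS hsub).y m * (hf.sprayAlgebra hS hsub).dy k
          (hf.sprayAlgebra hS hsub).E) := by
  set 𝒮 := hf.sprayAlgebra hS hsub with h𝒮
  ext s
  obtain ⟨⟨x, y⟩, hs⟩ := s
  have hx : x ∈ Ω := (hsub hs).1
  have hy : y ≠ 0 := (hsub hs).2
  have hM := hf.isMinkowskiNorm hx
  set g := hM.gForm hy with hg
  let Rl : Coord n →ₗ[ℝ] Coord n :=
    { toFun := riemann f x y
      map_add' := fun u v => by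
        ext i; simp [riemann, mul_add, Finset.sum_add_distrib]
      map_smul' := fun r u => by
        ext i; simp [riemann, Finset.mul_sum, mul_left_comm] }
  have hRm : ∀ u, (Rl u).ofLp = 𝒮.R.map (evalAt ⟨(x, y), hs⟩) *ᵥ u.ofLp := fun u => by
    ext i
    simp only [mulVec, dotProduct, Matrix.map_apply, evalAt_apply, h𝒮,
      ← hf.represents_riemannCoeff hS hsub i _ ⟨(x, y), hs⟩]
    rfl
  have hG : gramMatrix (f x) y = (1 / 2 : ℝ) • 𝒮.hess.map (evalAt ⟨(x, y), hs⟩) := by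
    ext i j
    exact hf.represents_gramMatrix hS hsub i j ⟨(x, y), hs⟩
  have hsymm : ∀ u v, g u (Rl v) = g v (Rl u) := fun u v => by
    have h1 : (gramMatrix (f x) y * 𝒮.R.map (evalAt ⟨(x, y), hs⟩))ᵀ =
        gramMatrix (f x) y * 𝒮.R.map (evalAt ⟨(x, y), hs⟩) := by
      rw [hG, Matrix.smul_mul, transpose_smul]
      congr 1
      ext i j
      have := congrArg (evalAt ⟨(x, y), hs⟩) (𝒮.hess_mul_R_symm j i)
      simpa [Matrix.mul_apply] using this
    rw [hg, hM.gForm_eq_sum, hM.gForm_eq_sum, hRm, hRm, mulVec_mulVec, mulVec_mulVec]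
    conv_lhs => rw [← h1]
    rw [mulVec_transpose, dotProduct_comm, ← dotProduct_mulVec]
  -- the quadratic form of `B` vanishes
  let B : Coord n → Coord n → ℝ := fun u v =>
    g u (Rl v) - κ * (g y y * g u v - g y u * g y v)
  have hBadd : ∀ u v w, B u (v + w) = B u v + B u w := fun u v w => by
    simp only [B, map_add]; ring
  have hBsymm : ∀ u v, B u v = B v u := fun u v => by
    have h1 : g u v = g v u := hM.gForm_symm hy u v
    simp only [B]
    rw [hsymm u v, h1]
    ring
  have hBsmul : ∀ (r : ℝ) u v, B u (r • v) = r * B u v := fun r u v => by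
    simp only [B, map_smul, smul_eq_mul]; ring
  have hB0 : ∀ u, (∀ a : ℝ, a • y ≠ u) → B u u = 0 := fun u hu => by
    have h := hflag x hx y u ((LinearIndependent.pair_iff' hy).2 hu)
    rw [flagCurvature] at h
    -- a vanishing denominator would make the flag curvature zero
    have hden : fundForm (f x) y y y * fundForm (f x) y u u - fundForm (f x) y y u ^ 2 ≠ 0 := by
      intro h0
      rw [h0, div_zero] at h
      exact hκ h.symm
    rw [div_eq_iff hden] at h
    change g u (Rl u) - κ * (g y y * g u u - g y u * g y u) = 0
    change g u (Rl u) = κ * (g y y * g u u - g y u ^ 2) at h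
    rw [h]; ring
  -- on multiples of `y` the form vanishes too, by its values at `w`, `t y + w` and `t y - w`
  obtain ⟨w, hw⟩ : ∃ w : Coord n, ∀ a : ℝ, a • y ≠ w := by
    by_contra! hcon
    have h1 : Submodule.span ℝ {y} = ⊤ := by
      rw [Submodule.eq_top_iff']
      intro w
      exact Submodule.mem_span_singleton.2 (hcon w)
    have h2 := finrank_span_singleton (K := ℝ) hy
    rw [h1, finrank_top, finrank_euclideanSpace_fin] at h2
    omega
  have hBq : ∀ u, B u u = 0 := fun u => by
    by_cases hu : ∀ a : ℝ, a • y ≠ u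
    · exact hB0 u hu
    push Not at hu
    obtain ⟨t, rfl⟩ := hu
    have e1 := hB0 w hw
    have e2 := hB0 (t • y + w) fun a ha => hw (a - t) (by rw [sub_smul, ha]; abel)
    have e3 := hB0 (t • y + (-1 : ℝ) • w) fun a ha => hw (t - a) (by
      rw [sub_smul, ha]; simp)
    simp only [hBadd, hBsymm (_ + _), hBsmul, hBsymm ((-1 : ℝ) • w)] at e2 e3
    rw [hBsymm w y] at e2
    rw [hBsmul]
    linarith
  have hB : ∀ u v, B u v = 0 := fun u v => by
    have := hBq (u + v)
    simp only [hBadd, hBsymm (_ + _), hBq] at this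
    linarith [hBsymm u v]
  have hR : Rl (stdVec k) = κ • (g y y • stdVec k - g y (stdVec k) • y) := by
    rw [← sub_eq_zero]
    by_contra hne
    refine (hM.gForm_pos hy hne).ne' ?_
    rw [← hg]
    set z := Rl (stdVec k) - κ • (g y y • stdVec k - g y (stdVec k) • y)
    have h1 : g z z = B z (stdVec k) := by
      conv_lhs => arg 2; simp only [z]
      simp only [B, map_sub, map_smul, smul_eq_mul]
      rw [hM.gForm_symm hy z y]
      ring
    rw [h1, hB]
  have hdy : (𝒮.dy k 𝒮.E).1 ⟨(x, y), hs⟩ = 2 * g y (stdVec k) := by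
    have h1 := congrArg (evalAt ⟨(x, y), hs⟩) (𝒮.hess_mul_y k)
    rw [hM.gForm_stdVec hy, hG]
    rw [← evalAt_apply, ← h1]
    simp only [map_sum, map_mul, mulVec, dotProduct, Finset.mul_sum]
    refine Finset.sum_congr rfl fun j _ => ?_
    change _ = 2 * ((1 / 2 : ℝ) * _ * _)
    rw [← mul_assoc, ← mul_assoc]
    norm_num
    exact Or.inl rfl
  have hRmk : (𝒮.R m k).1 ⟨(x, y), hs⟩ = Rl (stdVec k) m := by
    rw [hRm]
    simp [stdVec]
  have hE : 𝒮.E.1 ⟨(x, y), hs⟩ = g y y := (hM.gForm_self hy).symm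
  rw [← evalAt_apply, ← evalAt_apply, map_mul, map_mul, map_sub, map_mul, AlgHom.commutes]
  simp only [evalAt_apply, hdy, hRmk, hR, apply_ite (evalAt (S := S) ⟨(x, y), hs⟩), map_mul,
    map_zero, hE, map_ofNat]
  have hym : (𝒮.y m).1 ⟨(x, y), hs⟩ = y m := rfl
  rw [hym]
  by_cases hmk : m = k
  · subst hmk
    simp [stdVec]
    ring
  · simp [stdVec, hmk]
    ring

/-- The Landsberg curvature of a relatively stretch metric of constant flag curvature is
proportional to its Cartan torsion. Contracting the stretch identity with `y^l` kills the terms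
`L_{ijl|k} y^l` and `C_{ijl|k} y^l` and leaves `2 L' = c F L`, while `L' = C'' = -κ F² C`. -/
theorem cartanCoeff_landsbergCoeff (hn : 2 ≤ n) {κ : ℝ} (hκ : κ ≠ 0)
    (hflag : ∀ x ∈ Ω, ∀ y u : Coord n, LinearIndependent ℝ ![y, u] → flagCurvature f x y u = κ)
    {c : Coord n → Coord n → ℝ}
    (hstr : ∀ x ∈ Ω, ∀ y : Coord n, y ≠ 0 → ∀ i j k l : Fin n, stretchCoeff f i j k l x y =
      c x y * f x y * (horizCov f (cartanCoeff f) i j k l x y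
        - horizCov f (cartanCoeff f) i j l k x y))
    {x y : Coord n} (hx : x ∈ Ω) (hy : y ≠ 0) (i j k : Fin n) :
    -2 * κ * f x y ^ 2 * cartanCoeff f i j k x y = c x y * f x y * landsbergCoeff f i j k x y := by
  have hopen : IsOpen (Ω ×ˢ ({0}ᶜ : Set (Coord n))) := hf.isOpen.prod isOpen_compl_zero
  set 𝒮 := hf.sprayAlgebra hopen subset_rfl with h𝒮
  have hR := hf.R_eq_of_flagCurvature_eq hopen subset_rfl hn hκ hflag
  let T : Fin n → Matrix (Fin n) (Fin n) (smoothFun (Ω ×ˢ ({0}ᶜ : Set (Coord n)))) :=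
    fun k => (1 / 4 : ℝ) • 𝒮.C k
  have hC : ∀ i j k, Represents₂ (cartanCoeff f i j k) (T k i j) := fun i j k =>
    hf.represents_cartanCoeff hopen subset_rfl i j k
  have hL : ∀ i j k, Represents₂ (landsbergCoeff f i j k) (𝒮.D T k i j) := fun i j k =>
    hf.represents_sum_horizCov hopen subset_rfl hC i j k
  have hDL : ∀ i j k, Represents₂ (fun x y => ∑ l, horizCov f (landsbergCoeff f) i j k l x y * y l)
      (𝒮.D (𝒮.D T) k i j) := fun i j k =>
    hf.represents_sum_horizCov hopen subset_rfl hL i j k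
  have hT0 : ∑ k, 𝒮.y k • T k = 0 := by
    simp only [T, smul_comm (𝒮.y _), ← Finset.smul_sum, 𝒮.sum_y_smul_C, smul_zero]
  let s₀ : ↥(Ω ×ˢ ({0}ᶜ : Set (Coord n))) := ⟨(x, y), hx, hy⟩
  -- the contraction of the last index of the tensor itself with `y` vanishes
  have hz : ∀ {a : Fin n → Matrix (Fin n) (Fin n) (smoothFun (Ω ×ˢ ({0}ᶜ : Set (Coord n))))}
      {Q : Fin n → Fin n → Fin n → Coord n → Coord n → ℝ}, ∑ k, 𝒮.y k • a k = 0 →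
      (∀ i j k, Represents₂ (Q i j k) (a k i j)) →
      ∑ l, horizCov f Q i j l k x y * y l = 0 := fun {a Q} ha hQ => by
    have h1 := congrArg (fun M => evalAt s₀ (M i j)) (𝒮.sum_y_smul_cov_left ha k)
    simp only [Matrix.sum_apply, Matrix.smul_apply, smul_eq_mul, map_sum, map_mul,
      Matrix.zero_apply, map_zero] at h1
    rw [← h1]
    refine Finset.sum_congr rfl fun l _ => ?_
    rw [mul_comm]
    exact congrArg (y l * ·) (hf.represents_horizCov hopen subset_rfl hQ i j l k ⟨(x, y), hx, hy⟩)
  have h0 := hz hT0 hC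
  have h1 := hz (𝒮.sum_y_smul_D hT0) hL
  have h2 : ∑ l, stretchCoeff f i j k l x y * y l = ∑ l, c x y * f x y *
      (horizCov f (cartanCoeff f) i j k l x y - horizCov f (cartanCoeff f) i j l k x y) * y l :=
    Finset.sum_congr rfl fun l _ => by rw [hstr x hx y hy]
  simp only [stretchCoeff, mul_sub, sub_mul, Finset.sum_sub_distrib, mul_assoc, ← Finset.mul_sum,
    h0, h1] at h2
  have h3 : 𝒮.D (𝒮.D T) k = -(algebraMap ℝ _ κ * 𝒮.E) • T k := by
    have e : 𝒮.D T = fun k => (1 / 4 : ℝ) • 𝒮.D 𝒮.C k := funext fun k => 𝒮.D_smul _ _ k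
    rw [e, 𝒮.D_smul, 𝒮.D_D_C_of_R κ hR, smul_comm]
  have h4 := hDL i j k ⟨(x, y), hx, hy⟩
  simp only [h3] at h4
  have h5 : ((-(algebraMap ℝ _ κ * 𝒮.E) • T k) i j).1 ⟨(x, y), hx, hy⟩ =
      -(κ * f x y ^ 2) * cartanCoeff f i j k x y := by
    rw [hC i j k ⟨(x, y), hx, hy⟩]
    rfl
  rw [h5] at h4
  rw [h4] at h2
  have h6 : landsbergCoeff f i j k x y = ∑ l, horizCov f (cartanCoeff f) i j k l x y * y l := rfl
  rw [h6]
  linear_combination h2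

/-! ### The characteristic scalar along geodesics -/

include hsub

theorem represents_meanCartan (i : Fin n) :
    Represents₂ (fun x y => meanCartan (f x) y (stdVec i))
      ((1 / 2 : ℝ) • (hf.sprayAlgebra hS hsub).tr (hf.sprayAlgebra hS hsub).C i) := fun s => by
  have h1 : meanCartan (f s.1.1) s.1.2 (stdVec i) =
      ∑ j, ∑ k, gramInv (f s.1.1) s.1.2 j k * cartanCoeff f i j k s.1.1 s.1.2 := rfl
  refine h1.trans ?_
  simp only [hf.represents_gramInv hS hsub _ _ s, hf.represents_cartanCoeff hS hsub _ _ _ s]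
  change _ = (1 / 2 : ℝ) * (evalAt s) ((hf.sprayAlgebra hS hsub).tr _ i)
  simp only [SprayAlgebra.tr, Matrix.trace, Matrix.diag, Matrix.mul_apply, map_sum, map_mul,
    Finset.mul_sum]
  refine Finset.sum_congr rfl fun j _ => Finset.sum_congr rfl fun k _ => ?_
  rw [SprayAlgebra.C_symm']
  change (2 : ℝ) * _ * ((1 / 4 : ℝ) * _) = (1 / 2 : ℝ) * (_ * _)
  rw [show (1 / 2 : ℝ) = 2 * (1 / 4) by norm_num, mul_mul_mul_comm]
  rfl

theorem represents_meanCartanNormSq :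
    Represents₂ (fun x y => meanCartanNormSq (f x) y)
      ((1 / 2 : ℝ) • ((hf.sprayAlgebra hS hsub).tr (hf.sprayAlgebra hS hsub).C ⬝ᵥ
        (hf.sprayAlgebra hS hsub).sharp
          ((hf.sprayAlgebra hS hsub).tr (hf.sprayAlgebra hS hsub).C))) := fun s => by
  have hm := fun i => hf.represents_meanCartan hS hsub i s
  beta_reduce at hm
  change meanCartanNormSq (f s.1.1) s.1.2 = (1 / 2 : ℝ) * (evalAt s) _
  simp only [meanCartanNormSq, hm, hf.represents_gramInv hS hsub _ _ s, SprayAlgebra.sharp,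
    dotProduct, mulVec, map_sum, map_mul, Finset.mul_sum]
  refine Finset.sum_congr rfl fun j _ => Finset.sum_congr rfl fun k _ => ?_
  change (2 : ℝ) * evalAt s _ * ((1 / 2 : ℝ) * evalAt s _) * ((1 / 2 : ℝ) * evalAt s _) = _
  ring

theorem represents_meanCartanVec (i : Fin n) :
    Represents₂ (fun x y => meanCartanVec (f x) y i)
      ((hf.sprayAlgebra hS hsub).sharp
        ((hf.sprayAlgebra hS hsub).tr (hf.sprayAlgebra hS hsub).C) i) := fun s => by
  have hm := fun i => hf.represents_meanCartan hS hsub i s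
  beta_reduce at hm
  rw [← evalAt_apply]
  simp only [meanCartanVec, mulVec, dotProduct, hm, hf.represents_gramInv hS hsub _ _ s,
    SprayAlgebra.sharp, map_sum, map_mul]
  refine Finset.sum_congr rfl fun k _ => ?_
  change (2 : ℝ) * evalAt s _ * ((1 / 2 : ℝ) * evalAt s _) = _
  ring

theorem represents_cartan_meanCartanVec :
    let v := (hf.sprayAlgebra hS hsub).sharp
      ((hf.sprayAlgebra hS hsub).tr (hf.sprayAlgebra hS hsub).C)
    Represents₂ (fun x y => cartan (f x) y (meanCartanVec (f x) y) (meanCartanVec (f x) y)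
      (meanCartanVec (f x) y))
      ((1 / 4 : ℝ) • cubicForm (hf.sprayAlgebra hS hsub).C v v v) := fun s => by
  have hM := hf.isMinkowskiNorm (hsub s.2).1
  have hy := (hsub s.2).2
  have hV := fun i => hf.represents_meanCartanVec hS hsub i s
  beta_reduce at hV
  have hexp : ∀ u v w, cartan (f s.1.1) s.1.2 u v w = ∑ k, w k * ∑ i, u i * ∑ j,
      cartanCoeff f i j k s.1.1 s.1.2 * v j := fun u v w => by
    rw [← hM.cForm_apply hy, map_eq_sum_stdVec (hM.cForm hy u v)]
    refine Finset.sum_congr rfl fun k _ => ?_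
    have e1 : hM.cForm hy u v (stdVec k) = (hM.cForm hy).flip v u (stdVec k) := rfl
    congr 1
    rw [← LinearMap.flip_apply (hM.cForm hy u), map_eq_sum_stdVec]
    simp only [LinearMap.flip_apply]
    have e2 : ∀ j, hM.cForm hy u (stdVec j) (stdVec k) =
        ∑ i, u i * hM.cForm hy (stdVec i) (stdVec j) (stdVec k) := fun j => by
      have := map_eq_sum_stdVec (((hM.cForm hy).flip (stdVec j)).flip (stdVec k)) u
      simpa only [LinearMap.flip_apply] using this
    simp only [e2, Finset.mul_sum]
    rw [Finset.sum_comm]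
    refine Finset.sum_congr rfl fun i _ => Finset.sum_congr rfl fun j _ => ?_
    rw [mul_left_comm, mul_comm (v j)]
    rfl
  change cartan (f s.1.1) s.1.2 _ _ _ = (1 / 4 : ℝ) * (evalAt s) _
  simp only [hexp, hV, hf.represents_cartanCoeff hS hsub _ _ _ s, cubicForm, dotProduct, mulVec,
    map_sum, map_mul, Finset.mul_sum]
  refine Finset.sum_congr rfl fun k _ => Finset.sum_congr rfl fun i _ =>
    Finset.sum_congr rfl fun j _ => ?_
  have e : ((1 / 4 : ℝ) • (hf.sprayAlgebra hS hsub).C k i j).1 s =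
      (1 / 4 : ℝ) * evalAt s ((hf.sprayAlgebra hS hsub).C k i j) := rfl
  rw [e]
  simp only [evalAt_apply]
  ring

/-- On the set where the mean Cartan torsion does not vanish, the characteristic scalar is smooth,
and its derivative along the geodesic spray vanishes at every vector at which the Landsberg
curvature is proportional to the Cartan torsion. -/
theorem exists_represents_charScalar (hI : ∀ s ∈ S, meanCartanNormSq (f s.1) s.2 ≠ 0) :
    ∃ a : smoothFun S, Represents₂ (fun x y => charScalar (f x) y) a ∧
      ∀ (s : S) (r : ℝ), (∀ i j k, landsbergCoeff f i j k s.1.1 s.1.2 =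
        r * cartanCoeff f i j k s.1.1 s.1.2) → ((hf.sprayAlgebra hS hsub).X a).1 s = 0 := by
  set 𝒮 := hf.sprayAlgebra hS hsub with h𝒮
  -- `b` is `2 ‖I‖²` and `cub` is `4 C(I, I, I)`, so that `cub / b²` is the quotient in `charScalar`
  set t := 𝒮.tr 𝒮.C with ht
  set v := 𝒮.sharp t with hv
  set b := t ⬝ᵥ v with hb
  have hbrep := hf.represents_meanCartanNormSq hS hsub
  obtain ⟨bi, hbi⟩ : ∃ bi : smoothFun S, b * bi = 1 := exists_mul_eq_one fun s h => by
    apply hI s s.2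
    have h1 := hbrep s
    change meanCartanNormSq (f s.1.1) s.1.2 = (1 / 2 : ℝ) * b.1 s at h1
    rw [h1, h, mul_zero]
  set cub := cubicForm 𝒮.C v v v with hcub
  refine ⟨algebraMap ℝ _ ((n + 1) / (n - 2)) * (1 - cub * bi ^ 2), fun s => ?_, fun s r hr => ?_⟩
  · have h1 := hbrep s
    have h2 := hf.represents_cartan_meanCartanVec hS hsub s
    beta_reduce at h1 h2
    have h3 := congrArg (evalAt s) hbi
    rw [map_mul, map_one] at h3
    change (n + 1 : ℝ) / (n - 2) * (1 - _ / _ ^ 2) = _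
    rw [h1, h2]
    change (n + 1 : ℝ) / (n - 2) * (1 - (1 / 4 : ℝ) * evalAt s cub /
      ((1 / 2 : ℝ) * evalAt s b) ^ 2) =
        (n + 1 : ℝ) / (n - 2) * (1 - evalAt s cub * evalAt s bi ^ 2)
    have hb0 : evalAt s b ≠ 0 := left_ne_zero_of_mul_eq_one h3
    rw [eq_div_of_mul_eq hb0 (by rwa [mul_comm] at h3 : evalAt s bi * evalAt s b = 1)]
    field_simp
    ring
  · set ev : smoothFun S →+* ℝ := (evalAt s : smoothFun S →+* ℝ) with hev
    have hDC : ∀ k, (𝒮.D 𝒮.C k).map ev = r • (𝒮.C k).map ev := fun k => by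
      ext i j
      have e1 := hf.represents_sum_horizCov hS hsub (hf.represents_cartanCoeff hS hsub) i j k s
      rw [show (fun (k i j : Fin n) => (1 / 4 : ℝ) • (hf.sprayAlgebra hS hsub).C k i j) =
        fun k => (1 / 4 : ℝ) • 𝒮.C k from rfl, SprayAlgebra.D_smul] at e1
      have e2 := hr i j k
      rw [hf.represents_cartanCoeff hS hsub i j k s] at e2
      have e3 : (1 / 4 : ℝ) * ev (𝒮.D 𝒮.C k i j) = r * ((1 / 4 : ℝ) * ev (𝒮.C k i j)) :=
        e1.symm.trans e2
      simp only [Matrix.map_apply, Matrix.smul_apply, smul_eq_mul]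
      linarith
    have htr : ∀ k, ev (𝒮.tr (𝒮.D 𝒮.C) k) = r * ev (t k) := fun k => by
      have : ∀ M : Matrix (Fin n) (Fin n) (smoothFun S), ev (𝒮.ginv * M).trace =
          (𝒮.ginv.map ev * M.map ev).trace := fun M => by
        rw [← Matrix.map_mul]
        simp only [Matrix.trace, Matrix.diag, Matrix.map_apply, map_sum]
      rw [ht, SprayAlgebra.tr, this, hDC, Matrix.mul_smul, trace_smul, SprayAlgebra.tr, this,
        smul_eq_mul]
    have hsh : (fun k => ev (𝒮.sharp (𝒮.tr (𝒮.D 𝒮.C)) k)) = r • fun k => ev (v k) := by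
      ext k
      simp only [hv, SprayAlgebra.sharp, mulVec, dotProduct, map_sum, map_mul, htr, Pi.smul_apply,
        smul_eq_mul, Finset.mul_sum]
      exact Finset.sum_congr rfl fun _ _ => by ring
    -- under `L = r C`, the functions `b` and `cub` are eigenfunctions with weights `2 r` and `4 r`
    have hXb : ev (𝒮.X b) = 2 * r * ev b := by
      rw [hb, hv, ht, 𝒮.X_normSq, ← ht, ← hv]
      simp only [dotProduct, map_sum, map_mul, htr, map_ofNat, Finset.mul_sum]
      exact Finset.sum_congr rfl fun _ _ => by ring
    have hXcub : ev (𝒮.X cub) = 4 * r * ev cub := by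
      have h1 := 𝒮.X_cub
      dsimp only at h1
      rw [← ht, ← hv] at h1
      rw [hcub, h1]
      obtain ⟨c1, c2, c3, c4⟩ := cubicForm_smul_cases r (fun k => (𝒮.C k).map ev)
        (fun k => ev (v k))
      simp only [map_add, map_cubicForm, hDC, hsh, c1, c2, c3, c4]
      ring
    have hXbi : ev b * ev (𝒮.X bi) + ev bi * ev (𝒮.X b) = 0 := by
      have h1 := congrArg (fun a => ev (𝒮.X a)) hbi
      simpa using h1
    have hbi' : ev b * ev bi = 1 := by rw [← map_mul, hbi, map_one]
    have hXbi' : ev (𝒮.X bi) = -2 * r * ev bi := by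
      rw [hXb] at hXbi
      linear_combination ev bi * hXbi - ev (𝒮.X bi) * hbi' - 2 * r * ev bi * hbi'
    change ev (𝒮.X _) = 0
    simp only [Derivation.leibniz, Derivation.leibniz_pow, map_sub, Derivation.map_algebraMap,
      Derivation.map_one_eq_zero, smul_eq_mul, map_add, map_mul, hXcub, map_zero, hXbi', map_pow,
      nsmul_eq_mul]
    simp only [map_natCast]
    push_cast
    ring

end IsLocalFinsler

end Finsler

end

noncomputable section

namespace Finsler

/-! ### Charts and the tangent bundle -/

section Charts

variable {n : ℕ} {M : Type*} [TopologicalSpace M] [ChartedSpace (Coord n) M]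
  [IsManifold 𝓘(ℝ, Coord n) ∞ M]

/-- The tangent vector with coordinates `(x, y)` in the chart `e`. -/
def chartLift (e : OpenPartialHomeomorph M (Coord n)) (p : Coord n × Coord n) : TM n M :=
  ⟨e.symm p.1, mfderiv 𝓘(ℝ, Coord n) 𝓘(ℝ, Coord n) e.symm p.1 p.2⟩

/-- The coordinates `(x, y)` of a tangent vector in the chart `e`. -/
def chartCoord (e : OpenPartialHomeomorph M (Coord n)) (v : TM n M) : Coord n × Coord n :=
  (e v.1, mfderiv 𝓘(ℝ, Coord n) 𝓘(ℝ, Coord n) e v.1 v.2)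

theorem contMDiff_mk_modelSpace : ContMDiff 𝓘(ℝ, Coord n × Coord n) 𝓘(ℝ, Coord n).tangent ∞
    (fun p : Coord n × Coord n => (⟨p.1, p.2⟩ : TangentBundle 𝓘(ℝ, Coord n) (Coord n))) := by
  rw [modelWithCornersSelf_prod]
  exact contMDiff_tangentBundleModelSpaceHomeomorph_symm (I := 𝓘(ℝ, Coord n)) (H := Coord n)
    (E := Coord n) (n := ∞)

variable {e : OpenPartialHomeomorph M (Coord n)}
  (he : e ∈ IsManifold.maximalAtlas 𝓘(ℝ, Coord n) ∞ M)

include he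

omit [IsManifold 𝓘(ℝ, Coord n) ∞ M] in
theorem mdifferentiable_of_mem_maximalAtlas :
    e.MDifferentiable 𝓘(ℝ, Coord n) 𝓘(ℝ, Coord n) :=
  ⟨(contMDiffOn_of_mem_maximalAtlas he).mdifferentiableOn (by simp),
    (contMDiffOn_symm_of_mem_maximalAtlas he).mdifferentiableOn (by simp)⟩

theorem contMDiffOn_chartLift : ContMDiffOn 𝓘(ℝ, Coord n × Coord n) 𝓘(ℝ, Coord n).tangent ∞
    (chartLift e) (e.target ×ˢ Set.univ) := by
  have : IsManifold 𝓘(ℝ, Coord n) 1 M :=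
    IsManifold.of_le (n := ∞) (WithTop.coe_le_coe.2 le_top)
  have h1 := (contMDiffOn_symm_of_mem_maximalAtlas he).contMDiffOn_tangentMapWithin (m := ∞)
    (by simp) e.open_target.uniqueMDiffOn
  have h2 : ContMDiffOn 𝓘(ℝ, Coord n × Coord n) 𝓘(ℝ, Coord n).tangent ∞
      (fun p : Coord n × Coord n => (⟨p.1, p.2⟩ : TangentBundle 𝓘(ℝ, Coord n) (Coord n)))
      (e.target ×ˢ Set.univ) := contMDiff_mk_modelSpace.contMDiffOn
  refine (h1.comp h2 fun p hp => hp.1).congr fun p hp => ?_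
  simp only [chartLift, Function.comp, tangentMapWithin]
  rw [mfderivWithin_of_isOpen e.open_target hp.1]

theorem contMDiffOn_chartCoord : ContMDiffOn 𝓘(ℝ, Coord n).tangent 𝓘(ℝ, Coord n × Coord n) ∞
    (chartCoord e) {v : TM n M | v.1 ∈ e.source} := by
  have : IsManifold 𝓘(ℝ, Coord n) 1 M :=
    IsManifold.of_le (n := ∞) (WithTop.coe_le_coe.2 le_top)
  have h1 := (contMDiffOn_of_mem_maximalAtlas he).contMDiffOn_tangentMapWithin (m := ∞)
    (by simp) e.open_source.uniqueMDiffOn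
  have h2 : ContMDiffOn 𝓘(ℝ, Coord n).tangent 𝓘(ℝ, Coord n) ∞ (fun v : TM n M => e v.1)
      {v : TM n M | v.1 ∈ e.source} :=
    (contMDiffOn_of_mem_maximalAtlas he).comp
      (Bundle.contMDiff_proj (TangentSpace 𝓘(ℝ, Coord n))).contMDiffOn fun v hv => hv
  have h3 := (contMDiff_snd_tangentBundle_modelSpace (n := ∞) (Coord n)
    𝓘(ℝ, Coord n)).comp_contMDiffOn h1
  refine (h2.prodMk_space (h3.congr fun v hv => ?_))
  simp only [Function.comp, tangentMapWithin]
  rw [mfderivWithin_of_isOpen e.open_source hv]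

theorem chartLift_chartCoord {v : TM n M} (hv : v.1 ∈ e.source) :
    chartLift e (chartCoord e v) = v := by
  obtain ⟨x, y⟩ := v
  have h := (mdifferentiable_of_mem_maximalAtlas he).symm_comp_deriv hv
  have h1 : mfderiv 𝓘(ℝ, Coord n) 𝓘(ℝ, Coord n) e.symm (e x)
      (mfderiv 𝓘(ℝ, Coord n) 𝓘(ℝ, Coord n) e x y) = y := congrArg (fun L => L y) h
  have h2 : e.symm (e x) = x := e.left_inv hv
  exact congrArg₂ (fun (x' : M) (y' : Coord n) => (⟨x', y'⟩ : TM n M)) h2 h1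

omit [IsManifold 𝓘(ℝ, Coord n) ∞ M] in
/-- The derivative of an inverse chart, as a linear automorphism of the model space. -/
theorem exists_mfderiv_symm_eq {x : Coord n} (hx : x ∈ e.target) :
    ∃ A : Coord n ≃ₗ[ℝ] Coord n, ∀ y : Coord n,
      A y = (mfderiv 𝓘(ℝ, Coord n) 𝓘(ℝ, Coord n) e.symm x y : Coord n) := by
  have h := (mdifferentiable_of_mem_maximalAtlas he).symm.mfderiv_bijective (x := x) hx
  exact ⟨LinearEquiv.ofBijective
    (LinearMap.mk (AddHom.mk (fun y : Coord n =>
      (mfderiv 𝓘(ℝ, Coord n) 𝓘(ℝ, Coord n) e.symm x y : Coord n)) (fun u v => map_add _ u v))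
      (fun r v => map_smul _ r v)) h, fun y => rfl⟩

end Charts

/-! ### Finsler metrics in charts -/

section Metric

variable {n : ℕ} {M : Type*} [TopologicalSpace M] [ChartedSpace (Coord n) M]
  [IsManifold 𝓘(ℝ, Coord n) ∞ M] {F : TM n M → ℝ} (hF : IsFinslerMetric F)
  {e : OpenPartialHomeomorph M (Coord n)}
  (he : e ∈ IsManifold.maximalAtlas 𝓘(ℝ, Coord n) ∞ M)

include hF he

/-- The local expression of a Finsler metric in a chart is a Finsler metric over the target of the
chart. -/
theorem IsFinslerMetric.isLocalFinsler : IsLocalFinsler (inChart e F) e.target where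
  isOpen := e.open_target
  smooth := by
    have h1 : ContMDiffOn 𝓘(ℝ, Coord n × Coord n) 𝓘(ℝ, ℝ) ∞ (F ∘ chartLift e)
        (e.target ×ˢ {0}ᶜ) := by
      refine hF.smooth.comp ((contMDiffOn_chartLift he).mono
        (Set.prod_mono subset_rfl (Set.subset_univ _))) fun p hp => ?_
      obtain ⟨A, hA⟩ := exists_mfderiv_symm_eq he hp.1
      change (mfderiv 𝓘(ℝ, Coord n) 𝓘(ℝ, Coord n) e.symm p.1 p.2 : Coord n) ≠ 0
      rw [← hA]
      exact fun h => hp.2 ((LinearEquiv.map_eq_zero_iff A).1 h)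
    exact h1.contDiffOn
  homog x hx y r hr := by
    obtain ⟨A, hA⟩ := exists_mfderiv_symm_eq he hx
    have h := hF.homog (e.symm x) (A y) r hr
    simp only [inChart]
    have h2 : (mfderiv 𝓘(ℝ, Coord n) 𝓘(ℝ, Coord n) e.symm x (r • y)) =
      r • mfderiv 𝓘(ℝ, Coord n) 𝓘(ℝ, Coord n) e.symm x y := map_smul _ r y
    rw [h2]
    exact hF.homog _ _ _ hr
  posDef x hx y u hy hu := by
    obtain ⟨A, hA⟩ := exists_mfderiv_symm_eq he hx
    have h1 : inChart e F x = fun z => fibre F (e.symm x) (A.toLinearMap z) := by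
      ext z
      simp only [inChart, fibre, LinearEquiv.coe_coe, hA]
    rw [h1, fundForm_comp]
    exact hF.posDef _ _ _ (fun h => hy ((LinearEquiv.map_eq_zero_iff A).1 h))
      (fun h => hu ((LinearEquiv.map_eq_zero_iff A).1 h))

omit he in
theorem IsFinslerMetric.isMinkowskiNorm (x : M) : IsMinkowskiNorm (fibre F x) := by
  have he := IsManifold.chart_mem_maximalAtlas (I := 𝓘(ℝ, Coord n)) (n := ∞) x
  set e := chartAt (Coord n) x
  have hx : e x ∈ e.target := mem_chart_target _ x
  obtain ⟨A, hA⟩ := exists_mfderiv_symm_eq he hx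
  have hM := (hF.isLocalFinsler he).isMinkowskiNorm hx
  have h1 : fibre F x = fun z => inChart e F (e x) (A.symm z) := by
    ext z
    simp only [inChart, fibre]
    rw [← hA, A.apply_symm_apply]
    rw [show e.symm (e x) = x from e.left_inv (mem_chart_source _ x)]
  refine ⟨?_, fun y r hr => hF.homog x y r hr, fun y u hy hu => hF.posDef x y u hy hu⟩
  rw [h1]
  refine hM.smooth.comp (s := {0}ᶜ) (f := fun z => A.symm z)
    (LinearMap.toContinuousLinearMap A.symm.toLinearMap).contDiff.contDiffOn fun y hy => ?_
  exact fun h => hy ((LinearEquiv.map_eq_zero_iff A.symm).1 h)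

end Metric

end Finsler

end

noncomputable section

namespace Finsler

/-! ### `(α,β)`-metrics -/

section AlphaBeta

variable {n : ℕ} {M : Type*} [TopologicalSpace M] [ChartedSpace (Coord n) M]
  [IsManifold 𝓘(ℝ, Coord n) ∞ M] {F : TM n M → ℝ} (hF : IsFinslerMetric F)

include hF

theorem IsFinslerMetric.meanCartanNormSq_ne_zero {v : TM n M} (hv : v ∈ torsionSet F) :
    meanCartanNormSq (fibre F v.1) v.2 ≠ 0 :=
  ((hF.isMinkowskiNorm v.1).meanCartanNormSq_ne_zero_iff hv.1).2 hv.2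

omit hF in
/-- A Riemannian metric at one point, as a bilinear form on the model space. -/
theorem exists_bilin_eq_inner (a : RiemMetric n M) (x : M) : ∃ b : Coord n →ₗ[ℝ] Coord n →ₗ[ℝ] ℝ,
    ∀ u w : Coord n, b u w = a.inner x u w :=
  ⟨LinearMap.mk₂ ℝ (fun u w : Coord n => (a.inner x u w : ℝ))
    (fun u u' w => DFunLike.congr_fun (map_add (a.inner x) u u') w)
    (fun r u w => DFunLike.congr_fun (map_smul (a.inner x) r u) w)
    (fun u w w' => map_add (a.inner x u) w w')
    (fun r u w => map_smul (a.inner x u) r w), fun _ _ => rfl⟩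

omit hF in
theorem IsAlphaBetaMetric.exists_fibre_eq (hαβ : IsAlphaBetaMetric F) (x : M) :
    ∃ (b : Coord n →ₗ[ℝ] Coord n →ₗ[ℝ] ℝ) (β : Coord n →ₗ[ℝ] ℝ) (φ : ℝ → ℝ),
      (∀ u v, b u v = b v u) ∧ (∀ u, u ≠ 0 → 0 < b u u) ∧
        ∀ u, u ≠ 0 → fibre F x u = √(b u u) * φ (β u / √(b u u)) := by
  obtain ⟨a, β, b₀, φ, -, -, -, -, -, hFφ⟩ := hαβ
  obtain ⟨b, hb⟩ := exists_bilin_eq_inner a x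
  have h1 : ∀ u v, b u v = b v u := fun u w => by rw [hb, hb]; exact a.symm x u w
  have h2 : ∀ u, u ≠ 0 → 0 < b u u := fun u hu => by rw [hb]; exact a.pos x u hu
  refine ⟨b, LinearMap.mk (AddHom.mk (fun u : Coord n => β x u) fun u w => map_add (β x) u w)
    fun r u => map_smul (β x) r u, φ, h1, h2, fun u hu => ?_⟩
  rw [hb]
  exact hFφ ⟨x, u⟩ hu

/-- An `(α,β)`-metric is semi-C-reducible on each tangent space, since there it is invariant under the
`α`-isometries that preserve `β`. -/
theorem IsAlphaBetaMetric.exists_semiCReducibleAt (hαβ : IsAlphaBetaMetric F) {x : M} {y : Coord n}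
    (hy : y ≠ 0) (hI : meanCartanNormSq (fibre F x) y ≠ 0) :
    ∃ p q : ℝ, SemiCReducibleAt (fibre F x) y p q := by
  obtain ⟨b, β, φ, hb, hbpos, hf⟩ := hαβ.exists_fibre_eq x
  refine (hF.isMinkowskiNorm x).exists_semiCReducibleAt_of_invariant hy b hb hbpos β
    (fun R h1 h2 u => ?_) hI
  by_cases hu : u = 0
  · rw [hu, map_zero]
  have hRu : R u ≠ 0 := fun h0 => by
    have := h1 u
    rw [h0, map_zero] at this
    exact (hbpos u hu).ne this
  rw [hf u hu, hf _ hRu, h1, h2]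

theorem IsAlphaBetaMetric.exists_isSemiCReducible (hαβ : IsAlphaBetaMetric F) :
    ∃ p q : TM n M → ℝ, IsSemiCReducible F p q := by
  have key : ∀ v : TM n M, ∃ p q : ℝ, v ∈ torsionSet F →
      SemiCReducibleAt (fibre F v.1) v.2 p q := fun v => by
    by_cases hv : v ∈ torsionSet F
    · obtain ⟨p, q, h⟩ := hαβ.exists_semiCReducibleAt hF hv.1 (hF.meanCartanNormSq_ne_zero hv)
      exact ⟨p, q, fun _ => h⟩
    · -- off the torsion set the values of `p` and `q` are irrelevant
      exact ⟨0, 0, fun h => absurd h hv⟩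
  choose p q h using key
  exact ⟨p, q, fun v hv => h v hv⟩

end AlphaBeta

/-! ### The characteristic scalar in charts -/

section CharacteristicScalar

variable {n : ℕ} {M : Type*} [TopologicalSpace M] [ChartedSpace (Coord n) M]
  [IsManifold 𝓘(ℝ, Coord n) ∞ M] {F : TM n M → ℝ} (hF : IsFinslerMetric F)
  {e : OpenPartialHomeomorph M (Coord n)}
  (he : e ∈ IsManifold.maximalAtlas 𝓘(ℝ, Coord n) ∞ M)

/-- The coordinates, in the chart `e`, of the nonzero tangent vectors at which the mean Cartan
torsion does not vanish. -/
def torsionCoordSet (F : TM n M → ℝ) (e : OpenPartialHomeomorph M (Coord n)) :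
    Set (Coord n × Coord n) :=
  {s | s ∈ e.target ×ˢ {0}ᶜ ∧ meanCartanNormSq (inChart e F s.1) s.2 ≠ 0}

theorem torsionCoordSet_subset : torsionCoordSet F e ⊆ e.target ×ˢ {0}ᶜ := fun _ hs => hs.1

include hF he

theorem isOpen_torsionCoordSet : IsOpen (torsionCoordSet F e) := by
  have hS : IsOpen (e.target ×ˢ {0}ᶜ : Set (Coord n × Coord n)) :=
    e.open_target.prod isOpen_compl_zero
  have h := ((hF.isLocalFinsler he).represents_meanCartanNormSq hS subset_rfl).uncurry
  exact h.contDiffOn.continuousOn.isOpen_inter_preimage hS isOpen_compl_singleton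

theorem mem_torsionCoordSet_iff {s : Coord n × Coord n} (hs : s.1 ∈ e.target) :
    s ∈ torsionCoordSet F e ↔ chartLift e s ∈ torsionSet F := by
  obtain ⟨A, hA⟩ := exists_mfderiv_symm_eq he hs
  have h1 : inChart e F s.1 = fun z => fibre F (e.symm s.1) (A z) := by
    ext z
    simp only [inChart, fibre, hA]
  have hM := hF.isMinkowskiNorm (e.symm s.1)
  have h2 : A s.2 ≠ 0 ↔ s.2 ≠ 0 := (LinearEquiv.map_eq_zero_iff A).not
  have h3 : chartLift e s = ⟨e.symm s.1, A s.2⟩ := by rw [hA]; rfl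
  rw [h3]
  constructor
  · rintro ⟨⟨-, h0⟩, h⟩
    have h0' := h2.2 h0
    rw [h1, hM.meanCartanNormSq_comp h0' A rfl, hM.meanCartanNormSq_ne_zero_iff h0'] at h
    exact ⟨h0', h⟩
  · rintro ⟨h0, h⟩
    change A s.2 ≠ 0 at h0
    refine ⟨⟨hs, h2.1 h0⟩, ?_⟩
    rw [h1, hM.meanCartanNormSq_comp h0 A rfl, hM.meanCartanNormSq_ne_zero_iff h0]
    exact h

variable {p q : TM n M → ℝ} (hpq : IsSemiCReducible F p q) (hn : 3 ≤ n)

include hpq hn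

theorem inChart_eq_charScalar {s : Coord n × Coord n} (hs : s ∈ torsionCoordSet F e) :
    inChart e p s.1 s.2 = charScalar (inChart e F s.1) s.2 := by
  obtain ⟨A, hA⟩ := exists_mfderiv_symm_eq he hs.1.1
  have h1 : inChart e F s.1 = fun z => fibre F (e.symm s.1) (A z) := by
    ext z
    simp only [inChart, fibre, hA]
  have hM := hF.isMinkowskiNorm (e.symm s.1)
  have hv := (mem_torsionCoordSet_iff hF he hs.1.1).1 hs
  have h2 : SemiCReducibleAt (fibre F (e.symm s.1)) (A s.2) (p (chartLift e s))
      (q (chartLift e s)) := by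
    have := hpq _ hv
    rw [hA]
    exact this
  have h0 : A s.2 ≠ 0 := by rw [hA]; exact hv.1
  have h3 := hM.semiCReducibleAt_comp h0 A rfl h2
  rw [← h1] at h3
  exact ((hF.isLocalFinsler he).isMinkowskiNorm hs.1.1).eq_charScalar hs.1.2 hn hs.2 h3

variable {κ : ℝ} (hκ : κ ≠ 0) (hflag : HasConstantFlagCurvature F κ) {c : TM n M → ℝ}
  (hstretch : HasRelativeStretchCurvature F c)

/-- In every chart, the characteristic scalar is smooth on the coordinate torsion set. -/
theorem contDiffOn_inChart :
    ContDiffOn ℝ ∞ (fun s : Coord n × Coord n => inChart e p s.1 s.2) (torsionCoordSet F e) := by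
  obtain ⟨a, ha, -⟩ := (hF.isLocalFinsler he).exists_represents_charScalar
    (isOpen_torsionCoordSet hF he) torsionCoordSet_subset fun s hs => hs.2
  exact ha.uncurry.contDiffOn.congr fun s hs => inChart_eq_charScalar hF he hpq hn hs

include hκ hflag hstretch

/-- Where the Cartan torsion does not vanish, the Landsberg curvature is proportional to it with the
factor `-2κF/c`, so that the geodesic derivative of the characteristic scalar vanishes. -/
theorem geodesicDeriv_inChart {s : Coord n × Coord n} (hs : s ∈ torsionCoordSet F e) :
    geodesicDeriv (inChart e F) (inChart e p) s.1 s.2 = 0 := by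
  have hf := hF.isLocalFinsler he
  have hS := isOpen_torsionCoordSet hF he
  obtain ⟨a, ha, hXa⟩ := hf.exists_represents_charScalar hS torsionCoordSet_subset
    fun s hs => hs.2
  have hpa : Represents₂ (inChart e p) a := fun s =>
    (inChart_eq_charScalar hF he hpq hn s.2).trans (ha s)
  rw [hf.represents_geodesicDeriv hS torsionCoordSet_subset hpa ⟨s, hs⟩]
  have hx : s.1 ∈ e.target := hs.1.1
  have hM := hf.isMinkowskiNorm hx
  have hrel := hf.cartanCoeff_landsbergCoeff (by omega) hκ
    (fun x hx y u h => hflag e he x hx y u h) (fun x hx y hy => hstretch e he x hx y hy) hx hs.1.2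
  have hF0 : inChart e F s.1 s.2 ≠ 0 := hM.ne_zero hs.1.2
  have hc0 : inChart e c s.1 s.2 ≠ 0 := fun h0 => by
    have hC : ∀ i j k, cartanCoeff (inChart e F) i j k s.1 s.2 = 0 := fun i j k => by
      have h1 := hrel i j k
      rw [h0, zero_mul, zero_mul] at h1
      exact (mul_eq_zero.1 h1).resolve_left
        (mul_ne_zero (mul_ne_zero (by norm_num) hκ) (pow_ne_zero 2 hF0))
    apply hs.2
    have hI : ∀ i, meanCartan (inChart e F s.1) s.2 (stdVec i) = 0 := fun i =>
      Finset.sum_eq_zero fun j _ => Finset.sum_eq_zero fun k _ => by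
        rw [show cartan (inChart e F s.1) s.2 (stdVec i) (stdVec j) (stdVec k) = 0 from hC i j k,
          mul_zero]
    simp only [meanCartanNormSq, hI, mul_zero, Finset.sum_const_zero]
  refine hXa ⟨s, hs⟩ (-2 * κ * inChart e F s.1 s.2 / inChart e c s.1 s.2) fun i j k => ?_
  have h1 := hrel i j k
  field_simp
  apply mul_left_cancel₀ hF0
  linear_combination -h1

omit hκ hflag hstretch he

theorem contMDiffOn_of_isSemiCReducible :
    ContMDiffOn 𝓘(ℝ, Coord n).tangent 𝓘(ℝ, ℝ) ∞ p (torsionSet F) := by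
  intro v hv
  have he := IsManifold.chart_mem_maximalAtlas (I := 𝓘(ℝ, Coord n)) (n := ∞) v.1
  set e := chartAt (Coord n) v.1
  have hve : v.1 ∈ e.source := mem_chart_source _ _
  have hopen : IsOpen {w : TM n M | w.1 ∈ e.source} :=
    e.open_source.preimage (FiberBundle.continuous_proj _ _)
  have h1 := contMDiffOn_chartCoord he
  have h2 : chartCoord e v ∈ torsionCoordSet F e := by
    rw [mem_torsionCoordSet_iff hF he (e.map_source hve), chartLift_chartCoord he hve]
    exact hv
  have h3 := ((contDiffOn_inChart hF he hpq hn).contDiffAt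
    ((isOpen_torsionCoordSet hF he).mem_nhds h2)).contMDiffAt
  have h4 := h3.comp v (h1.contMDiffAt (hopen.mem_nhds hve))
  refine ContMDiffAt.contMDiffWithinAt (h4.congr_of_eventuallyEq ?_)
  filter_upwards [hopen.mem_nhds hve] with w hw
  change p w = p (chartLift e (chartCoord e w))
  rw [chartLift_chartCoord he hw]

end CharacteristicScalar

end Finsler

end

noncomputable section

namespace Finsler

open Topology

/-! ### Geodesics -/

section Geodesics

variable {n : ℕ} {M : Type*} [TopologicalSpace M] [ChartedSpace (Coord n) M]
  [IsManifold 𝓘(ℝ, Coord n) ∞ M] {F : TM n M → ℝ} {σ : ℝ → M} {J : Set ℝ}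
  {e : OpenPartialHomeomorph M (Coord n)}
  (he : e ∈ IsManifold.maximalAtlas 𝓘(ℝ, Coord n) ∞ M)

/-- The derivative of a function `φ(x, y)` along the natural lift of a solution of
`γ'' + 2G(γ, γ') = 0`. -/
theorem IsLocalFinsler.hasDerivAt_comp_geodesic {f : Coord n → Coord n → ℝ} {Ω : Set (Coord n)}
    (hf : IsLocalFinsler f Ω) {S : Set (Coord n × Coord n)} (hS : IsOpen S)
    (hsub : S ⊆ Ω ×ˢ {0}ᶜ) {φ : Coord n → Coord n → ℝ} {a : smoothFun S} (h : Represents₂ φ a)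
    {γ : ℝ → Coord n} {t : ℝ} (hγ : DifferentiableAt ℝ γ t) (hγ' : DifferentiableAt ℝ (deriv γ) t)
    (hs : (γ t, deriv γ t) ∈ S)
    (hgeo : ∀ i, deriv (deriv γ) t i + 2 * sprayCoeff f i (γ t) (deriv γ t) = 0) :
    HasDerivAt (fun s => φ (γ s) (deriv γ s)) (geodesicDeriv f φ (γ t) (deriv γ t)) t := by
  set s : S := ⟨(γ t, deriv γ t), hs⟩ with hsdef
  have hd := (h.uncurry.differentiableAt hS hs).hasFDerivAt
  have h1 := hd.comp_hasDerivAt t (hγ.hasDerivAt.prodMk hγ'.hasDerivAt)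
  refine h1.congr_deriv ?_
  have hX := hf.represents_geodesicDeriv hS hsub h s
  refine Eq.trans ?_ hX.symm
  rw [← evalAt_apply, SprayAlgebra.X_apply]
  have h2 : (deriv γ t, deriv (deriv γ) t) = ∑ i, (deriv γ t i • ((stdVec i, 0) : Coord n × Coord n)
      + (-2 * sprayCoeff f i (γ t) (deriv γ t)) • (0, stdVec i)) := by
    have h3 : ∀ i, -2 * sprayCoeff f i (γ t) (deriv γ t) = deriv (deriv γ) t i := fun i => by
      linarith [hgeo i]
    simp only [h3]
    ext1
    · simp [Prod.fst_sum]; exact (sum_stdVec _).symm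
    · simp [Prod.snd_sum]; exact (sum_stdVec _).symm
  rw [h2, map_sum]
  have e1 : ∀ v, fderiv ℝ (fun p : Coord n × Coord n => φ p.1 p.2) (γ t, deriv γ t) v =
      (dirDeriv hS v a).1 s := fun v => h.uncurry.dirDeriv_eq_fderiv hS v s
  have e2 : ∀ i, sprayCoeff f i (γ t) (deriv γ t) = ((hf.sprayAlgebra hS hsub).G i).1 s :=
    fun i => hf.represents_sprayCoeff hS hsub i s
  simp only [map_add, map_smul, smul_eq_mul]
  simp only [e1, e2]
  simp only [map_sub, map_sum, map_mul, map_ofNat, evalAt_apply]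
  rw [Finset.sum_add_distrib, Finset.mul_sum, sub_eq_add_neg, ← Finset.sum_neg_distrib]
  congr 1
  refine Finset.sum_congr rfl fun i _ => ?_
  rw [neg_mul, neg_mul, mul_assoc]
  rfl

include he

omit [IsManifold 𝓘(ℝ, Coord n) ∞ M] in
theorem contDiffAt_chart_comp (hσ : ContMDiffOn 𝓘(ℝ, ℝ) 𝓘(ℝ, Coord n) 2 σ J) (hJ : IsOpen J)
    {t : ℝ} (ht : t ∈ J) (hte : σ t ∈ e.source) : ContDiffAt ℝ 2 (fun s => e (σ s)) t :=
  (((contMDiffOn_of_mem_maximalAtlas he).of_le (WithTop.coe_le_coe.2 le_top)).contMDiffAt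
    (e.open_source.mem_nhds hte) |>.comp t (hσ.contMDiffAt (hJ.mem_nhds ht))).contDiffAt

/-- The velocity of a curve has the coordinates `(γ, γ')`, where `γ` is the curve in the chart. -/
theorem chartCoord_velocity (hσ : MDifferentiableAt 𝓘(ℝ, ℝ) 𝓘(ℝ, Coord n) σ t)
    (hte : σ t ∈ e.source) :
    chartCoord e (velocity σ t) = (e (σ t), deriv (fun s => e (σ s)) t) := by
  have h1 := mfderiv_comp t ((mdifferentiable_of_mem_maximalAtlas he).mdifferentiableAt hte) hσ
  have h2 : mfderiv 𝓘(ℝ, ℝ) 𝓘(ℝ, Coord n) (e ∘ σ) t (1 : ℝ) = deriv (fun s => e (σ s)) t := by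
    rw [mfderiv_eq_fderiv]
    rfl
  refine Prod.ext rfl ?_
  rw [← h2, h1]
  rfl

end Geodesics

section Constancy

variable {n : ℕ} {M : Type*} [TopologicalSpace M] [ChartedSpace (Coord n) M]
  [IsManifold 𝓘(ℝ, Coord n) ∞ M] {F : TM n M → ℝ} (hF : IsFinslerMetric F)
  {p q : TM n M → ℝ} (hpq : IsSemiCReducible F p q) (hn : 3 ≤ n) {κ : ℝ} (hκ : κ ≠ 0)
  (hflag : HasConstantFlagCurvature F κ) {c : TM n M → ℝ}
  (hstretch : HasRelativeStretchCurvature F c) {σ : ℝ → M} {J : Set ℝ}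
  (hσ : IsGeodesicOn F σ J) (hU : ∀ t ∈ J, velocity σ t ∈ torsionSet F)

include hF hpq hn hκ hflag hstretch hσ hU

theorem hasDerivAt_velocity {t : ℝ} (ht : t ∈ J) :
    HasDerivAt (fun s => p (velocity σ s)) 0 t := by
  have he := IsManifold.chart_mem_maximalAtlas (I := 𝓘(ℝ, Coord n)) (n := ∞) (σ t)
  set e := chartAt (Coord n) (σ t)
  have hte : σ t ∈ e.source := mem_chart_source _ _
  have hcont := hσ.contMDiffOn.contMDiffAt (hσ.isOpen.mem_nhds ht)
  have hγ := contDiffAt_chart_comp he hσ.contMDiffOn hσ.isOpen ht hte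
  have hnear : ∀ᶠ s in 𝓝 t, s ∈ J ∧ σ s ∈ e.source :=
    (hσ.isOpen.eventually_mem ht).and
      (hcont.continuousAt.eventually (e.open_source.eventually_mem hte))
  have hcoord : ∀ s, s ∈ J → σ s ∈ e.source →
      chartCoord e (velocity σ s) = (e (σ s), deriv (fun s => e (σ s)) s) := fun s hs hse =>
    chartCoord_velocity he ((hσ.contMDiffOn.contMDiffAt (hσ.isOpen.mem_nhds hs)).mdifferentiableAt
      (by simp)) hse
  have hmem : (e (σ t), deriv (fun s => e (σ s)) t) ∈ torsionCoordSet F e := by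
    rw [← hcoord t ht hte, mem_torsionCoordSet_iff hF he (e.map_source hte),
      chartLift_chartCoord he hte]
    exact hU t ht
  have hf := hF.isLocalFinsler he
  have h1 := hf.hasDerivAt_comp_geodesic (isOpen_torsionCoordSet hF he) torsionCoordSet_subset
    (φ := inChart e p) (a := smoothFun.mk _ (contDiffOn_inChart hF he hpq hn)) (fun _ => rfl)
    (hγ.differentiableAt (by simp))
    ((((hγ.fderiv_right (m := 1) (by norm_num)).clm_apply
      (contDiffAt_const (c := (1 : ℝ)))).differentiableAt (by simp))) hmem (hσ.geodesic_eq e he t ht hte)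
  rw [geodesicDeriv_inChart hF he hpq hn hκ hflag hstretch hmem] at h1
  refine h1.congr_of_eventuallyEq ?_
  filter_upwards [hnear] with s hs
  change _ = p (chartLift e (e (σ s), deriv (fun s => e (σ s)) s))
  rw [← hcoord s hs.1 hs.2, chartLift_chartCoord he hs.2]

/-- The characteristic scalar is constant along geodesics. -/
theorem velocity_eq_of_isGeodesicOn {s t : ℝ} (hs : s ∈ J) (ht : t ∈ J) :
    p (velocity σ s) = p (velocity σ t) := by
  have hd := fun t (ht : t ∈ J) =>
    hasDerivAt_velocity hF hpq hn hκ hflag hstretch hσ hU ht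
  exact hσ.isOpen.is_const_of_deriv_eq_zero hσ.ordConnected.isPreconnected
    (fun t ht => (hd t ht).differentiableAt.differentiableWithinAt) (fun t ht => (hd t ht).deriv)
    hs ht

end Constancy

end Finsler

end

theorem theorem1p2 {n : ℕ} (hn : 3 ≤ n) {M : Type*} [TopologicalSpace M]
    [ChartedSpace (Finsler.Coord n) M] [IsManifold 𝓘(ℝ, Finsler.Coord n) ∞ M]
    (F : Finsler.TM n M → ℝ) (hF : Finsler.IsFinslerMetric F)
    (hαβ : Finsler.IsAlphaBetaMetric F) (hnR : ¬ Finsler.IsRiemannian F)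
    (κ : ℝ) (hκ : κ ≠ 0) (hflag : Finsler.HasConstantFlagCurvature F κ)
    (c : Finsler.TM n M → ℝ) (hc : ∃ v : Finsler.TM n M, v.2 ≠ 0 ∧ c v ≠ 0)
    (hstretch : Finsler.HasRelativeStretchCurvature F c) :
    (∃ p q : Finsler.TM n M → ℝ, Finsler.IsSemiCReducible F p q) ∧
    ∀ p q : Finsler.TM n M → ℝ, Finsler.IsSemiCReducible F p q →
      ContMDiffOn 𝓘(ℝ, Finsler.Coord n).tangent 𝓘(ℝ, ℝ) ∞ p (Finsler.torsionSet F) ∧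
      (∀ e ∈ IsManifold.maximalAtlas 𝓘(ℝ, Finsler.Coord n) ∞ M, ∀ v ∈ Finsler.torsionSet F,
        ∀ x ∈ e.target, ∀ y : Finsler.Coord n,
          v = ⟨e.symm x, mfderiv 𝓘(ℝ, Finsler.Coord n) 𝓘(ℝ, Finsler.Coord n) e.symm x y⟩ →
          Finsler.geodesicDeriv (Finsler.inChart e F) (Finsler.inChart e p) x y = 0) ∧
      ∀ (σ : ℝ → M) (J : Set ℝ), Finsler.IsGeodesicOn F σ J →
        (∀ t ∈ J, Finsler.velocity σ t ∈ Finsler.torsionSet F) →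
        ∀ s ∈ J, ∀ t ∈ J, p (Finsler.velocity σ s) = p (Finsler.velocity σ t) := by
  refine ⟨hαβ.exists_isSemiCReducible hF, fun p q hpq =>
    ⟨Finsler.contMDiffOn_of_isSemiCReducible hF hpq hn, fun e he v hv x hx y hvxy => ?_,
      fun σ J hσ hU s hs t ht =>
        Finsler.velocity_eq_of_isGeodesicOn hF hpq hn hκ hflag hstretch hσ hU hs ht⟩⟩
  have h : Finsler.chartLift e (x, y) = v := hvxy.symm
  exact Finsler.geodesicDeriv_inChart (s := (x, y)) hF he hpq hn hκ hflag hstretch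
    ((Finsler.mem_torsionCoordSet_iff hF he hx).2 (h ▸ hv))
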